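/- A billiard table is given in polar coordinates by a positive $2\pi$-periodic $C^2$ function $\rho$ such that the domain $\{r\le\rho(\theta)\}$ is strictly convex. Describe a state of the billiard by $(\theta,v)$, where $\theta$ is the polar angle of a boundary point and $v\in(0,\pi)$ is the angle between the outgoing ray and the positive (counterclockwise) tangent. The table has a $p/q$ caustic if there is a continuous $2\pi$-periodic function $g:\mathbb R\to(0,\pi)$ whose graph $\{v=g(\theta)\}$ is invariant under the billiard map and consists of periodic orbits of rotation number $p/q$ (each orbit closes up after $q$ reflections, winding $p$ times around the boundary). Let $n:\mathbb R\to\mathbb R$ be a $2\pi$-periodic, even, real-analytic function with Fourier series $n(\theta)=\sum_{k\in\mathbb Z}n_ke^{ik\theta}$, normalized by $$\sup_\theta|n(\theta)|=1,\qquad n(0)=n'(0)=0,\qquad \int_0^{2\pi}n(\theta)\,d\theta=0 .$$ Suppose that there is a modular function $w:\mathbb Z\to(0,\infty)$ of $n$, that is, $w(-k)=w(k)$ and $|n_k|\le e^{-w(k)}$ for all $k\in\mathbb Z$, and there are positive integers $k_1<k_2<\cdots$ for which the limit $$\lim_{i\to\infty}\frac{|n_{k_i}|}{e^{-w(k_i)}}$$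 exists and is positive and finite; and suppose that $$\lim_{i\to+\infty}\frac{w(i)}{2^i}=\infty .$$ Then for every $K\ge 0$ there is $\varepsilon_0=\varepsilon_0(n,K)>0$ such that the following holds. Let $m:\mathbb R\to\mathbb R$ be $2\pi$-periodic and Lipschitz with constant $K$, with $|m|\le K$, and let $$r_\varepsilon(\theta)=1+\varepsilon n(\theta)+\varepsilon^2m(\theta)+O(\varepsilon^3)$$ be a deformation of the unit circle, the $O(\varepsilon^3)$ term being bounded by $K\varepsilon^3$ uniformly in $\theta$. Then for every $0<\varepsilon\le\varepsilon_0$ for which $r_\varepsilon$ bounds a billiard table as above and satisfies this bound, the table does not have both a $1/2$ caustic and a $1/3$ caustic. -/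

import Mathlib

open Real Set Filter Topology
open scoped NNReal

noncomputable section

/-- The point at polar angle `θ` of the curve `r = r(θ)`, in the plane identified with `ℂ`. -/
def boundaryPoint (r : ℝ → ℝ) (θ : ℝ) : ℂ :=
  (r θ : ℂ) * Complex.exp ((θ : ℂ) * Complex.I)

/-- The (counterclockwise, not normalized) tangent vector of the curve at polar angle `θ`. -/
def boundaryTangent (r : ℝ → ℝ) (θ : ℝ) : ℂ :=
  deriv (boundaryPoint r) θ

/-- The closed domain enclosed by the curve `r = r(θ)`. -/
def tableRegion (r : ℝ → ℝ) : Set ℂ :=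
  {z | ∃ θ : ℝ, ∃ t ∈ Icc (0 : ℝ) 1, z = (t : ℂ) * boundaryPoint r θ}

/-- `r = r(θ)` is the boundary, in polar coordinates, of a strictly convex billiard table
with `C²` boundary. -/
structure IsBilliardTable (r : ℝ → ℝ) : Prop where
  periodic : Function.Periodic r (2 * π)
  pos : ∀ θ, 0 < r θ
  contDiff : ContDiff ℝ 2 r
  strictConvex : StrictConvex ℝ (tableRegion r)

/-- The billiard map, lifted to the universal cover `θ ∈ ℝ` of the boundary.
The state `(θ, v)`, with `0 < v < π`, describes the ray which leaves the boundary point at polar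
angle `θ` and makes the angle `v` with the positive tangent there. `BilliardStep r a b` says that
the ray of `a` next hits the boundary at the position of `b`, and that after elastic reflection
(angle of reflection equal to angle of incidence) its state is `b`. The lift is the one
that advances the position counterclockwise by an amount strictly between `0` and `2π`.
Multiplication by `exp (v * I)` is rotation by the angle `v`. -/
structure BilliardStep (r : ℝ → ℝ) (a b : ℝ × ℝ) : Prop where
  angle_mem : a.2 ∈ Ioo 0 π
  angle_mem' : b.2 ∈ Ioo 0 π
  lt : a.1 < b.1
  lt_add : b.1 < a.1 + 2 * π
  outgoing : ∃ c : ℝ, 0 < c ∧ boundaryPoint r b.1 - boundaryPoint r a.1 =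
    (c : ℂ) * (Complex.exp ((a.2 : ℂ) * Complex.I) * boundaryTangent r a.1)
  incoming : ∃ c : ℝ, 0 < c ∧ boundaryPoint r b.1 - boundaryPoint r a.1 =
    (c : ℂ) * (Complex.exp (-(b.2 : ℂ) * Complex.I) * boundaryTangent r b.1)

/-- The table has a `p/q` caustic: the phase space of the billiard map has a non-contractible
invariant curve, the graph `v = g(θ)` of a continuous function on the circle, all of whose points
are periodic with rotation number `p/q`, that is, the orbit closes up after `q` reflections and
winds `p` times around the boundary. -/
def HasRationalCaustic (r : ℝ → ℝ) (p q : ℕ) : Prop :=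
  ∃ g : ℝ → ℝ, Continuous g ∧ Function.Periodic g (2 * π) ∧
    ∀ θ : ℝ, ∃ x : ℤ → ℝ, x 0 = θ ∧
      (∀ i, BilliardStep r (x i, g (x i)) (x (i + 1), g (x (i + 1)))) ∧
      ∀ i, x (i + q) = x i + 2 * π * p

/-- The coefficient `n_k` in the Fourier series `n(θ) = ∑ n_k e^{ikθ}` of a `2π`-periodic
function, `n_k = (1/2π) ∫₀^{2π} n(θ) e^{-ikθ} dθ`. -/
def fourierCoefficient (n : ℝ → ℝ) (k : ℤ) : ℂ :=
  fourierCoeffOn Real.two_pi_pos (fun θ => (n θ : ℂ)) k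

/-- `w` is a modular function of `n`: an even positive function on `ℤ` with
`|n_k| ≤ e^{-w(k)}` for all `k`, this bound being sharp, up to a constant factor, along a
subsequence of the indices. -/
structure IsModularFunction (n : ℝ → ℝ) (w : ℤ → ℝ) : Prop where
  pos : ∀ k, 0 < w k
  even : ∀ k, w (-k) = w k
  bound : ∀ k, ‖fourierCoefficient n k‖ ≤ Real.exp (-w k)
  sharp : ∃ k : ℕ → ℕ, StrictMono k ∧ ∃ l : ℝ, 0 < l ∧
    Tendsto (fun i => ‖fourierCoefficient n (k i)‖ / Real.exp (-w (k i))) atTop (𝓝 l)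

/-- The normalization of the first order term `n` of a deformation of the unit circle. -/
structure IsNormalized (n : ℝ → ℝ) : Prop where
  sup_norm : IsLUB (range fun θ => |n θ|) 1
  zero : n 0 = 0
  deriv_zero : deriv n 0 = 0
  integral_zero : ∫ θ in (0 : ℝ)..2 * π, n θ = 0

end

/-! ### The boundary curve of a billiard table -/

/-! The caustics enter only through two constants. Along a rational caustic the tangential momentum
`‖τ‖ cos v` has a primitive `S`, and the chord length, corrected by the coboundary of `S`, is
maximal along the orbits of the caustic, with one and the same value for all of them
(`exists_calibration`). Hence a `1/2` caustic gives the longest chords from all boundary points a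
common length L₂, and a `1/3` caustic gives the maximal inscribed triangles with a prescribed vertex
a common perimeter L₃.

If the theorem failed, there would be such tables with ε → 0, for fixed `n` and with uniform bounds
on everything else. Expand L₂ and L₃ in ε. Order ε forces n(θ) + n(θ+π) and n(θ) + n(θ+2π/3) +
n(θ+4π/3) to be constant, hence zero because `n` has mean zero. At order ε² the unknown `m` enters
L₂ through sums over antipodal pairs and L₃ through sums over regular triangles. The vertices of a
regular hexagon form two triangles and also three diameters, so `m` drops out of 2L₃ - 3√3 L₂, and
what remains says that the quadratic expression `coexistenceForm` in `n` and its derivative is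
constant (`HasSmallDeformations.coexistenceForm_const`).

Vanishing triangle sums leave n = ν + ν̄ with ν made of modes congruent to 1 modulo 3, and the form
equals 6|ν' - iν|² (`normSq_modeDefect`). A function of constant modulus has Fourier coefficients
orthogonal to all their nontrivial translates. A Newton polygon argument
(`false_of_orthogonal_translates`) shows that such a sequence, if it decays like a sufficiently
steep Gaussian, has at most one nonzero term: a suitable translation matches a vertex far to the
right with one far to the left, and their product outweighs all other products together. The growth
of `w` provides the decay, while its sharpness along a subsequence provides infinitely many nonzero
coefficients. -/

theorem boundaryPoint_periodic {r : ℝ → ℝ} (hr : IsBilliardTable r) :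
    Function.Periodic (boundaryPoint r) (2 * π) := by
  intro θ
  have h : ((θ + 2 * π : ℝ) : ℂ) * Complex.I = (θ : ℂ) * Complex.I + 2 * π * Complex.I := by
    push_cast; ring
  simp only [boundaryPoint, hr.periodic θ, h, Complex.exp_periodic _]

theorem hasDerivAt_boundaryPoint {r : ℝ → ℝ} (hr : IsBilliardTable r) (θ : ℝ) :
    HasDerivAt (boundaryPoint r) (((deriv r θ : ℝ) + r θ * Complex.I) *
      Complex.exp ((θ : ℂ) * Complex.I)) θ := by
  have h1 : HasDerivAt (fun t : ℝ => (r t : ℂ)) ((deriv r θ : ℝ) : ℂ) θ :=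
    ((hr.contDiff.differentiable (by norm_num)).differentiableAt.hasDerivAt).ofReal_comp
  have h2 : HasDerivAt (fun t : ℝ => Complex.exp ((t : ℂ) * Complex.I))
      (Complex.exp ((θ : ℂ) * Complex.I) * (1 * Complex.I)) θ :=
    ((Complex.ofRealCLM.hasDerivAt (x := θ)).mul_const Complex.I).cexp
  convert! h1.mul h2 using 1
  ring

theorem boundaryTangent_eq {r : ℝ → ℝ} (hr : IsBilliardTable r) (θ : ℝ) :
    boundaryTangent r θ = ((deriv r θ : ℝ) + r θ * Complex.I) *
      Complex.exp ((θ : ℂ) * Complex.I) :=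
  (hasDerivAt_boundaryPoint hr θ).deriv

theorem hasDerivAt_boundaryPoint_tangent {r : ℝ → ℝ} (hr : IsBilliardTable r) (θ : ℝ) :
    HasDerivAt (boundaryPoint r) (boundaryTangent r θ) θ := by
  rw [boundaryTangent_eq hr]; exact hasDerivAt_boundaryPoint hr θ

theorem continuous_boundaryPoint {r : ℝ → ℝ} (hr : IsBilliardTable r) :
    Continuous (boundaryPoint r) :=
  continuous_iff_continuousAt.2 fun θ => (hasDerivAt_boundaryPoint hr θ).continuousAt

theorem continuous_boundaryTangent {r : ℝ → ℝ} (hr : IsBilliardTable r) :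
    Continuous (boundaryTangent r) := by
  have h : Continuous (deriv r) := hr.contDiff.continuous_deriv (by norm_num)
  have h2 := hr.contDiff.continuous
  rw [show boundaryTangent r = _ from funext (boundaryTangent_eq hr)]
  fun_prop

theorem boundaryTangent_ne_zero {r : ℝ → ℝ} (hr : IsBilliardTable r) (θ : ℝ) :
    boundaryTangent r θ ≠ 0 := by
  rw [boundaryTangent_eq hr]
  refine mul_ne_zero (fun h => ?_) (Complex.exp_ne_zero _)
  have := congrArg Complex.im h
  simp at this
  exact (hr.pos θ).ne' this

theorem norm_boundaryPoint {r : ℝ → ℝ} (hr : IsBilliardTable r) (θ : ℝ) :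
    ‖boundaryPoint r θ‖ = r θ := by
  simp [boundaryPoint, Complex.norm_exp_ofReal_mul_I, abs_of_pos (hr.pos θ)]

theorem boundaryPoint_mem {r : ℝ → ℝ} (θ : ℝ) : boundaryPoint r θ ∈ tableRegion r :=
  ⟨θ, 1, by simp, by simp⟩

/-- Uniqueness of polar coordinates: comparing norms leaves equal exponentials, and periodicity of
`r` then cancels the radii. The factors `a`, `b` make it apply to points of the region as well as to
the boundary. -/
theorem smul_boundaryPoint_eq {r : ℝ → ℝ} (hr : IsBilliardTable r) {a b s t : ℝ} (ha : 0 < a)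
    (hb : 0 ≤ b) (h : (a : ℂ) * boundaryPoint r s = (b : ℂ) * boundaryPoint r t) :
    a = b ∧ ∃ k : ℤ, s = t + k * (2 * π) := by
  have hn := congrArg norm h
  simp only [norm_mul, Complex.norm_real, norm_boundaryPoint hr, Real.norm_eq_abs,
    abs_of_pos ha, abs_of_nonneg hb] at hn
  have h' : Complex.exp (s * Complex.I) = Complex.exp (t * Complex.I) := by
    have hne : ((a * r s : ℝ) : ℂ) ≠ 0 := by
      exact_mod_cast (mul_pos ha (hr.pos s)).ne'
    apply mul_left_cancel₀ hne
    have e : ((a * r s : ℝ) : ℂ) = ((b * r t : ℝ) : ℂ) := by rw [hn]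
    calc ((a * r s : ℝ) : ℂ) * Complex.exp (s * Complex.I) = a * boundaryPoint r s := by
          simp [boundaryPoint]; ring
      _ = b * boundaryPoint r t := h
      _ = ((b * r t : ℝ) : ℂ) * Complex.exp (t * Complex.I) := by simp [boundaryPoint]; ring
      _ = _ := by rw [e]
  obtain ⟨k, hk⟩ := Complex.exp_eq_exp_iff_exists_int.1 h'
  have hst : s = t + k * (2 * π) := by
    have := congrArg Complex.im hk
    simpa using this
  refine ⟨?_, k, hst⟩
  have : r s = r t := by
    rw [hst]; exact hr.periodic.int_mul k t
  rw [this] at hn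
  exact mul_right_cancel₀ (hr.pos t).ne' hn

theorem boundaryPoint_ne {r : ℝ → ℝ} (hr : IsBilliardTable r) {s t : ℝ} (h1 : s < t)
    (h2 : t < s + 2 * π) : boundaryPoint r s ≠ boundaryPoint r t := by
  intro h
  obtain ⟨-, k, hk⟩ := smul_boundaryPoint_eq hr (a := 1) (b := 1) one_pos zero_le_one
    (by simpa using h)
  have hπ := Real.pi_pos
  have h3 : (k : ℝ) < 0 := by by_contra! hc; nlinarith
  have h4 : (-1 : ℝ) < k := by by_contra! hc; nlinarith
  have h3' : k < 0 := by exact_mod_cast h3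
  have h4' : -1 < k := by exact_mod_cast h4
  omega

/-- Points slightly further out on the same ray are not in the region. -/
theorem boundaryPoint_notMem_interior {r : ℝ → ℝ} (hr : IsBilliardTable r) (θ : ℝ) :
    boundaryPoint r θ ∉ interior (tableRegion r) := by
  intro h
  have hc : Tendsto (fun a : ℝ => (a : ℂ) * boundaryPoint r θ) (𝓝[>] 1)
      (𝓝 (boundaryPoint r θ)) := by
    have : Continuous fun a : ℝ => (a : ℂ) * boundaryPoint r θ := by fun_prop
    simpa using (this.tendsto 1).mono_left nhdsWithin_le_nhds
  have hev := (hc.eventually (isOpen_interior.mem_nhds h)).and self_mem_nhdsWithin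
  obtain ⟨a, ha, ha1⟩ := hev.exists
  have ha1 : 1 < a := ha1
  obtain ⟨φ, t, ht, e⟩ := interior_subset ha
  obtain ⟨e, -⟩ := smul_boundaryPoint_eq hr (by linarith) ht.1 e
  linarith [ht.2]

theorem zero_mem_interior {r : ℝ → ℝ} (hr : IsBilliardTable r) :
    (0 : ℂ) ∈ interior (tableRegion r) := by
  obtain ⟨θ₀, -, hθ₀⟩ := isCompact_Icc.exists_isMinOn (s := Icc 0 (2 * π))
    (nonempty_Icc.2 Real.two_pi_pos.le) hr.contDiff.continuous.continuousOn
  have hmin : ∀ θ, r θ₀ ≤ r θ := by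
    intro θ
    obtain ⟨y, hy, e⟩ := hr.periodic.exists_mem_Ico₀ Real.two_pi_pos θ
    rw [e]; exact hθ₀ ⟨hy.1, hy.2.le⟩
  rw [mem_interior_iff_mem_nhds]
  refine Filter.mem_of_superset (Metric.ball_mem_nhds 0 (hr.pos θ₀)) fun z hz => ?_
  have hz' : ‖z‖ < r θ₀ := by simpa using hz
  refine ⟨z.arg, ‖z‖ / r z.arg, ⟨by have := hr.pos z.arg; positivity, ?_⟩, ?_⟩
  · rw [div_le_one (hr.pos _)]; exact hz'.le.trans (hmin _)
  · have : (r z.arg : ℂ) ≠ 0 := by exact_mod_cast (hr.pos _).ne'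
    rw [boundaryPoint, Complex.ofReal_div, ← mul_assoc, div_mul_cancel₀ _ this,
      Complex.norm_mul_exp_arg_mul_I]

/-- The table lies on the left of its tangents. -/
theorem im_chord_mul_conj_tangent_nonneg {r : ℝ → ℝ} (hr : IsBilliardTable r) (s t : ℝ) :
    0 ≤ ((boundaryPoint r s - boundaryPoint r t) *
      (starRingEnd ℂ) (boundaryTangent r t)).im := by
  have hconv := hr.strictConvex.convex
  -- A supporting functional `f` at the boundary point is maximal there along the curve, so it kills
  -- the tangent τ. Up to a factor it is then z ↦ Im(z τ̄), and the interior point `0` decides the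
  -- sign of the factor.
  obtain ⟨f, hf⟩ := geometric_hahn_banach_open_point hconv.interior isOpen_interior
    (boundaryPoint_notMem_interior hr t)
  have hcl : ∀ z ∈ tableRegion r, f z ≤ f (boundaryPoint r t) := by
    intro z hz
    have hz' : z ∈ closure (interior (tableRegion r)) := by
      rw [hconv.closure_interior_eq_closure_of_nonempty_interior ⟨0, zero_mem_interior hr⟩]
      exact subset_closure hz
    exact closure_minimal (fun a ha => (hf a ha).le)
      (isClosed_le f.continuous continuous_const) hz'
  have hd : f (boundaryTangent r t) = 0 := by
    refine IsLocalMax.hasDerivAt_eq_zero (f := fun u => f (boundaryPoint r u)) (a := t)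
      (Filter.Eventually.of_forall fun u => hcl _ (boundaryPoint_mem u)) ?_
    exact (f.hasFDerivAt.comp_hasDerivAt t (hasDerivAt_boundaryPoint_tangent hr t))
  have hpos : 0 < f (boundaryPoint r t) := by simpa using hf 0 (zero_mem_interior hr)
  set τ := boundaryTangent r t with hτ
  have hτ0 : 0 < Complex.normSq τ := Complex.normSq_pos.2 (boundaryTangent_ne_zero hr t)
  have key : ∀ z : ℂ, Complex.normSq τ * f z =
      (z * (starRingEnd ℂ) τ).im * f (Complex.I * τ) := by
    intro z
    have hz : (Complex.normSq τ : ℝ) • z = (z * (starRingEnd ℂ) τ).re • τ +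
        (z * (starRingEnd ℂ) τ).im • (Complex.I * τ) := by
      apply Complex.ext <;> simp [Complex.normSq_apply] <;> ring
    have := congrArg f hz
    rw [map_add, map_smul, map_smul, map_smul, hd] at this
    simpa only [smul_eq_mul, mul_zero, zero_add] using this
  have him : (boundaryPoint r t * (starRingEnd ℂ) τ).im = -(r t) ^ 2 := by
    rw [hτ, boundaryTangent_eq hr]
    have h1 : (r t : ℂ) * Complex.exp (t * Complex.I) * ((starRingEnd ℂ) ((((deriv r t : ℝ) : ℂ)
        + r t * Complex.I) * Complex.exp (t * Complex.I))) =
        (r t : ℂ) * (deriv r t - r t * Complex.I) * ((Complex.exp (t * Complex.I)) *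
          (starRingEnd ℂ) (Complex.exp (t * Complex.I))) := by
      simp; ring
    rw [boundaryPoint, h1, Complex.mul_conj, Complex.normSq_eq_norm_sq,
      Complex.norm_exp_ofReal_mul_I]
    simp; ring
  have h1 := key (boundaryPoint r t)
  rw [him] at h1
  have hneg : f (Complex.I * τ) < 0 := by
    by_contra! hc
    have := mul_pos hτ0 hpos
    nlinarith [sq_nonneg (r t), mul_nonneg (sq_nonneg (r t)) hc]
  have h2 := key (boundaryPoint r s - boundaryPoint r t)
  rw [map_sub] at h2
  have h3 := hcl _ (boundaryPoint_mem s)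
  by_contra! hc
  have h4 := mul_pos_of_neg_of_neg hc hneg
  nlinarith

/-- A ray issued from a boundary point hits the boundary again at most once. -/
theorem chord_end_unique {r : ℝ → ℝ} (hr : IsBilliardTable r) {z u : ℂ} {s t c d : ℝ}
    (hz : z ∈ tableRegion r)
    (hc : 0 < c) (hd : 0 < d) (hu : u ≠ 0)
    (hs : boundaryPoint r s - z = c * u) (ht : boundaryPoint r t - z = d * u) : c = d := by
  have key : ∀ {s t c d : ℝ}, 0 < c → boundaryPoint r s - z = c * u →
      boundaryPoint r t - z = d * u → ¬ c < d := by
    intro s t c d hc hs ht hcd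
    have hd : 0 < d := hc.trans hcd
    have hne : z ≠ boundaryPoint r t := by
      intro e
      rw [← e, sub_self] at ht
      have : (d : ℂ) ≠ 0 := by exact_mod_cast hd.ne'
      exact mul_ne_zero this hu ht.symm
    -- The nearer of two hits would lie on the open segment from `z` to the farther one, which
    -- strict convexity puts in the interior.
    refine boundaryPoint_notMem_interior hr s
      (hr.strictConvex.openSegment_subset hz (boundaryPoint_mem t) hne ?_)
    refine ⟨1 - c / d, c / d, by rw [sub_pos, div_lt_one hd]; exact hcd, by positivity,
      by ring, ?_⟩
    have h1 : boundaryPoint r t = z + d * u := by rw [← ht]; ring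
    have h2 : boundaryPoint r s = z + c * u := by rw [← hs]; ring
    have : (d : ℂ) ≠ 0 := by exact_mod_cast hd.ne'
    rw [h1, h2, Complex.real_smul, Complex.real_smul]
    push_cast
    field_simp
    ring
  rcases lt_trichotomy c d with h | h | h
  · exact (key hc hs ht h).elim
  · exact h
  · exact (key hd ht hs h).elim

/-! ### The perimeter of the polygons inscribed in a table with a rational caustic -/

/-- The length of the chord between the boundary points at polar angles `s` and `t`. -/
noncomputable def chordLength (r : ℝ → ℝ) (s t : ℝ) : ℝ := ‖boundaryPoint r t - boundaryPoint r s‖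

theorem chordLength_comm (r : ℝ → ℝ) (s t : ℝ) : chordLength r s t = chordLength r t s :=
  norm_sub_rev _ _

/-! ### First variation of the chord length, and determinism of billiard steps -/

theorem hasDerivAt_norm_sub_const {f : ℝ → ℂ} {f' z : ℂ} {t : ℝ} (hf : HasDerivAt f f' t)
    (h : f t ≠ z) :
    HasDerivAt (fun u => ‖f u - z‖) (((f t - z) * (starRingEnd ℂ) f').re / ‖f t - z‖) t := by
  have h0 : 0 < ‖f t - z‖ := norm_pos_iff.2 (sub_ne_zero.2 h)
  have h1 := ((hf.sub_const z).norm_sq).sqrt (by positivity)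
  simp only [Real.sqrt_sq (norm_nonneg _)] at h1
  convert! h1 using 1
  rw [Complex.inner, mul_div_mul_left _ _ two_ne_zero]
  congr 1
  simp
  ring

theorem hasDerivAt_chordLength_right {r : ℝ → ℝ} (hr : IsBilliardTable r) {s t : ℝ}
    (h : boundaryPoint r s ≠ boundaryPoint r t) :
    HasDerivAt (chordLength r s) (((boundaryPoint r t - boundaryPoint r s) *
      (starRingEnd ℂ) (boundaryTangent r t)).re / chordLength r s t) t :=
  hasDerivAt_norm_sub_const (hasDerivAt_boundaryPoint_tangent hr t) h.symm

theorem hasDerivAt_chordLength_left {r : ℝ → ℝ} (hr : IsBilliardTable r) {s t : ℝ}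
    (h : boundaryPoint r s ≠ boundaryPoint r t) :
    HasDerivAt (fun u => chordLength r u t) (-((boundaryPoint r t - boundaryPoint r s) *
      (starRingEnd ℂ) (boundaryTangent r s)).re / chordLength r s t) s := by
  have := hasDerivAt_chordLength_right hr h.symm
  rw [chordLength_comm] at this
  convert! this using 1
  · ext u; exact chordLength_comm r u t
  · rw [← neg_sub (boundaryPoint r s), neg_mul, Complex.neg_re, neg_neg]

theorem norm_smul_exp_mul {c : ℝ} (hc : 0 < c) (v : ℝ) (τ : ℂ) :
    ‖(c : ℂ) * (Complex.exp ((v : ℂ) * Complex.I) * τ)‖ = c * ‖τ‖ := by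
  rw [norm_mul, norm_mul, Complex.norm_exp_ofReal_mul_I, Complex.norm_real, Real.norm_eq_abs,
    abs_of_pos hc, one_mul]

theorem re_smul_exp_mul_mul_conj (c v : ℝ) (τ : ℂ) :
    ((c : ℂ) * (Complex.exp ((v : ℂ) * Complex.I) * τ) * (starRingEnd ℂ) τ).re =
      c * ‖τ‖ * (‖τ‖ * Real.cos v) := by
  have : (c : ℂ) * (Complex.exp ((v : ℂ) * Complex.I) * τ) * (starRingEnd ℂ) τ =
      ((c * ‖τ‖ ^ 2 : ℝ) : ℂ) * Complex.exp ((v : ℂ) * Complex.I) := by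
    rw [← Complex.normSq_eq_norm_sq, Complex.ofReal_mul, ← Complex.mul_conj]; ring
  rw [this, Complex.re_ofReal_mul, Complex.exp_ofReal_mul_I_re]
  ring

theorem BilliardStep.ne {r : ℝ → ℝ} (hr : IsBilliardTable r) {a b : ℝ × ℝ}
    (h : BilliardStep r a b) : boundaryPoint r a.1 ≠ boundaryPoint r b.1 :=
  boundaryPoint_ne hr h.lt h.lt_add

/-- First variation formula: the chord length is a generating function of the billiard map, with
momentum ‖τ‖ cos v conjugate to the polar angle. -/
theorem BilliardStep.hasDerivAt_left {r : ℝ → ℝ} (hr : IsBilliardTable r) {a b : ℝ × ℝ}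
    (h : BilliardStep r a b) :
    HasDerivAt (fun u => chordLength r u b.1) (-(‖boundaryTangent r a.1‖ * Real.cos a.2)) a.1 := by
  obtain ⟨c, hc, e⟩ := h.outgoing
  have hτ := norm_pos_iff.2 (boundaryTangent_ne_zero hr a.1)
  convert! hasDerivAt_chordLength_left hr (h.ne hr) using 1
  rw [chordLength, e, norm_smul_exp_mul hc, re_smul_exp_mul_mul_conj]
  field_simp

/-- An inscribed chord at which the incoming angle is critical arrives with that angle. -/
theorem chord_eq_of_re_eq {r : ℝ → ℝ} (hr : IsBilliardTable r) {s t v : ℝ}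
    (hv : v ∈ Ioo 0 π)
    (h : ((boundaryPoint r t - boundaryPoint r s) * (starRingEnd ℂ) (boundaryTangent r t)).re =
      chordLength r s t * (‖boundaryTangent r t‖ * Real.cos v)) :
    boundaryPoint r t - boundaryPoint r s = ((chordLength r s t / ‖boundaryTangent r t‖ : ℝ) : ℂ) *
      (Complex.exp (-(v : ℂ) * Complex.I) * boundaryTangent r t) := by
  set τ := boundaryTangent r t with hτdef
  have hτ0 : τ ≠ 0 := boundaryTangent_ne_zero hr t
  have hτ := norm_pos_iff.2 hτ0
  set w := (boundaryPoint r t - boundaryPoint r s) * (starRingEnd ℂ) τ with hw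
  -- The cosine determines the angle only up to sign; the table being on the left of its tangent
  -- selects the sign.
  have him : w.im ≤ 0 := by
    have := im_chord_mul_conj_tangent_nonneg hr s t
    rw [← neg_sub, neg_mul, Complex.neg_im] at this
    linarith
  have hnw : ‖w‖ = chordLength r s t * ‖τ‖ := by rw [hw, norm_mul, Complex.norm_conj, chordLength]
  have hsin : 0 < Real.sin v := Real.sin_pos_of_pos_of_lt_pi hv.1 hv.2
  have hN : 0 ≤ chordLength r s t * ‖τ‖ := by rw [← hnw]; positivity
  have him2 : w.im = -(chordLength r s t * ‖τ‖ * Real.sin v) := by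
    have h1 : w.re * w.re + w.im * w.im = (chordLength r s t * ‖τ‖) ^ 2 := by
      rw [← hnw, ← Complex.normSq_eq_norm_sq, Complex.normSq_apply]
    have h2 : w.im ^ 2 = (chordLength r s t * ‖τ‖ * Real.sin v) ^ 2 := by
      have := Real.sin_sq_add_cos_sq v
      rw [h] at h1
      linear_combination h1 - (chordLength r s t * ‖τ‖) ^ 2 * this
    have h3 : (-w.im) = (chordLength r s t * ‖τ‖ * Real.sin v) :=
      (pow_left_inj₀ (by linarith) (by positivity) two_ne_zero).1 (by rw [← h2]; ring)
    linarith
  have hw2 : w = ((chordLength r s t * ‖τ‖ : ℝ) : ℂ) * Complex.exp (-(v : ℂ) * Complex.I) := by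
    have e : -(v : ℂ) * Complex.I = ((-v : ℝ) : ℂ) * Complex.I := by push_cast; ring
    rw [e]
    apply Complex.ext
    · rw [Complex.re_ofReal_mul, Complex.exp_ofReal_mul_I_re, Real.cos_neg, h]; ring
    · rw [Complex.im_ofReal_mul, Complex.exp_ofReal_mul_I_im, Real.sin_neg, him2]; ring
  have hc : (starRingEnd ℂ) τ ≠ 0 := (map_ne_zero _).2 hτ0
  apply mul_right_cancel₀ hc
  rw [← hw, hw2]
  have h4 : τ * (starRingEnd ℂ) τ = ((‖τ‖ ^ 2 : ℝ) : ℂ) := by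
    rw [Complex.mul_conj, Complex.normSq_eq_norm_sq]
  have h5 : ((chordLength r s t / ‖τ‖ : ℝ) : ℂ) * (Complex.exp (-(v : ℂ) * Complex.I) * τ) *
      (starRingEnd ℂ) τ = ((chordLength r s t / ‖τ‖ : ℝ) : ℂ) * Complex.exp (-(v : ℂ) * Complex.I) *
      (τ * (starRingEnd ℂ) τ) := by ring
  rw [h5, h4]
  have : ((chordLength r s t * ‖τ‖ : ℝ) : ℂ) = ((chordLength r s t / ‖τ‖ : ℝ) : ℂ) *
      ((‖τ‖ ^ 2 : ℝ) : ℂ) := by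
    rw [← Complex.ofReal_mul]; congr 1; field_simp
  rw [this]; ring

theorem eq_of_boundaryPoint_eq {r : ℝ → ℝ} (hr : IsBilliardTable r) {s t u : ℝ}
    (h : boundaryPoint r s = boundaryPoint r t) (h1 : u < s) (h2 : s < u + 2 * π) (h3 : u < t)
    (h4 : t < u + 2 * π) : s = t := by
  rcases lt_trichotomy s t with h' | h' | h'
  · exact (boundaryPoint_ne hr h' (by linarith) h).elim
  · exact h'
  · exact (boundaryPoint_ne hr h' (by linarith) h.symm).elim

theorem BilliardStep.right_unique {r : ℝ → ℝ} (hr : IsBilliardTable r) {a b b' : ℝ × ℝ}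
    (h : BilliardStep r a b) (h' : BilliardStep r a b') : b.1 = b'.1 := by
  obtain ⟨c, hc, e⟩ := h.outgoing
  obtain ⟨d, hd, e'⟩ := h'.outgoing
  have hcd := chord_end_unique hr (boundaryPoint_mem a.1) hc hd
    (mul_ne_zero (Complex.exp_ne_zero _) (boundaryTangent_ne_zero hr _)) e e'
  rw [← hcd, ← e] at e'
  exact eq_of_boundaryPoint_eq hr (sub_left_inj.1 e').symm h.lt h.lt_add h'.lt h'.lt_add

/-- The hypothesis on `s` is the critical point equation of a corrected chord length. It makes the
chord from `s` arrive at the angle of `b`, so the reversed rays towards `a.1` and `s` coincide and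
`chord_end_unique` applies. -/
theorem BilliardStep.left_eq {r : ℝ → ℝ} (hr : IsBilliardTable r) {a b : ℝ × ℝ} {s : ℝ}
    (h : BilliardStep r a b) (h1 : s < b.1) (h2 : b.1 < s + 2 * π)
    (hs : ((boundaryPoint r b.1 - boundaryPoint r s) *
      (starRingEnd ℂ) (boundaryTangent r b.1)).re =
      chordLength r s b.1 * (‖boundaryTangent r b.1‖ * Real.cos b.2)) : a.1 = s := by
  obtain ⟨c, hc, e⟩ := h.incoming
  have e' := chord_eq_of_re_eq hr h.angle_mem' hs
  have hτ := norm_pos_iff.2 (boundaryTangent_ne_zero hr b.1)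
  have hl : 0 < chordLength r s b.1 :=
    norm_pos_iff.2 (sub_ne_zero.2 (boundaryPoint_ne hr h1 h2).symm)
  set u := Complex.exp (-(b.2 : ℂ) * Complex.I) * boundaryTangent r b.1
  have hcd := chord_end_unique hr (boundaryPoint_mem b.1) (s := a.1) (t := s) hc (div_pos hl hτ)
    (neg_ne_zero.2 (mul_ne_zero (Complex.exp_ne_zero _) (boundaryTangent_ne_zero hr b.1)))
    (by rw [mul_neg, ← e]; ring) (by rw [mul_neg, ← e']; ring)
  rw [← hcd, ← e] at e'
  have := h.lt_add
  exact eq_of_boundaryPoint_eq hr (u := b.1 - 2 * π) (sub_right_inj.1 e').symm (by linarith)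
    (by linarith [h.lt]) (by linarith) (by linarith)

/-- A continuous function which is touched from below at every point by a function with
vanishing derivative is constant. -/
theorem eq_of_forall_exists_hasDerivAt_zero_le {C : ℝ → ℝ} (hC : Continuous C)
    (h : ∀ s, ∃ φ : ℝ → ℝ, φ s = C s ∧ (∀ᶠ u in 𝓝 s, φ u ≤ C u) ∧ HasDerivAt φ 0 s) (a b : ℝ) :
    C a = C b := by
  have key : ∀ {C : ℝ → ℝ}, Continuous C →
      (∀ s, ∃ φ : ℝ → ℝ, φ s = C s ∧ (∀ᶠ u in 𝓝 s, φ u ≤ C u) ∧ HasDerivAt φ 0 s) →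
      ∀ {a b}, a ≤ b → C a ≤ C b := by
    intro C hC h a b hab
    -- Compare `-C` with a line of slope `e > 0`: the touching function bounds the right slopes of
    -- `-C` at each point by quantities tending to 0.
    have hε : ∀ e > 0, -C b ≤ -C a + e * (b - a) := by
      intro e he
      refine image_le_of_liminf_slope_right_lt_deriv_boundary' (f := fun x => -C x)
        (f' := fun _ => 0) (B := fun x => -C a + e * (x - a)) (B' := fun _ => e) (a := a) (b := b)
        (by fun_prop) ?_ (by simp) (by fun_prop) ?_ (fun _ _ _ => he) ⟨hab, le_rfl⟩
      · intro x _ ρ hρ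
        obtain ⟨φ, h1, h2, h3⟩ := h x
        have h4 : ∀ᶠ z in 𝓝[>] x, -ρ < slope φ x z :=
          ((h3.tendsto_slope).mono_left (nhdsWithin_mono _ fun z hz => ne_of_gt hz)).eventually
            (lt_mem_nhds (by linarith))
        refine ((h4.and (nhdsWithin_le_nhds h2)).and self_mem_nhdsWithin).frequently.mono ?_
        rintro z ⟨⟨h5, h6⟩, h7⟩
        have h7 : x < z := h7
        rw [slope_def_field, lt_div_iff₀ (by linarith)] at h5
        rw [slope_def_field, div_lt_iff₀ (by linarith)]
        linarith
      · intro x _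
        have := ((((hasDerivAt_id x).sub_const a).const_mul e).const_add (-C a)).hasDerivWithinAt
          (s := Ici x)
        simpa using this
    have : -C b ≤ -C a := by
      have ht : Tendsto (fun e : ℝ => -C a + e * (b - a)) (𝓝[>] 0) (𝓝 (-C a)) := by
        have : Continuous fun e : ℝ => -C a + e * (b - a) := by fun_prop
        simpa using (this.tendsto 0).mono_left nhdsWithin_le_nhds
      exact ge_of_tendsto ht (eventually_nhdsWithin_of_forall fun e he => hε e he)
    linarith
  -- The touching hypothesis is invariant under `x ↦ -x`, which reverses the inequality.
  have key2 : ∀ {a b}, a ≤ b → C b ≤ C a := by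
    intro a b hab
    have := key (C := fun x => C (-x)) (by fun_prop) (fun s => by
      obtain ⟨φ, h1, h2, h3⟩ := h (-s)
      refine ⟨fun x => φ (-x), h1, (continuous_neg.tendsto s).eventually h2, ?_⟩
      have h4 : HasDerivAt (φ ∘ fun x : ℝ => -x) (0 * -1) s := h3.comp s (hasDerivAt_neg s)
      rwa [zero_mul] at h4) (neg_le_neg hab)
    simpa using this
  rcases le_total a b with hab | hab
  · exact le_antisymm (key hC h hab) (key2 hab)
  · exact le_antisymm (key2 hab) (key hC h hab)

/-! ### Calibration of the chord length by a rational caustic -/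

theorem continuous_chordLength {r : ℝ → ℝ} (hr : IsBilliardTable r) :
    Continuous fun x : ℝ × ℝ => chordLength r x.1 x.2 := by
  have := continuous_boundaryPoint hr
  unfold chordLength
  fun_prop

theorem chordLength_add_two_pi_right {r : ℝ → ℝ} (hr : IsBilliardTable r) (s t : ℝ) :
    chordLength r s (t + 2 * π) = chordLength r s t := by
  rw [chordLength, boundaryPoint_periodic hr t, chordLength]

/-- A chord leaving the point `s` at a short distance is longer than any primitive with smaller
derivative allows. -/
theorem eventually_lt_chordLength {r : ℝ → ℝ} (hr : IsBilliardTable r) {S : ℝ → ℝ} {s η : ℝ}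
    (hS : HasDerivAt S η s) (hη : η < ‖boundaryTangent r s‖) :
    ∀ᶠ t in 𝓝[>] s, S t - S s < chordLength r s t := by
  have h1 := ((hasDerivAt_boundaryPoint_tangent hr s).tendsto_slope.norm.sub
    hS.tendsto_slope).mono_left (nhdsWithin_mono s fun z (hz : z ∈ Ioi s) => ne_of_gt hz)
  filter_upwards [h1.eventually (lt_mem_nhds (sub_pos.2 hη)), self_mem_nhdsWithin] with t h2 h3
  have h3 : 0 < t - s := sub_pos.2 h3
  rw [slope_def_module, slope_def_module, norm_smul, norm_inv, Real.norm_eq_abs, abs_of_pos h3,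
    smul_eq_mul, ← mul_sub] at h2
  have := (pos_iff_pos_of_mul_pos h2).1 (inv_pos.2 h3)
  simp only [chordLength]
  linarith

theorem eventually_lt_chordLength_left {r : ℝ → ℝ} (hr : IsBilliardTable r) {S : ℝ → ℝ} {s η : ℝ}
    (hS : HasDerivAt S η s) (hη : -‖boundaryTangent r s‖ < η) :
    ∀ᶠ t in 𝓝[<] s, S t - S s < chordLength r s t := by
  have h1 := ((hasDerivAt_boundaryPoint_tangent hr s).tendsto_slope.norm.add
    hS.tendsto_slope).mono_left (nhdsWithin_mono s fun z (hz : z ∈ Iio s) => ne_of_lt hz)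
  filter_upwards [h1.eventually (lt_mem_nhds (show 0 < _ by linarith)), self_mem_nhdsWithin]
    with t h2 h3
  have h3 : t - s < 0 := sub_neg.2 h3
  rw [slope_def_module, slope_def_module, norm_smul, norm_inv, Real.norm_eq_abs, abs_of_neg h3,
    smul_eq_mul, inv_neg, neg_mul, ← sub_eq_neg_add, ← mul_sub] at h2
  have := neg_of_mul_pos_right h2 (inv_lt_zero.2 h3).le
  simp only [chordLength]
  linarith

/-- Among the chords issued from a point, the one on the orbit of the caustic is the longest, up to
a primitive of the tangential momentum. -/
theorem chordLength_sub_le_of_orbit {r g S : ℝ → ℝ} (hr : IsBilliardTable r)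
    (horb : ∀ θ, ∃ x : ℤ → ℝ, x 0 = θ ∧
      ∀ i, BilliardStep r (x i, g (x i)) (x (i + 1), g (x (i + 1))))
    (hS : ∀ θ, HasDerivAt S (‖boundaryTangent r θ‖ * Real.cos (g θ)) θ)
    (hη1 : ∀ θ, ‖boundaryTangent r θ‖ * Real.cos (g θ) < ‖boundaryTangent r θ‖)
    (hη2 : ∀ θ, -‖boundaryTangent r θ‖ < ‖boundaryTangent r θ‖ * Real.cos (g θ))
    {s : ℝ} {b : ℝ × ℝ} (hx1 : BilliardStep r (s, g s) b) :
    ∀ t ∈ Icc s (s + 2 * π),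
      chordLength r s t + S s - S t ≤ chordLength r s b.1 + S s - S b.1 := by
  have hSc : Continuous S := continuous_iff_continuousAt.2 fun θ => (hS θ).continuousAt
  have hΦc : Continuous fun t => chordLength r s t + S s - S t := by
    have := (continuous_chordLength hr).comp (Continuous.prodMk_right s)
    simp only [Function.comp_def] at this
    fun_prop
  obtain ⟨t, ht, htmax⟩ := isCompact_Icc.exists_isMaxOn (s := Icc s (s + 2 * π))
    (nonempty_Icc.2 (by linarith [Real.two_pi_pos]))
    hΦc.continuousOn
  have htmax : ∀ u ∈ Icc s (s + 2 * π), chordLength r s u + S s - S u ≤ chordLength r s t + S s - S t := htmax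
  have h2π := Real.two_pi_pos
  -- The maximum is not at a degenerate chord: near one the length grows at rate ‖τ‖, strictly
  -- faster than `S` can vary.
  have hne1 : t ≠ s := by
    rintro rfl
    have h1 := (eventually_lt_chordLength hr (hS t) (hη1 t)).and
      (Ioo_mem_nhdsGT (show t < t + 2 * π by linarith))
    obtain ⟨u, hu1, hu2⟩ := h1.exists
    have := htmax u ⟨hu2.1.le, hu2.2.le⟩
    have h0 : chordLength r t t = 0 := by simp [chordLength]
    rw [h0] at this
    linarith
  have hne2 : t ≠ s + 2 * π := by
    intro e
    have h1 := (eventually_lt_chordLength_left hr (hS t) (hη2 t)).and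
      (Ioo_mem_nhdsLT (show s < t by linarith))
    obtain ⟨u, hu1, hu2⟩ := h1.exists
    have := htmax u ⟨hu2.1.le, by linarith [hu2.2]⟩
    have h0 : chordLength r s t = 0 := by
      rw [e, chordLength_add_two_pi_right hr]; simp [chordLength]
    have h2 : chordLength r s u = chordLength r t u := by
      rw [e, chordLength, chordLength, boundaryPoint_periodic hr]
    rw [h0, h2] at this
    linarith
  have hst : s < t := lt_of_le_of_ne ht.1 hne1.symm
  have hts : t < s + 2 * π := lt_of_le_of_ne ht.2 hne2
  have hne := boundaryPoint_ne hr hst hts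
  have hl : 0 < chordLength r s t := norm_pos_iff.2 (sub_ne_zero.2 hne.symm)
  -- At an interior maximum the chord arrives at `t` with the angle of the caustic. So `s` precedes
  -- `t` on the orbit through `t`, and `t` is the image of `s`.
  have hcrit := IsLocalMax.hasDerivAt_eq_zero (f := fun t => chordLength r s t + S s - S t) (a := t)
    (Filter.mem_of_superset (Icc_mem_nhds hst hts) htmax)
    (((hasDerivAt_chordLength_right hr hne).add_const (S s)).sub (hS t))
  obtain ⟨y, hy0, hy⟩ := horb t
  have hy1 := hy (-1)
  simp only [neg_add_cancel, hy0] at hy1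
  have hys : y (-1) = s := hy1.left_eq hr hst hts (by
    rw [sub_eq_zero, div_eq_iff hl.ne'] at hcrit
    rw [hcrit, mul_comm])
  rw [hys] at hy1
  have : t = b.1 := hy1.right_unique hr hx1
  rwa [← this]

/-- The orbits on a rational caustic calibrate the chord length: up to the coboundary of
a function `S`, it is maximal, and constant, along the orbits of the caustic. -/
theorem exists_calibration {r : ℝ → ℝ} (hr : IsBilliardTable r) {p q : ℕ}
    (h : HasRationalCaustic r p q) :
    ∃ (S : ℝ → ℝ) (C σ : ℝ), (∀ θ, S (θ + 2 * π) = S θ + σ) ∧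
      (∀ s t, s ≤ t → t ≤ s + 2 * π → chordLength r s t ≤ C + S t - S s) ∧
      ∀ θ, ∃ x : ℤ → ℝ, x 0 = θ ∧ (∀ i, x i < x (i + 1)) ∧ (∀ i, x (i + 1) < x i + 2 * π) ∧
        (∀ i, x (i + q) = x i + 2 * π * p) ∧
        ∀ i, chordLength r (x i) (x (i + 1)) = C + S (x (i + 1)) - S (x i) := by
  obtain ⟨g, hg, hgp, horb⟩ := h
  have hgI : ∀ θ, g θ ∈ Ioo 0 π := fun θ => by
    obtain ⟨x, h0, h1, -⟩ := horb θ
    have := (h1 0).angle_mem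
    simpa only [h0] using this
  -- The momentum along the caustic. It is periodic, but its primitive `S` gains a constant, the σ
  -- of the statement, at each turn.
  obtain ⟨η, hη⟩ : ∃ η : ℝ → ℝ, ∀ θ, η θ = ‖boundaryTangent r θ‖ * Real.cos (g θ) :=
    ⟨_, fun _ => rfl⟩
  have hηc : Continuous η := by
    rw [show η = _ from funext hη]
    have := continuous_boundaryTangent hr
    fun_prop
  have hτ : ∀ θ, 0 < ‖boundaryTangent r θ‖ := fun θ =>
    norm_pos_iff.2 (boundaryTangent_ne_zero hr θ)
  have hη1 : ∀ θ, η θ < ‖boundaryTangent r θ‖ := fun θ => by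
    have : Real.cos (g θ) < 1 := by
      rw [← Real.cos_zero]
      exact Real.cos_lt_cos_of_nonneg_of_le_pi le_rfl (hgI θ).2.le (hgI θ).1
    have := mul_lt_mul_of_pos_left this (hτ θ)
    simpa [hη] using this
  have hη2 : ∀ θ, -‖boundaryTangent r θ‖ < η θ := fun θ => by
    have : -1 < Real.cos (g θ) := by
      rw [← Real.cos_pi]
      exact Real.cos_lt_cos_of_nonneg_of_le_pi (hgI θ).1.le le_rfl (hgI θ).2
    have := mul_lt_mul_of_pos_left this (hτ θ)
    simpa [hη] using this
  have hηp : Function.Periodic η (2 * π) := fun θ => by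
    have h1 : boundaryTangent r (θ + 2 * π) = boundaryTangent r θ := by
      have h2 : Function.Periodic (deriv r) (2 * π) := fun u => by
        have := deriv_comp_add_const r (2 * π) u
        rw [← this]; congr 1; ext y; exact hr.periodic y
      have h : ((θ + 2 * π : ℝ) : ℂ) * Complex.I = (θ : ℂ) * Complex.I + 2 * π * Complex.I := by
        push_cast; ring
      rw [boundaryTangent_eq hr, boundaryTangent_eq hr, h2, hr.periodic, h,
        Complex.exp_periodic _]
    simp only [hη, h1, hgp θ]
  obtain ⟨S, hSdef⟩ : ∃ S : ℝ → ℝ, ∀ θ, S θ = ∫ u in (0 : ℝ)..θ, η u := ⟨_, fun _ => rfl⟩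
  have hS : ∀ θ, HasDerivAt S (η θ) θ := fun θ => by
    rw [show S = _ from funext hSdef]
    exact intervalIntegral.integral_hasDerivAt_right (hηc.intervalIntegrable _ _)
      hηc.aestronglyMeasurable.stronglyMeasurableAtFilter hηc.continuousAt
  have hSc : Continuous S := continuous_iff_continuousAt.2 fun θ => (hS θ).continuousAt
  have hSp : ∀ θ, S (θ + 2 * π) = S θ + ∫ u in (0 : ℝ)..2 * π, η u := fun θ => by
    rw [hSdef, hSdef, ← intervalIntegral.integral_add_adjacent_intervals
      (hηc.intervalIntegrable 0 θ) (hηc.intervalIntegrable θ (θ + 2 * π)),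
      hηp.intervalIntegral_add_eq θ 0, zero_add]
  obtain ⟨Φ, hΦ⟩ : ∃ Φ : ℝ → ℝ → ℝ, ∀ s t, Φ s t = chordLength r s t + S s - S t :=
    ⟨_, fun _ _ => rfl⟩
  have hΦc : Continuous fun x : ℝ × ℝ => Φ x.1 x.2 := by
    simp only [hΦ]
    have := continuous_chordLength hr
    fun_prop
  have hmax : ∀ s b, BilliardStep r (s, g s) b → ∀ t ∈ Icc s (s + 2 * π), Φ s t ≤ Φ s b.1 := by
    intro s b hb t ht
    rw [hΦ, hΦ]
    exact chordLength_sub_le_of_orbit hr (fun θ => (horb θ).imp fun x hx => ⟨hx.1, hx.2.1⟩)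
      (by simpa only [hη] using hS) (by simpa only [hη] using hη1) (by simpa only [hη] using hη2)
      hb t ht
  -- The end point is written `s + u` so that the supremum runs over a fixed compact interval and is
  -- continuous in `s`.
  obtain ⟨C, hCdef⟩ : ∃ C : ℝ → ℝ, ∀ s, C s = sSup ((fun u => Φ s (s + u)) '' Icc 0 (2 * π)) :=
    ⟨_, fun _ => rfl⟩
  have hCc : Continuous C := by
    rw [show C = _ from funext hCdef]
    exact isCompact_Icc.continuous_sSup (f := fun s u => Φ s (s + u)) 
      (hΦc.comp (continuous_fst.prodMk (continuous_fst.add continuous_snd)))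
  have hCge : ∀ s t, s ≤ t → t ≤ s + 2 * π → Φ s t ≤ C s := by
    intro s t h1 h2
    rw [hCdef]
    refine le_csSup (isCompact_Icc.image ?_).bddAbove
      ⟨t - s, ⟨by linarith, by linarith⟩, by simp⟩
    exact hΦc.comp (continuous_const.prodMk (continuous_const.add continuous_id))
  have hCeq : ∀ s (x : ℤ → ℝ), x 0 = s →
      (∀ i, BilliardStep r (x i, g (x i)) (x (i + 1), g (x (i + 1)))) → Φ s (x 1) = C s := by
    intro s x hx0 hx
    have h1 := (hx 0).lt
    have h2 := (hx 0).lt_add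
    simp only [hx0, zero_add] at h1 h2
    refine le_antisymm (hCge s _ h1.le h2.le)
      ((hCdef s).trans_le (csSup_le ((nonempty_Icc.2 Real.two_pi_pos.le).image _) ?_))
    rintro _ ⟨u, hu, rfl⟩
    have h0 := hx 0
    rw [hx0, zero_add] at h0
    exact hmax s _ h0 (s + u) ⟨by linarith [hu.1], by linarith [hu.2]⟩
  -- Envelope argument: freezing the end point `x 1` touches `C` from below at `s`, and by the first
  -- variation formula the derivative there is -η + η = 0. Differentiability of `C` is not needed.
  have hconst : ∀ a b, C a = C b := by
    refine eq_of_forall_exists_hasDerivAt_zero_le hCc fun s => ?_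
    obtain ⟨x, hx0, hx, -⟩ := horb s
    have h0 := hx 0
    rw [hx0, zero_add] at h0
    refine ⟨fun u => Φ u (x 1), hCeq s x hx0 hx, ?_, ?_⟩
    · have h1 : s < x 1 := h0.lt
      have h2 : x 1 < s + 2 * π := h0.lt_add
      filter_upwards [Ioo_mem_nhds (show x 1 - 2 * π < s by linarith) h1] with u hu
      exact hCge u _ hu.2.le (by linarith [hu.1])
    · have := ((h0.hasDerivAt_left hr).fun_add (hS s)).sub_const (S (x 1))
      simpa [hη, hΦ] using this
  refine ⟨S, C 0, _, hSp, ?_, ?_⟩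
  · intro s t h1 h2
    have := hCge s t h1 h2
    rw [hconst s 0] at this
    simp only [hΦ] at this
    linarith
  · intro θ
    obtain ⟨x, hx0, hx, hxq⟩ := horb θ
    refine ⟨x, hx0, fun i => (hx i).lt, fun i => (hx i).lt_add, hxq, fun i => ?_⟩
    have := hCeq (x i) (fun j => x (i + j)) (by simp) fun j => by
      have := hx (i + j)
      rwa [add_assoc] at this
    rw [hconst (x i) 0] at this
    simp only [hΦ] at this
    linarith

/-- A table with a `1/2` caustic has constant width in the polar sense: the longest chords issued
from all points of the boundary have the same length. -/
theorem exists_maximal_chordLength {r : ℝ → ℝ} (hr : IsBilliardTable r)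
    (h : HasRationalCaustic r 1 2) :
    ∃ L : ℝ, (∀ s t, s ≤ t → t ≤ s + 2 * π → chordLength r s t ≤ L) ∧
      ∀ s, ∃ t, s ≤ t ∧ t ≤ s + 2 * π ∧ chordLength r s t = L := by
  obtain ⟨S, C, σ, hS, hle, horb⟩ := exists_calibration hr h
  refine ⟨C + σ / 2, fun s t h1 h2 => ?_, fun s => ?_⟩
  · have h3 := hle s t h1 h2
    -- The chord is run forth and back, so the increments of `S` add up to σ.
    have h4 := hle t (s + 2 * π) h2 (by linarith)
    rw [chordLength_add_two_pi_right hr, chordLength_comm, hS] at h4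
    linarith
  · obtain ⟨x, hx0, hx1, hx2, hx3, hx4⟩ := horb s
    have e2 := hx3 0
    have h1 := hx4 0
    have h2 := hx4 1
    have h3 := hx1 0
    have h4 := hx2 0
    norm_num at e2 h1 h2 h3 h4
    rw [e2, hx0] at h2
    rw [hx0] at h1 h3 h4
    rw [chordLength_add_two_pi_right hr, chordLength_comm, hS] at h2
    exact ⟨x 1, h3.le, h4.le, by linarith⟩

/-- In a table with a `1/3` caustic, the inscribed triangles of maximal perimeter with a vertex
at a given boundary point all have the same perimeter. -/
theorem exists_maximal_triangle {r : ℝ → ℝ} (hr : IsBilliardTable r)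
    (h : HasRationalCaustic r 1 3) :
    ∃ L : ℝ, (∀ s t u, s ≤ t → t ≤ u → u ≤ s + 2 * π →
        chordLength r s t + chordLength r t u + chordLength r u s ≤ L) ∧
      ∀ s, ∃ t u, s ≤ t ∧ t ≤ u ∧ u ≤ s + 2 * π ∧
        chordLength r s t + chordLength r t u + chordLength r u s = L := by
  obtain ⟨S, C, σ, hS, hle, horb⟩ := exists_calibration hr h
  refine ⟨3 * C + σ, fun s t u h1 h2 h3 => ?_, fun s => ?_⟩
  · have h4 := hle s t h1 (by linarith)
    have h5 := hle t u h2 (by linarith)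
    have h6 := hle u (s + 2 * π) h3 (by linarith)
    rw [chordLength_add_two_pi_right hr, hS] at h6
    linarith
  · obtain ⟨x, hx0, hx1, hx2, hx3, hx4⟩ := horb s
    have e3 := hx3 0
    have h1 := hx4 0
    have h2 := hx4 1
    have h3 := hx4 2
    have h4 := hx1 0
    have h5 := hx1 1
    have h6 := hx1 2
    norm_num at e3 h1 h2 h3 h4 h5 h6
    rw [e3, hx0] at h3 h6
    rw [hx0] at h1 h4
    rw [chordLength_add_two_pi_right hr, hS] at h3
    exact ⟨x 1, x 2, h4.le, h5.le, h6.le, by linarith⟩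

/-! ### Expansion of the length of chords of an almost circular table -/

/-- Law of cosines in half-angle form, which separates the radial difference, small to second order,
from the main term. -/
theorem chordLength_sq (r : ℝ → ℝ) (s t : ℝ) :
    chordLength r s t ^ 2 = (r s - r t) ^ 2 + 4 * r s * r t * Real.sin ((t - s) / 2) ^ 2 := by
  have h1 : Real.cos (t - s) = 1 - 2 * Real.sin ((t - s) / 2) ^ 2 := by
    rw [show t - s = 2 * ((t - s) / 2) by ring, Real.cos_two_mul, Real.sin_sq]; ring_nf
  have h2 : chordLength r s t ^ 2 = r s ^ 2 + r t ^ 2 - 2 * r s * r t * Real.cos (t - s) := by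
    rw [chordLength, ← Complex.normSq_eq_norm_sq, Complex.normSq_apply, Real.cos_sub]
    simp only [boundaryPoint, Complex.sub_re, Complex.sub_im, Complex.re_ofReal_mul,
      Complex.im_ofReal_mul, Complex.exp_ofReal_mul_I_re, Complex.exp_ofReal_mul_I_im]
    have h3 := Real.sin_sq_add_cos_sq t
    have h4 := Real.sin_sq_add_cos_sq s
    linear_combination (r t) ^ 2 * h3 + (r s) ^ 2 * h4
  rw [h2, h1]; ring

theorem chordLength_nonneg (r : ℝ → ℝ) (s t : ℝ) : 0 ≤ chordLength r s t := norm_nonneg _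

/-- The second order Taylor polynomial of the length of the chord which joins the points with
radii `1 + a` and `1 + b` at an angular distance `2 * α + d`. -/
noncomputable def chordTaylor (α a b d : ℝ) : ℝ :=
  2 * sin α + sin α * (a + b) + cos α * d + cos α / 2 * (a + b) * d - sin α / 4 * d ^ 2 +
    cos α ^ 2 / (4 * sin α) * (a - b) ^ 2

theorem abs_sin_add_half_sub_le {α d z : ℝ} (hd : |d| ≤ z) (hz : z ≤ 1) :
    |sin (α + d / 2) - (sin α + cos α * d / 2 - sin α * d ^ 2 / 8)| ≤ 2 * z ^ 3 := by
  have hz0 : 0 ≤ z := (abs_nonneg d).trans hd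
  have hd2 : |d / 2| ≤ z / 2 := by rw [abs_div, abs_two]; linarith
  have h1 := Real.cos_bound (x := d / 2) (by linarith)
  have h2 := Real.sin_bound (x := d / 2) (by linarith)
  have h3 : |d / 2| ^ 3 ≤ (z / 2) ^ 3 := by gcongr
  have hz3 : 0 ≤ z ^ 3 := by positivity
  have h4 : |d / 2| ^ 4 ≤ z ^ 3 := by
    have : |d / 2| ^ 4 ≤ z ^ 4 := by gcongr; linarith
    nlinarith
  have h5 : |d / 2| ^ 5 ≤ z ^ 3 := by
    have : |d / 2| ^ 5 ≤ z ^ 5 := by gcongr; linarith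
    have : z ^ 5 ≤ z ^ 3 := pow_le_pow_of_le_one hz0 hz (by norm_num)
    linarith
  have h6 : |cos (d / 2) - (1 - d ^ 2 / 8)| ≤ z ^ 3 := by
    rw [show 1 - d ^ 2 / 8 = 1 - (d / 2) ^ 2 / 2 by ring]; linarith
  have h7 : |sin (d / 2) - d / 2| ≤ z ^ 3 := by
    have h8 : |(d / 2) ^ 3 / 6| ≤ z ^ 3 / 48 := by
      rw [abs_div, abs_pow]; norm_num
      rw [div_pow] at h3; norm_num at h3 ⊢; linarith
    calc |sin (d / 2) - d / 2| = |(sin (d / 2) - (d / 2 - (d / 2) ^ 3 / 6)) - (d / 2) ^ 3 / 6| := by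
          ring_nf
      _ ≤ _ := abs_sub _ _
      _ ≤ z ^ 3 := by linarith
  rw [Real.sin_add]
  calc _ = |sin α * (cos (d / 2) - (1 - d ^ 2 / 8)) + cos α * (sin (d / 2) - d / 2)| := by ring_nf
    _ ≤ |sin α * (cos (d / 2) - (1 - d ^ 2 / 8))| + |cos α * (sin (d / 2) - d / 2)| :=
        abs_add_le _ _
    _ ≤ 1 * z ^ 3 + 1 * z ^ 3 := by
        rw [abs_mul, abs_mul]
        gcongr
        · exact abs_sin_le_one α
        · exact abs_cos_le_one α
    _ = 2 * z ^ 3 := by ring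

/-- Here `l + T ≥ T`. It reduces the expansion of a chord to that of its square, so no square root
is expanded. -/
theorem abs_sub_le_of_sq {l T : ℝ} (hl : 0 ≤ l) (hT : 0 < T) : |l - T| ≤ |l ^ 2 - T ^ 2| / T := by
  rw [le_div_iff₀ hT, sq_sub_sq, abs_mul, mul_comm]
  gcongr
  rw [abs_of_nonneg (by linarith)]; linarith

theorem abs_le_of_four {x a b c d A B C D : ℝ} (h : x = a + b + c + d) (ha : |a| ≤ A)
    (hb : |b| ≤ B) (hc : |c| ≤ C) (hd : |d| ≤ D) : |x| ≤ A + B + C + D := by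
  rw [h]
  have h1 := abs_add_le (a + b + c) d
  have h2 := abs_add_le (a + b) c
  have h3 := abs_add_le a b
  linarith

theorem abs_mul_le {a b A B : ℝ} (ha : |a| ≤ A) (hb : |b| ≤ B) : |a * b| ≤ A * B := by
  rw [abs_mul]
  exact mul_le_mul ha hb (abs_nonneg _) ((abs_nonneg _).trans ha)

/-- Here `s`, `c` are sin α, cos α and `U` is sin(α + d/2). The polynomial subtracted from `U` is
its second order Taylor polynomial V. The coefficient `κ = c² / (4s)` is the one for which the term
(a - b)² cancels at leading order in the difference of squares. -/
theorem abs_chord_sq_sub_sq_le {s c κ a b d z U : ℝ} (hκ0 : 0 ≤ κ) (hsκ : 4 * s * κ = c ^ 2)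
    (hsc : s ^ 2 + c ^ 2 = 1) (hs1 : |s| ≤ 1) (hz1 : z ≤ 1) (ha : |a| ≤ z) (hb : |b| ≤ z)
    (hd : |d| ≤ z) (hU1 : |U| ≤ 1) (hsU : |s - U| ≤ z / 2)
    (hU : |U - (s + c * d / 2 - s * d ^ 2 / 8)| ≤ 2 * z ^ 3)
    (hsV : |s - (s + c * d / 2 - s * d ^ 2 / 8)| ≤ z) :
    |(a - b) ^ 2 + 4 * (1 + a) * (1 + b) * U ^ 2 - ((2 + (a + b)) * (s + c * d / 2 - s * d ^ 2 / 8) +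
      ((a + b) * s * d ^ 2 / 8 + κ * (a - b) ^ 2)) ^ 2| ≤
      4 * (1 + 12 * κ) * z ^ 3 + 96 * z ^ 3 + 4 * z ^ 3 + (1 + 4 * κ) ^ 2 * z ^ 3 := by
  obtain ⟨V, hV⟩ : ∃ V, V = s + c * d / 2 - s * d ^ 2 / 8 := ⟨_, rfl⟩
  rw [← hV] at hU hsV ⊢
  have hz0 : 0 ≤ z := (abs_nonneg d).trans hd
  have hV2 : |V| ≤ 2 := by
    rw [abs_le] at hs1 hsV ⊢; constructor <;> linarith
  have hσ : |a + b| ≤ 2 * z := (abs_add_le a b).trans (by linarith)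
  have hδ : |a - b| ≤ 2 * z := (abs_sub a b).trans (by linarith)
  have hd2 : |d ^ 2| ≤ z * z := by rw [sq]; exact abs_mul_le hd hd
  have h1 : |(a - b) ^ 2| ≤ 2 * z * (2 * z) := by rw [sq]; exact abs_mul_le hδ hδ
  have h2σ : |2 + (a + b)| ≤ 4 := by rw [abs_le] at hσ ⊢; constructor <;> linarith
  have hA : |(a + b) * s * d ^ 2 / 8| ≤ z ^ 3 / 4 := by
    have := abs_mul_le (abs_mul_le hσ hs1) hd2
    rw [abs_div, abs_of_pos (show (0 : ℝ) < 8 by norm_num)]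
    linarith [show 2 * z * 1 * (z * z) = 2 * z ^ 3 by ring]
  have hκδ : |κ * (a - b) ^ 2| ≤ κ * (2 * z * (2 * z)) :=
    abs_mul_le (abs_of_nonneg hκ0).le h1
  have hz3 : 0 ≤ z ^ 3 := by positivity
  have hz32 : z ^ 3 ≤ z ^ 2 := pow_le_pow_of_le_one hz0 hz1 (by norm_num)
  have hz43 : z ^ 4 ≤ z ^ 3 := pow_le_pow_of_le_one hz0 hz1 (by norm_num)
  -- From 4(1+a)(1+b) = (2+a+b)² - (a-b)², and 1 - U² = (s² - U²) + 4sκ. Each of the four groups is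
  -- of third order in `z`.
  refine abs_le_of_four (a := (a - b) ^ 2 * ((s - U) * (s + U) + 4 * κ * (s - V) -
    2 * κ * ((a + b) * V))) (b := (2 + (a + b)) * (2 + (a + b)) * ((U - V) * (U + V)))
    (c := -((2 + (a + b)) * (V * ((a + b) * s * d ^ 2 / 4))))
    (d := -(((a + b) * s * d ^ 2 / 8 + κ * (a - b) ^ 2) *
      ((a + b) * s * d ^ 2 / 8 + κ * (a - b) ^ 2))) ?_ ?_ ?_ ?_ ?_
  · linear_combination -(a - b) ^ 2 * hsκ - (a - b) ^ 2 * hsc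
  · have e1 := abs_mul_le hsU ((abs_add_le s U).trans (show _ ≤ (2 : ℝ) by linarith))
    have e2 : |4 * κ * (s - V)| ≤ 4 * κ * z :=
      abs_mul_le (abs_of_nonneg (by positivity)).le hsV
    have e3 : |2 * κ * ((a + b) * V)| ≤ 2 * κ * (2 * z * 2) :=
      abs_mul_le (abs_of_nonneg (by positivity)).le (abs_mul_le hσ hV2)
    have e5 : |(s - U) * (s + U) + 4 * κ * (s - V) - 2 * κ * ((a + b) * V)| ≤
        (1 + 12 * κ) * z := by
      rw [abs_le] at e1 e2 e3 ⊢
      constructor <;> linarith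
    have := abs_mul_le h1 e5
    linarith [show 2 * z * (2 * z) * ((1 + 12 * κ) * z) = 4 * (1 + 12 * κ) * z ^ 3 by ring]
  · have := abs_mul_le (abs_mul_le h2σ h2σ)
      (abs_mul_le hU ((abs_add_le U V).trans (show _ ≤ (3 : ℝ) by linarith)))
    linarith
  · rw [abs_neg]
    have e1 : |(a + b) * s * d ^ 2 / 4| ≤ z ^ 3 / 2 := by
      rw [show (a + b) * s * d ^ 2 / 4 = 2 * ((a + b) * s * d ^ 2 / 8) by ring, abs_mul, abs_two]
      linarith
    have := abs_mul_le h2σ (abs_mul_le hV2 e1)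
    linarith
  · rw [abs_neg]
    have e1 : |(a + b) * s * d ^ 2 / 8 + κ * (a - b) ^ 2| ≤ (1 + 4 * κ) * z ^ 2 :=
      (abs_add_le _ _).trans (by linarith)
    have := abs_mul_le e1 e1
    have e2 : (1 + 4 * κ) ^ 2 * z ^ 4 ≤ (1 + 4 * κ) ^ 2 * z ^ 3 :=
      mul_le_mul_of_nonneg_left hz43 (sq_nonneg _)
    linarith [show (1 + 4 * κ) * z ^ 2 * ((1 + 4 * κ) * z ^ 2) = (1 + 4 * κ) ^ 2 * z ^ 4 by ring]

theorem exists_abs_sub_chordTaylor_le {α : ℝ} (hα : 0 < sin α) :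
    ∃ C : ℝ, 0 ≤ C ∧ ∀ l a b d z : ℝ, 0 ≤ l →
      l ^ 2 = (a - b) ^ 2 + 4 * (1 + a) * (1 + b) * sin (α + d / 2) ^ 2 →
      |a| ≤ z → |b| ≤ z → |d| ≤ z → 5 * z ≤ sin α → |l - chordTaylor α a b d| ≤ C * z ^ 3 := by
  obtain ⟨s, hs⟩ : ∃ s, s = sin α := ⟨_, rfl⟩
  obtain ⟨c, hc⟩ : ∃ c, c = cos α := ⟨_, rfl⟩
  obtain ⟨κ, hκ⟩ : ∃ κ, κ = c ^ 2 / (4 * s) := ⟨_, rfl⟩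
  have hsc : s ^ 2 + c ^ 2 = 1 := by rw [hs, hc]; exact Real.sin_sq_add_cos_sq α
  have hs1 : |s| ≤ 1 := by rw [hs]; exact abs_sin_le_one α
  have hc1 : |c| ≤ 1 := by rw [hc]; exact abs_cos_le_one α
  rw [← hs] at hα
  have hκ0 : 0 ≤ κ := by rw [hκ]; positivity
  have hsκ : 4 * s * κ = c ^ 2 := by rw [hκ]; field_simp
  refine ⟨(4 * (1 + 12 * κ) + 96 + 4 + (1 + 4 * κ) ^ 2) / s, by positivity,
    fun l a b d z hl hl2 ha hb hd hz => ?_⟩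
  rw [← hs] at hz
  have hz0 : 0 ≤ z := (abs_nonneg d).trans hd
  have hz1 : z ≤ 1 := by linarith [(abs_le.1 hs1).2]
  have hU := abs_sin_add_half_sub_le (α := α) hd hz1
  rw [← hs, ← hc] at hU
  have hσ : |a + b| ≤ 2 * z := (abs_add_le a b).trans (by linarith)
  have hcd : |c * d| ≤ 1 * z := abs_mul_le hc1 hd
  have hsd : |s * d ^ 2| ≤ 1 * (z * z) := abs_mul_le hs1 (by rw [sq]; exact abs_mul_le hd hd)
  have hzz : z * z ≤ z := by nlinarith
  have hsV : |s - (s + c * d / 2 - s * d ^ 2 / 8)| ≤ z := by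
    rw [show s - (s + c * d / 2 - s * d ^ 2 / 8) = -(c * d) / 2 + s * d ^ 2 / 8 by ring]
    rw [abs_le] at hcd hsd ⊢
    constructor <;> linarith
  have hsU : |s - sin (α + d / 2)| ≤ z / 2 := by
    have h1 := Real.abs_sin_sub_sin_le (α + d / 2) α
    rw [add_sub_cancel_left, abs_div, abs_two] at h1
    rw [abs_sub_comm, hs]
    linarith
  have hTe : chordTaylor α a b d = 2 * s + s * (a + b) + c * d + c / 2 * (a + b) * d -
      s / 4 * d ^ 2 + κ * (a - b) ^ 2 := by rw [chordTaylor, hκ, hs, hc]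
  have hT : s ≤ chordTaylor α a b d := by
    have h1 : |s * (a + b)| ≤ 1 * (2 * z) := abs_mul_le hs1 hσ
    have h2 : |c / 2 * (a + b) * d| ≤ 1 * z := by
      refine abs_mul_le ?_ hd
      have : |c / 2 * (a + b)| ≤ 1 / 2 * (2 * z) := abs_mul_le (by
        rw [abs_div, abs_two]; linarith) hσ
      linarith
    have h3 : 0 ≤ κ * (a - b) ^ 2 := by positivity
    rw [hTe]
    rw [abs_le] at h1 h2 hcd hsd
    linarith
  have hT0 : 0 < chordTaylor α a b d := hα.trans_le hT
  have hTV : chordTaylor α a b d = (2 + (a + b)) * (s + c * d / 2 - s * d ^ 2 / 8) +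
      ((a + b) * s * d ^ 2 / 8 + κ * (a - b) ^ 2) := by
    rw [hTe]; ring
  have hmain := abs_chord_sq_sub_sq_le hκ0 hsκ hsc hs1 hz1 ha hb hd (abs_sin_le_one _) hsU hU hsV
  rw [← hTV, ← hl2] at hmain
  calc |l - chordTaylor α a b d| ≤ |l ^ 2 - chordTaylor α a b d ^ 2| / chordTaylor α a b d :=
        abs_sub_le_of_sq hl hT0
    _ ≤ |l ^ 2 - chordTaylor α a b d ^ 2| / s := by gcongr
    _ ≤ (4 * (1 + 12 * κ) * z ^ 3 + 96 * z ^ 3 + 4 * z ^ 3 + (1 + 4 * κ) ^ 2 * z ^ 3) / s := by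
        gcongr
    _ = _ := by ring

/-! ### Chords of a deformation of the unit circle -/

/-- The curve `r` is, up to an error of order `ε ^ 3`, the deformation `1 + ε n + ε² m` of the unit
circle; all the constants are controlled by `N`. -/
structure IsDeformation (n n' m r : ℝ → ℝ) (N ε : ℝ) : Prop where
  pos : 0 < ε
  le_one : ε ≤ 1
  abs_first_le : ∀ x, |n x| ≤ N
  abs_deriv_le : ∀ x, |n' x| ≤ N
  taylor : ∀ x h, |n (x + h) - n x - n' x * h| ≤ N * h ^ 2
  abs_le_second : ∀ x, |m x| ≤ N
  lipschitz : ∀ x h, |m (x + h) - m x| ≤ N * |h|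
  approx : ∀ x, |r x - (1 + ε * n x + ε ^ 2 * m x)| ≤ N * ε ^ 3

namespace IsDeformation

variable {n n' m r : ℝ → ℝ} {N ε : ℝ}

theorem nonneg (h : IsDeformation n n' m r N ε) : 0 ≤ N := (abs_nonneg _).trans (h.abs_first_le 0)

theorem pow_le (h : IsDeformation n n' m r N ε) {k l : ℕ} (hkl : k ≤ l) : ε ^ l ≤ ε ^ k :=
  pow_le_pow_of_le_one h.pos.le h.le_one hkl

theorem radius_expansion (h : IsDeformation n n' m r N ε) {B ξ : ℝ} (hξ : |ξ| ≤ B) (x : ℝ) :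
    |r (x + ε * ξ) - 1 - (ε * n x + ε ^ 2 * (m x + n' x * ξ))| ≤ N * (B ^ 2 + B + 1) * ε ^ 3 := by
  have hN := h.nonneg
  have hε := h.pos
  have hB : 0 ≤ B := (abs_nonneg ξ).trans hξ
  have hξ2 : ξ ^ 2 ≤ B ^ 2 := sq_le_sq' (abs_le.1 hξ).1 (abs_le.1 hξ).2
  have h1 := h.approx (x + ε * ξ)
  have h2 : |ε * (n (x + ε * ξ) - n x - n' x * (ε * ξ))| ≤ ε * (N * (ε ^ 2 * B ^ 2)) :=
    abs_mul_le (abs_of_pos hε).le ((h.taylor x (ε * ξ)).trans (by rw [mul_pow]; gcongr))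
  have h3 : |ε ^ 2 * (m (x + ε * ξ) - m x)| ≤ ε ^ 2 * (N * (ε * B)) :=
    abs_mul_le (abs_of_pos (by positivity)).le ((h.lipschitz x (ε * ξ)).trans (by
      gcongr; exact abs_mul_le (abs_of_pos hε).le hξ))
  have := abs_le_of_four (x := r (x + ε * ξ) - 1 - (ε * n x + ε ^ 2 * (m x + n' x * ξ)))
    (d := 0) (by ring) h1 h2 h3 (abs_zero.le)
  linarith

theorem abs_radius_sub_one_le (h : IsDeformation n n' m r N ε) (x : ℝ) :
    |r x - 1| ≤ 3 * N * ε := by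
  have hN := h.nonneg
  have hε := h.pos
  have h1 := h.approx x
  have h2 : |ε * n x| ≤ ε * N := abs_mul_le (abs_of_pos hε).le (h.abs_first_le x)
  have h3 : |ε ^ 2 * m x| ≤ ε ^ 2 * N :=
    abs_mul_le (abs_of_pos (by positivity)).le (h.abs_le_second x)
  have := abs_le_of_four (x := r x - 1) (d := 0) (by ring) h1 h2 h3 (abs_zero.le)
  have h4 := mul_le_mul_of_nonneg_left (h.pow_le (show 1 ≤ 2 by norm_num)) hN
  have h5 := mul_le_mul_of_nonneg_left (h.pow_le (show 1 ≤ 3 by norm_num)) hN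
  rw [pow_one] at h4 h5
  linarith

end IsDeformation

/-- The coefficient of `ε ^ 2` in the length of the chord between the points at polar angles
`φ + ε ξ` and `ψ + ε ζ`, where `ψ = φ + 2 α`. -/
noncomputable def chordSecondOrder (n n' m : ℝ → ℝ) (α φ ψ ξ ζ : ℝ) : ℝ :=
  sin α * (m φ + m ψ) + sin α * (n' φ * ξ + n' ψ * ζ) + cos α / 2 * (n φ + n ψ) * (ζ - ξ) -
    sin α / 4 * (ζ - ξ) ^ 2 + cos α ^ 2 / (4 * sin α) * (n φ - n ψ) ^ 2

/-- The constants depend only on α, `N` and `B`, since `m`, `r` and `ε` will vary along a sequence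
of tables. End points are displaced by multiples of `ε` because maximal polygons deviate from
regular ones by that order, which is felt at order ε². -/
theorem exists_chordLength_expansion {α : ℝ} (hα : 0 < sin α) {N B : ℝ} (hN : 0 ≤ N)
    (hB : 0 ≤ B) :
    ∃ C : ℝ, 0 ≤ C ∧ ∃ ε₁ : ℝ, 0 < ε₁ ∧ ∀ (n n' m r : ℝ → ℝ) (ε : ℝ),
      IsDeformation n n' m r N ε → ε ≤ ε₁ → ∀ φ ψ ξ ζ : ℝ, ψ = φ + 2 * α → |ξ| ≤ B → |ζ| ≤ B →
        |chordLength r (φ + ε * ξ) (ψ + ε * ζ) - (2 * sin α +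
          ε * (sin α * (n φ + n ψ) + cos α * (ζ - ξ)) +
          ε ^ 2 * chordSecondOrder n n' m α φ ψ ξ ζ)| ≤ C * ε ^ 3 := by
  obtain ⟨C, hC, hT⟩ := exists_abs_sub_chordTaylor_le hα
  set A := N * (B ^ 2 + B + 1) with hA
  have hA0 : 0 ≤ A := by positivity
  -- With this `M`, all deviations of radii and angles are at most `M * ε`, which becomes `z` in the
  -- Taylor estimate; the bound on `ε` below is `5 * z ≤ sin α`.
  set M := 2 * N + N * B + A + 2 * B + 1 with hM
  have hM0 : 0 < M := by positivity
  have hNB : 0 ≤ N * B := mul_nonneg hN hB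
  have hM1 : 2 * N ≤ M := by linarith
  have hM2 : 2 * B ≤ M := by linarith
  set κ := cos α ^ 2 / (4 * sin α) with hκ
  have hκ0 : 0 ≤ κ := by positivity
  refine ⟨C * M ^ 3 + 2 * A + (2 * M * M) + κ * (2 * M * (4 * M)), by positivity,
    sin α / (5 * M), by positivity, fun n n' m r ε h hε φ ψ ξ ζ hψ hξ hζ => ?_⟩
  have hε0 := h.pos
  have h32 : ε ^ 3 ≤ ε ^ 2 := h.pow_le (by norm_num)
  have h21 : ε ^ 2 ≤ ε := by simpa using h.pow_le (show 1 ≤ 2 by norm_num)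
  have key : ∀ x ξ, |ξ| ≤ B → |r (x + ε * ξ) - 1 - (ε * n x + ε ^ 2 * (m x + n' x * ξ))| ≤
      A * ε ^ 3 ∧ |r (x + ε * ξ) - 1 - ε * n x| ≤ M * ε ^ 2 ∧ |r (x + ε * ξ) - 1| ≤ M * ε := by
    intro x ξ hξ
    have h1 := h.radius_expansion hξ x
    have h2 : |ε ^ 2 * m x| ≤ ε ^ 2 * N :=
      abs_mul_le (abs_of_pos (by positivity)).le (h.abs_le_second x)
    have h3 : |ε ^ 2 * (n' x * ξ)| ≤ ε ^ 2 * (N * B) :=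
      abs_mul_le (abs_of_pos (by positivity)).le (abs_mul_le (h.abs_deriv_le x) hξ)
    have h4 : |ε * n x| ≤ ε * N := abs_mul_le (abs_of_pos hε0).le (h.abs_first_le x)
    have h5 := mul_le_mul_of_nonneg_left h32 hA0
    have h6 := mul_le_mul_of_nonneg_left h21 (show 0 ≤ N + N * B + A by positivity)
    have h7 : 0 ≤ B * ε := by positivity
    have h8 : 0 ≤ B * ε ^ 2 := by positivity
    have h9 : 0 ≤ N * ε ^ 2 := by positivity
    have h10 : 0 ≤ N * ε := by positivity
    have h11 : |r (x + ε * ξ) - 1 - ε * n x| ≤ (N + N * B + A) * ε ^ 2 := by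
      refine (abs_le_of_four (d := 0) (D := 0) (by ring) h1 h2 h3 abs_zero.le).trans ?_
      linarith
    refine ⟨h1, h11.trans ?_, ?_⟩
    · gcongr; rw [hM]; linarith
    · refine (abs_le_of_four (c := 0) (d := 0) (C := 0) (D := 0) (by ring) h11 h4 abs_zero.le
        abs_zero.le).trans ?_
      have : M * ε = 2 * N * ε + N * B * ε + A * ε + 2 * B * ε + ε := by rw [hM]; ring
      linarith
  obtain ⟨a1, a2, a3⟩ := key φ ξ hξ
  obtain ⟨b1, b2, b3⟩ := key ψ ζ hζ
  have hd0 : |ζ - ξ| ≤ 2 * B := (abs_sub _ _).trans (by linarith)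
  have hd : |ε * (ζ - ξ)| ≤ ε * M :=
    abs_mul_le (abs_of_pos hε0).le (hd0.trans hM2)
  have hz : 5 * (M * ε) ≤ sin α := by
    rw [le_div_iff₀ (by positivity)] at hε; linarith
  have hexp := hT (chordLength r (φ + ε * ξ) (ψ + ε * ζ)) (r (φ + ε * ξ) - 1) (r (ψ + ε * ζ) - 1)
    (ε * (ζ - ξ)) (M * ε) (chordLength_nonneg _ _ _) (by
      rw [chordLength_sq, hψ]; ring_nf) a3 b3 (by rwa [mul_comm M]) hz
  have hs1 : |sin α| ≤ 1 := abs_sin_le_one α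
  have hc1 : |cos α / 2| ≤ 1 / 2 := by
    rw [abs_div, abs_two]; linarith [abs_cos_le_one α]
  obtain ⟨a, ha⟩ : ∃ a, a = r (φ + ε * ξ) - 1 := ⟨_, rfl⟩
  obtain ⟨b, hb⟩ : ∃ b, b = r (ψ + ε * ζ) - 1 := ⟨_, rfl⟩
  rw [← ha] at a1 a2 a3 hexp
  rw [← hb] at b1 b2 b3 hexp
  -- Four sources of error: the Taylor remainder, the radii in the linear term, and the replacement
  -- of the radial deviations by `ε n` in the mixed term and in the squared difference.
  refine (abs_le_of_four (a := chordLength r (φ + ε * ξ) (ψ + ε * ζ) -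
      chordTaylor α a b (ε * (ζ - ξ)))
    (b := sin α * ((a - (ε * n φ + ε ^ 2 * (m φ + n' φ * ξ))) +
      (b - (ε * n ψ + ε ^ 2 * (m ψ + n' ψ * ζ)))))
    (c := cos α / 2 * ((a - ε * n φ) + (b - ε * n ψ)) * (ε * (ζ - ξ)))
    (d := κ * (((a - ε * n φ) - (b - ε * n ψ)) * ((a - b) + ε * (n φ - n ψ)))) ?_ hexp
    (abs_mul_le hs1 ((abs_add_le _ _).trans (add_le_add a1 b1)))
    (abs_mul_le (abs_mul_le hc1 ((abs_add_le _ _).trans (add_le_add a2 b2))) hd)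
    (abs_mul_le (abs_of_nonneg hκ0).le (abs_mul_le ((abs_sub _ _).trans (add_le_add a2 b2))
      (((abs_add_le _ _).trans (add_le_add ((abs_sub _ _).trans (add_le_add a3 b3))
        (abs_mul_le (abs_of_pos hε0).le ((abs_sub _ _).trans
          (add_le_add (h.abs_first_le _) (h.abs_first_le _)))))))))).trans ?_
  · rw [chordTaylor, chordSecondOrder, ← hκ]
    ring
  · have h1 : κ * ((M * ε ^ 2 + M * ε ^ 2) * (M * ε + M * ε + ε * (N + N))) ≤
        κ * (2 * M * (4 * M)) * ε ^ 3 := by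
      have : M * ε + M * ε + ε * (N + N) ≤ 4 * M * ε := by
        have : 2 * N * ε ≤ M * ε := by gcongr
        have : 0 ≤ M * ε := by positivity
        linarith
      calc _ ≤ κ * ((M * ε ^ 2 + M * ε ^ 2) * (4 * M * ε)) := by gcongr
        _ = _ := by ring
    have h2 : 0 ≤ M * M * ε ^ 3 := by positivity
    linarith [show (M * ε) ^ 3 = M ^ 3 * ε ^ 3 by ring,
      show 1 / 2 * (M * ε ^ 2 + M * ε ^ 2) * (ε * M) = M * M * ε ^ 3 by ring,
      show C * (M * ε) ^ 3 = C * M ^ 3 * ε ^ 3 by ring]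

/-! ### Localization of the maximal polygons -/

/-- The bound has to hold on all of [-π, π], because nothing is known in advance about where a
maximal chord ends. The constant comes from 1/5 < 2/π². -/
theorem cos_le_one_sub_sq_div_five {x : ℝ} (hx : |x| ≤ π) : cos x ≤ 1 - x ^ 2 / 5 := by
  have h := Real.cos_le_one_sub_mul_cos_sq hx
  have h1 : (1 : ℝ) / 5 ≤ 2 / π ^ 2 := by
    rw [div_le_div_iff₀ (by norm_num) (by positivity)]
    nlinarith [Real.pi_lt_d2, Real.pi_pos]
  nlinarith [mul_le_mul_of_nonneg_right h1 (sq_nonneg x)]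

theorem four_fifths_le_sqrt_three_div_two : (4 : ℝ) / 5 ≤ √3 / 2 := by
  have : (8 : ℝ) / 5 ≤ √3 := Real.le_sqrt_of_sq_le (by norm_num)
  linarith

theorem sqrt_three_div_two_le_one : √3 / 2 ≤ (1 : ℝ) := by
  have : √3 ≤ (2 : ℝ) := Real.sqrt_le_iff.2 (by norm_num)
  linarith

/-- A tangent line with a quadratic gap, valid for all half-angles in [0, π]. Summed over the sides
of a triangle, the linear terms cancel and only the quadratic loss remains. -/
theorem sin_pi_div_three_add_le {x : ℝ} (h1 : -(π / 3) ≤ x) (h2 : x ≤ 2 * π / 3) :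
    sin (π / 3 + x) ≤ √3 / 2 + x / 2 - x ^ 2 / 20 := by
  have hπ := Real.pi_pos
  have hπ2 := Real.pi_lt_d2
  rw [Real.sin_add, Real.sin_pi_div_three, Real.cos_pi_div_three]
  have hc := cos_le_one_sub_sq_div_five (x := x) (abs_le.2 ⟨by linarith, by linarith⟩)
  have hs := four_fifths_le_sqrt_three_div_two
  have h3 : √3 / 2 * cos x ≤ √3 / 2 - 4 / 25 * x ^ 2 := by
    have := mul_le_mul_of_nonneg_left hc (show 0 ≤ √3 / 2 by positivity)
    nlinarith [mul_le_mul_of_nonneg_right hs (sq_nonneg x)]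
  rcases le_total 0 x with hx | hx
  · have := Real.sin_le hx
    nlinarith [sq_nonneg x]
  · have h4 := Real.sin_ge_sub_cube (x := -x) (by linarith)
    rw [Real.sin_neg] at h4
    have h5 : (-x) * x ^ 2 ≤ 21 / 20 * x ^ 2 := by
      apply mul_le_mul_of_nonneg_right _ (sq_nonneg x); linarith
    nlinarith [sq_nonneg x]

theorem sin_two_pi_div_three_add_le {x : ℝ} (h1 : -(2 * π / 3) ≤ x) (h2 : x ≤ π / 3) :
    sin (2 * π / 3 + x) ≤ √3 / 2 - x / 2 - x ^ 2 / 20 := by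
  have := sin_pi_div_three_add_le (x := -x) (by linarith) (by linarith)
  rw [← Real.sin_pi_sub, show π - (2 * π / 3 + x) = π / 3 + -x by ring]
  linarith [neg_sq x]

theorem sin_two_pi_div_three : sin (2 * π / 3) = √3 / 2 := by
  rw [← Real.sin_pi_sub, show π - 2 * π / 3 = π / 3 by ring, Real.sin_pi_div_three]

theorem cos_two_pi_div_three : cos (2 * π / 3) = -(1 / 2) := by
  rw [show 2 * π / 3 = π - π / 3 by ring, Real.cos_pi_sub, Real.cos_pi_div_three]

/-- The squared chord is ((r s + r t) sin)² plus (r s - r t)² (1 - sin²). -/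
theorem mul_sin_le_chordLength (r : ℝ → ℝ) (s t : ℝ) :
    (r s + r t) * sin ((t - s) / 2) ≤ chordLength r s t := by
  refine le_trans (le_abs_self _) (abs_le_of_sq_le_sq ?_ (chordLength_nonneg _ _ _))
  rw [chordLength_sq]
  nlinarith [mul_nonneg (sq_nonneg (r s - r t))
    (sub_nonneg.2 (Real.sin_sq_le_one ((t - s) / 2)))]

/-- The perimeter of a triangle inscribed in `r` is at least that of its radial projection to an
equilateral triangle. -/
theorem sqrt_three_mul_le_perimeter (r : ℝ → ℝ) (θ : ℝ) :
    2 * (√3 / 2) * (r θ + r (θ + 2 * π / 3) + r (θ + 4 * π / 3)) ≤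
      chordLength r θ (θ + 2 * π / 3) + chordLength r (θ + 2 * π / 3) (θ + 4 * π / 3) +
        chordLength r θ (θ + 4 * π / 3) := by
  have l1 := mul_sin_le_chordLength r θ (θ + 2 * π / 3)
  have l2 := mul_sin_le_chordLength r (θ + 2 * π / 3) (θ + 4 * π / 3)
  have l3 := mul_sin_le_chordLength r θ (θ + 4 * π / 3)
  rw [show (θ + 2 * π / 3 - θ) / 2 = π / 3 by ring, Real.sin_pi_div_three] at l1
  rw [show (θ + 4 * π / 3 - (θ + 2 * π / 3)) / 2 = π / 3 by ring, Real.sin_pi_div_three] at l2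
  rw [show (θ + 4 * π / 3 - θ) / 2 = 2 * π / 3 by ring, sin_two_pi_div_three] at l3
  linarith

namespace IsDeformation

variable {n n' m r : ℝ → ℝ} {N ε : ℝ}

theorem half_le_radius (h : IsDeformation n n' m r N ε) (hz : 12 * N * ε ≤ 1) (x : ℝ) :
    1 / 2 ≤ r x := by
  have := (abs_le.1 (h.abs_radius_sub_one_le x)).1
  linarith

theorem abs_radius_sub_radius_le (h : IsDeformation n n' m r N ε) (s t : ℝ) :
    |r s - r t| ≤ 2 * (3 * N * ε) := by
  rw [show r s - r t = (r s - 1) - (r t - 1) by ring]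
  exact (abs_sub _ _).trans (by linarith [h.abs_radius_sub_one_le s, h.abs_radius_sub_one_le t])

/-- Crude, with an error of order ε but valid for every chord: enough to bring the maximizers within
a fixed distance of a regular polygon. -/
theorem chordLength_le (h : IsDeformation n n' m r N ε) (hz : 12 * N * ε ≤ 1)
    {s t : ℝ} (h1 : s ≤ t) (h2 : t ≤ s + 2 * π) :
    chordLength r s t ≤ 2 * sin ((t - s) / 2) + 12 * N * ε := by
  have hs := Real.sin_nonneg_of_nonneg_of_le_pi (x := (t - s) / 2) (by linarith) (by linarith)
  have ha := h.half_le_radius hz s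
  have hb := h.half_le_radius hz t
  have hd := h.abs_radius_sub_radius_le s t
  have h3 : chordLength r s t ≤ (r s + r t) * sin ((t - s) / 2) + |r s - r t| := by
    refine abs_le_of_sq_le_sq' ?_ (by positivity) |>.2
    rw [chordLength_sq, add_sq, sq_abs]
    have : 0 ≤ 2 * ((r s + r t) * sin ((t - s) / 2)) * |r s - r t| := by positivity
    nlinarith [mul_nonneg (sq_nonneg (r s - r t)) (sq_nonneg (sin ((t - s) / 2)))]
  have h4 := (abs_le.1 (h.abs_radius_sub_one_le s)).2
  have h5 := (abs_le.1 (h.abs_radius_sub_one_le t)).2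
  have h6 : (r s + r t) * sin ((t - s) / 2) ≤ 2 * sin ((t - s) / 2) + 6 * N * ε := by
    have h7 : (r s + r t - 2) * sin ((t - s) / 2) ≤ (6 * N * ε) * 1 :=
      mul_le_mul (by linarith) (Real.sin_le_one _) hs
        (by have := h.nonneg; have := h.pos; positivity)
    linarith
  linarith

/-- For chords that are not short, the squared radial difference costs only ε² under the square
root. -/
theorem chordLength_le_of_half_le_sin (h : IsDeformation n n' m r N ε) (hz : 12 * N * ε ≤ 1)
    {s t : ℝ} (hs : 1 / 2 ≤ sin ((t - s) / 2)) :
    chordLength r s t ≤ (r s + r t) * sin ((t - s) / 2) + 36 * N ^ 2 * ε ^ 2 := by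
  have ha := h.half_le_radius hz s
  have hb := h.half_le_radius hz t
  have hd := h.abs_radius_sub_radius_le s t
  have hd2 : (r s - r t) ^ 2 ≤ 36 * N ^ 2 * ε ^ 2 := by
    rw [← sq_abs]
    calc |r s - r t| ^ 2 ≤ (2 * (3 * N * ε)) ^ 2 := by gcongr
      _ = _ := by ring
  have h3 : 1 / 2 ≤ (r s + r t) * sin ((t - s) / 2) := by nlinarith
  refine abs_le_of_sq_le_sq' ?_ (by positivity) |>.2
  rw [chordLength_sq, add_sq]
  have h4 : 1 / 2 * (36 * N ^ 2 * ε ^ 2) ≤ (r s + r t) * sin ((t - s) / 2) *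
      (36 * N ^ 2 * ε ^ 2) := by gcongr
  nlinarith [mul_nonneg (sq_nonneg (r s - r t)) (sq_nonneg (sin ((t - s) / 2))),
    sq_nonneg (36 * N ^ 2 * ε ^ 2)]

theorem radius_sub_radius_le (h : IsDeformation n n' m r N ε) {x y : ℝ} (hxy : |x - y| ≤ 1) :
    r x - r y ≤ 2 * N * ε * |x - y| + 4 * N * ε ^ 2 := by
  have hε := h.pos
  have hN := h.nonneg
  have h1 := (abs_le.1 (h.approx x)).2
  have h2 := (abs_le.1 (h.approx y)).1
  have h3 := (abs_le.1 (h.taylor y (x - y))).2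
  have h4 := (abs_le.1 (abs_mul_le (h.abs_deriv_le y) (le_refl |x - y|))).2
  have h5 := (abs_le.1 (h.abs_le_second x)).2
  have h6 := (abs_le.1 (h.abs_le_second y)).1
  rw [add_sub_cancel] at h3
  have h7 : (x - y) ^ 2 ≤ |x - y| := by
    rw [← sq_abs]; nlinarith [abs_nonneg (x - y)]
  have h8 : n x - n y ≤ 2 * N * |x - y| := by nlinarith
  have h9 := mul_le_mul_of_nonneg_left h8 hε.le
  have h10 := mul_le_mul_of_nonneg_left (h.pow_le (show 2 ≤ 3 by norm_num)) hN
  have h11 := mul_le_mul_of_nonneg_left (show m x - m y ≤ 2 * N by linarith)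
    (show 0 ≤ ε ^ 2 by positivity)
  linarith

end IsDeformation

/-- Converts a quadratic loss balanced against terms of size εX and ε² into a displacement of order
ε. -/
theorem le_mul_of_sq_le {X ε a b : ℝ} (hε : 0 < ε) (ha : 0 ≤ a) (hb : 0 ≤ b)
    (h : X ^ 2 ≤ a * ε * X + b * ε ^ 2) : X ≤ (a + b + 1) * ε := by
  by_contra! hc
  have h1 : ε ≤ X := by nlinarith [mul_nonneg (add_nonneg ha hb) hε.le]
  have h2 : b * ε ^ 2 ≤ b * ε * X := by
    rw [sq, ← mul_assoc]; gcongr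
  have h3 : (a + b) * ε < X := by linarith
  nlinarith [mul_lt_mul_of_pos_right h3 (hε.trans_le h1)]

/-- The crude length bound gives |δ| ≤ 1. Then the loss of order δ² from the cosine can only be
repaid by the variation of the radius, of order ε|δ| + ε². -/
theorem exists_localization_chord {N : ℝ} (hN : 0 ≤ N) :
    ∃ B : ℝ, 0 ≤ B ∧ ∃ ε₁ : ℝ, 0 < ε₁ ∧ ∀ (n n' m r : ℝ → ℝ) (ε : ℝ),
      IsDeformation n n' m r N ε → ε ≤ ε₁ → ∀ θ δ : ℝ, |δ| ≤ π →
        chordLength r θ (θ + π) ≤ chordLength r θ (θ + π + δ) → |δ| ≤ B * ε := by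
  refine ⟨2 * (5 * (4 * N) + 5 * (4 * N + 36 * N ^ 2) + 1), by positivity, 1 / (1000 * (N + 1)),
    by positivity, fun n n' m r ε h hε θ δ hδ hle => ?_⟩
  have hε0 := h.pos
  rw [le_div_iff₀ (by positivity)] at hε
  have hNε : 0 ≤ N * ε := by positivity
  have hz : 12 * N * ε ≤ 1 := by linarith
  obtain ⟨hδ1, hδ2⟩ := abs_le.1 hδ
  have e0 : sin ((θ + π - θ) / 2) = 1 := by
    rw [show (θ + π - θ) / 2 = π / 2 by ring, Real.sin_pi_div_two]
  have e1 : sin ((θ + π + δ - θ) / 2) = cos (δ / 2) := by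
    rw [show (θ + π + δ - θ) / 2 = π / 2 - (-(δ / 2)) by ring, Real.sin_pi_div_two_sub,
      Real.cos_neg]
  have hlow := mul_sin_le_chordLength r θ (θ + π)
  rw [e0, mul_one] at hlow
  have hup := h.chordLength_le hz (s := θ) (t := θ + π + δ) (by linarith) (by linarith)
  rw [e1] at hup
  have hcos := cos_le_one_sub_sq_div_five (x := δ / 2) (by
    rw [abs_div, abs_two]; linarith [abs_nonneg δ])
  have r1 := (abs_le.1 (h.abs_radius_sub_one_le θ)).1
  have r2 := (abs_le.1 (h.abs_radius_sub_one_le (θ + π))).1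
  have hsq : (δ / 2) ^ 2 ≤ 1 / 4 := by linarith
  have hδs : |δ| ≤ 1 := by
    rw [div_pow] at hsq
    exact (sq_le_one_iff_abs_le_one δ).1 (by linarith)
  have hcos2 := Real.one_sub_sq_div_two_le_cos (x := δ / 2)
  have hup2 := h.chordLength_le_of_half_le_sin hz (s := θ) (t := θ + π + δ) (by
    rw [e1]; linarith)
  rw [e1] at hup2
  have a1 := h.half_le_radius hz θ
  have a2 := h.half_le_radius hz (θ + π + δ)
  have h3 : (r θ + r (θ + π + δ)) * cos (δ / 2) ≤ (r θ + r (θ + π + δ)) - (δ / 2) ^ 2 / 5 := by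
    have h4 := mul_le_mul_of_nonneg_left hcos (show 0 ≤ r θ + r (θ + π + δ) by linarith)
    have h5 := mul_le_mul_of_nonneg_right (show 1 ≤ r θ + r (θ + π + δ) by linarith)
      (show 0 ≤ (δ / 2) ^ 2 / 5 by positivity)
    linarith
  have h4 := h.radius_sub_radius_le (x := θ + π + δ) (y := θ + π) (by simpa using hδs)
  rw [add_sub_cancel_left] at h4
  have h5 : |δ| = 2 * |δ / 2| := by rw [abs_div, abs_two]; ring
  have h6 : |δ / 2| ≤ (5 * (4 * N) + 5 * (4 * N + 36 * N ^ 2) + 1) * ε := by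
    refine le_mul_of_sq_le hε0 (by positivity) (by positivity) ?_
    rw [sq_abs]
    rw [h5] at h4
    linarith
  rw [h5]
  linarith

theorem IsDeformation.triangle_rough {n n' m r : ℝ → ℝ} {N ε θ X Y : ℝ}
    (h : IsDeformation n n' m r N ε) (hε : ε * (10000 * (N + 1)) ≤ 1) (h1 : -(π / 3) ≤ X)
    (h2 : X - Y ≤ π / 3) (h3 : Y ≤ π / 3)
    (hle : 2 * (√3 / 2) * (r θ + r (θ + 2 * π / 3) + r (θ + 4 * π / 3)) ≤
      chordLength r θ (θ + 2 * π / 3 + 2 * X) +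
        chordLength r (θ + 2 * π / 3 + 2 * X) (θ + 4 * π / 3 + 2 * Y) +
        chordLength r θ (θ + 4 * π / 3 + 2 * Y)) :
    X ^ 2 + (Y - X) ^ 2 + Y ^ 2 ≤ 1 / 16 := by
  have hε0 := h.pos
  have hNε : 0 ≤ N * ε := mul_nonneg h.nonneg hε0.le
  have hz : 12 * N * ε ≤ 1 := by linarith
  have u1 := h.chordLength_le hz (s := θ) (t := θ + 2 * π / 3 + 2 * X) (by linarith) (by linarith)
  have u2 := h.chordLength_le hz (s := θ + 2 * π / 3 + 2 * X) (t := θ + 4 * π / 3 + 2 * Y)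
    (by linarith) (by linarith)
  have u3 := h.chordLength_le hz (s := θ) (t := θ + 4 * π / 3 + 2 * Y) (by linarith) (by linarith)
  rw [show (θ + 2 * π / 3 + 2 * X - θ) / 2 = π / 3 + X by ring] at u1
  rw [show (θ + 4 * π / 3 + 2 * Y - (θ + 2 * π / 3 + 2 * X)) / 2 = π / 3 + (Y - X) by ring] at u2
  rw [show (θ + 4 * π / 3 + 2 * Y - θ) / 2 = 2 * π / 3 + Y by ring] at u3
  have s1 := sin_pi_div_three_add_le (x := X) (by linarith) (by linarith)
  have s2 := sin_pi_div_three_add_le (x := Y - X) (by linarith) (by linarith)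
  have s3 := sin_two_pi_div_three_add_le (x := Y) (by linarith) (by linarith)
  obtain ⟨s, hs⟩ : ∃ s, s = √3 / 2 := ⟨_, rfl⟩
  have hs1 : 4 / 5 ≤ s := hs ▸ four_fifths_le_sqrt_three_div_two
  have hs2 : s ≤ 1 := hs ▸ sqrt_three_div_two_le_one
  rw [← hs] at s1 s2 s3 hle
  obtain ⟨r01, -⟩ := abs_le.1 (h.abs_radius_sub_one_le θ)
  obtain ⟨ra1, -⟩ := abs_le.1 (h.abs_radius_sub_one_le (θ + 2 * π / 3))
  obtain ⟨rb1, -⟩ := abs_le.1 (h.abs_radius_sub_one_le (θ + 4 * π / 3))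
  have hsr : 6 * s - 18 * N * ε ≤ 2 * s * (r θ + r (θ + 2 * π / 3) + r (θ + 4 * π / 3)) := by
    have h6 := mul_le_mul_of_nonneg_left (show 3 - 9 * N * ε ≤ r θ + r (θ + 2 * π / 3) +
      r (θ + 4 * π / 3) by linarith) (show 0 ≤ 2 * s by linarith)
    have h7 := mul_le_mul_of_nonneg_right hs2 hNε
    linarith
  linarith

/-- Near the regular triangle each side is a sine weighted by two radii. The linear parts of the
sines now cancel only up to differences of radii, hence the term ε(|X| + |Y|). -/
theorem IsDeformation.triangle_refined {n n' m r : ℝ → ℝ} {N ε θ X Y : ℝ}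
    (h : IsDeformation n n' m r N ε) (hε : ε * (10000 * (N + 1)) ≤ 1) (h1 : -(π / 3) ≤ X)
    (h2 : X - Y ≤ π / 3) (h3 : Y ≤ π / 3)
    (hle : 2 * (√3 / 2) * (r θ + r (θ + 2 * π / 3) + r (θ + 4 * π / 3)) ≤
      chordLength r θ (θ + 2 * π / 3 + 2 * X) +
        chordLength r (θ + 2 * π / 3 + 2 * X) (θ + 4 * π / 3 + 2 * Y) +
        chordLength r θ (θ + 4 * π / 3 + 2 * Y)) :
    (X ^ 2 + (Y - X) ^ 2 + Y ^ 2) / 20 ≤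
      11 * N * ε * (|X| + |Y|) + (16 * N + 108 * N ^ 2) * ε ^ 2 := by
  have hsum := h.triangle_rough hε h1 h2 h3 hle
  have hε0 := h.pos
  have hNε : 0 ≤ N * ε := mul_nonneg h.nonneg hε0.le
  have hz : 12 * N * ε ≤ 1 := by linarith
  have s1 := sin_pi_div_three_add_le (x := X) (by linarith) (by linarith)
  have s2 := sin_pi_div_three_add_le (x := Y - X) (by linarith) (by linarith)
  have s3 := sin_two_pi_div_three_add_le (x := Y) (by linarith) (by linarith)
  obtain ⟨s, hs⟩ : ∃ s, s = √3 / 2 := ⟨_, rfl⟩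
  have hs1 : 4 / 5 ≤ s := hs ▸ four_fifths_le_sqrt_three_div_two
  have hs2 : s ≤ 1 := hs ▸ sqrt_three_div_two_le_one
  rw [← hs] at s1 s2 s3 hle
  have small : ∀ x : ℝ, x ^ 2 ≤ 1 / 16 → |x| ≤ 1 / 4 := fun x hx =>
    abs_le_of_sq_le_sq (by linarith) (by norm_num)
  have hXs := small X (by linarith [sq_nonneg (Y - X), sq_nonneg Y])
  have hYs := small Y (by linarith [sq_nonneg (Y - X), sq_nonneg X])
  have hYXs := small (Y - X) (by linarith [sq_nonneg Y, sq_nonneg X])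
  have hsin : ∀ α x : ℝ, sin α = √3 / 2 → |x| ≤ 1 / 4 → 1 / 2 ≤ sin (α + x) := by
    intro α x hα hx
    have := Real.abs_sin_sub_sin_le (α + x) α
    rw [add_sub_cancel_left, hα, ← hs] at this
    have := (abs_le.1 this).1
    linarith
  have e1 : (θ + 2 * π / 3 + 2 * X - θ) / 2 = π / 3 + X := by ring
  have e2 : (θ + 4 * π / 3 + 2 * Y - (θ + 2 * π / 3 + 2 * X)) / 2 = π / 3 + (Y - X) := by ring
  have e3 : (θ + 4 * π / 3 + 2 * Y - θ) / 2 = 2 * π / 3 + Y := by ring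
  have v1 := h.chordLength_le_of_half_le_sin hz
    (by rw [e1]; exact hsin _ _ Real.sin_pi_div_three hXs)
  have v2 := h.chordLength_le_of_half_le_sin hz
    (by rw [e2]; exact hsin _ _ Real.sin_pi_div_three hYXs)
  have v3 := h.chordLength_le_of_half_le_sin hz
    (by rw [e3]; exact hsin _ _ sin_two_pi_div_three hYs)
  rw [e1] at v1
  rw [e2] at v2
  rw [e3] at v3
  have a0 := h.half_le_radius hz θ
  have at' := h.half_le_radius hz (θ + 2 * π / 3 + 2 * X)
  have au := h.half_le_radius hz (θ + 4 * π / 3 + 2 * Y)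
  have key : ∀ a b S T Q : ℝ, 1 / 2 ≤ a → 1 / 2 ≤ b → 0 ≤ Q → S ≤ T - Q →
      (a + b) * S ≤ (a + b) * T - Q := by
    intro a b S T Q ha hb hQ hS
    nlinarith [mul_le_mul_of_nonneg_left hS (show 0 ≤ a + b by linarith)]
  have w1 := key _ _ _ _ _ a0 at' (by positivity) s1
  have w2 := key _ _ _ _ _ at' au (by positivity) s2
  have w3 := key _ _ _ _ _ a0 au (by positivity) s3
  have d1 := h.radius_sub_radius_le (x := θ + 2 * π / 3 + 2 * X) (y := θ + 2 * π / 3) (by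
    rw [add_sub_cancel_left, abs_mul, abs_two]; linarith)
  have d2 := h.radius_sub_radius_le (x := θ + 4 * π / 3 + 2 * Y) (y := θ + 4 * π / 3) (by
    rw [add_sub_cancel_left, abs_mul, abs_two]; linarith)
  rw [add_sub_cancel_left, abs_mul, abs_two] at d1 d2
  have key2 : ∀ a b : ℝ, 0 ≤ b → a ≤ b → 2 * s * a ≤ 2 * b := by
    intro a b hb hab
    nlinarith
  have hN := h.nonneg
  have d3 := key2 _ _ (by positivity) d1
  have d4 := key2 _ _ (by positivity) d2
  -- What the weighted linear terms leave is X(r₀ - r₂)/2 + Y(r₁ - r₀)/2, with r₀, r₁, r₂ the radii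
  -- at the vertices.
  have c1 := (abs_le.1 (abs_mul_le (h.abs_radius_sub_radius_le θ (θ + 4 * π / 3 + 2 * Y))
    (le_refl |X|))).2
  have c2 := (abs_le.1 (abs_mul_le (h.abs_radius_sub_radius_le (θ + 2 * π / 3 + 2 * X) θ)
    (le_refl |Y|))).2
  linarith

theorem exists_localization_triangle {N : ℝ} (hN : 0 ≤ N) :
    ∃ B : ℝ, 0 ≤ B ∧ ∃ ε₁ : ℝ, 0 < ε₁ ∧ ∀ (n n' m r : ℝ → ℝ) (ε : ℝ),
      IsDeformation n n' m r N ε → ε ≤ ε₁ → ∀ θ t u : ℝ, θ ≤ t → t ≤ u → u ≤ θ + 2 * π →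
        chordLength r θ (θ + 2 * π / 3) + chordLength r (θ + 2 * π / 3) (θ + 4 * π / 3) +
          chordLength r θ (θ + 4 * π / 3) ≤
        chordLength r θ t + chordLength r t u + chordLength r θ u →
        |t - (θ + 2 * π / 3)| ≤ B * ε ∧ |u - (θ + 4 * π / 3)| ≤ B * ε := by
  refine ⟨2 * (40 * (11 * N) + 40 * (16 * N + 108 * N ^ 2) + 1), by positivity,
    1 / (10000 * (N + 1)), by positivity, fun n n' m r ε h hε θ t u h1 h2 h3 hle => ?_⟩
  rw [le_div_iff₀ (by positivity)] at hε
  obtain ⟨X, rfl⟩ : ∃ X, t = θ + 2 * π / 3 + 2 * X := ⟨(t - (θ + 2 * π / 3)) / 2, by ring⟩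
  obtain ⟨Y, rfl⟩ : ∃ Y, u = θ + 4 * π / 3 + 2 * Y := ⟨(u - (θ + 4 * π / 3)) / 2, by ring⟩
  have hfin : |X| + |Y| ≤ (40 * (11 * N) + 40 * (16 * N + 108 * N ^ 2) + 1) * ε := by
    refine le_mul_of_sq_le h.pos (by positivity) (by positivity) ?_
    have h5 := h.triangle_refined hε (by linarith) (by linarith) (by linarith)
      ((sqrt_three_mul_le_perimeter r θ).trans hle)
    have h6 : (|X| + |Y|) ^ 2 ≤ 2 * (X ^ 2 + Y ^ 2) := by
      rw [← sq_abs X, ← sq_abs Y]; nlinarith [sq_nonneg (|X| - |Y|)]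
    have h7 : X ^ 2 + Y ^ 2 ≤ X ^ 2 + (Y - X) ^ 2 + Y ^ 2 := by linarith [sq_nonneg (Y - X)]
    linarith
  rw [add_sub_cancel_left, add_sub_cancel_left, abs_mul, abs_mul, abs_two]
  constructor <;> linarith [abs_nonneg X, abs_nonneg Y]

/-! ### Expansion of the maximal perimeters -/

/-- `L` is the length of the longest chord issued from any boundary point. -/
def IsMaximalChordLength (r : ℝ → ℝ) (L : ℝ) : Prop :=
  (∀ s t, s ≤ t → t ≤ s + 2 * π → chordLength r s t ≤ L) ∧
    ∀ s, ∃ t, s ≤ t ∧ t ≤ s + 2 * π ∧ chordLength r s t = L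

/-- `L` is the maximal perimeter of the inscribed triangles with any given vertex. -/
def IsMaximalTrianglePerimeter (r : ℝ → ℝ) (L : ℝ) : Prop :=
  (∀ s t u, s ≤ t → t ≤ u → u ≤ s + 2 * π →
    chordLength r s t + chordLength r t u + chordLength r u s ≤ L) ∧
    ∀ s, ∃ t u, s ≤ t ∧ t ≤ u ∧ u ≤ s + 2 * π ∧
      chordLength r s t + chordLength r t u + chordLength r u s = L

/-- With one end fixed at θ, the part of order ε² depending on the displacement ζ of the other is
n'(θ+π)ζ - ζ²/4, whose maximum n'(θ+π)² is attained at ζ = 2n'(θ+π). That displacement gives the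
lower bound; localization and completing the square give the upper one. -/
theorem exists_maximal_chordLength_expansion {N : ℝ} (hN : 0 ≤ N) :
    ∃ C : ℝ, 0 ≤ C ∧ ∃ ε₁ : ℝ, 0 < ε₁ ∧ ∀ (n n' m r : ℝ → ℝ) (ε L : ℝ),
      IsDeformation n n' m r N ε → ε ≤ ε₁ → IsMaximalChordLength r L → ∀ θ : ℝ,
        |L - (2 + ε * (n θ + n (θ + π)) + ε ^ 2 * (m θ + m (θ + π) + n' (θ + π) ^ 2))| ≤
          C * ε ^ 3 := by
  obtain ⟨B, hB, ε₁, hε₁, hloc⟩ := exists_localization_chord hN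
  obtain ⟨C, hC, ε₂, hε₂, hexp⟩ := exists_chordLength_expansion (α := π / 2)
    (by rw [Real.sin_pi_div_two]; norm_num) hN (B := B + 2 * N) (by positivity)
  -- The last bound on `ε` keeps the test end point, displaced by at most 2Nε, between θ and θ + 2π.
  refine ⟨C, hC, min (min ε₁ ε₂) (1 / (N + 1)), by positivity,
    fun n n' m r ε L h hε hL θ => ?_⟩
  have hεa := hε.trans ((min_le_left _ _).trans (min_le_left _ _))
  have hεb := hε.trans ((min_le_left _ _).trans (min_le_right _ _))
  have hεc := hε.trans (min_le_right _ _)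
  rw [le_div_iff₀ (by positivity)] at hεc
  have hε0 := h.pos
  have hNε : 0 ≤ N * ε := by positivity
  have hπ := Real.pi_gt_three
  have hE : ∀ ζ, |ζ| ≤ B + 2 * N → |chordLength r θ (θ + π + ε * ζ) - (2 + ε * (n θ + n (θ + π)) +
      ε ^ 2 * (m θ + m (θ + π) + n' (θ + π) * ζ - ζ ^ 2 / 4))| ≤ C * ε ^ 3 := by
    intro ζ hζ
    have := hexp n n' m r ε h hεb θ (θ + π) 0 ζ (by ring) (by rw [abs_zero]; positivity) hζ
    rw [chordSecondOrder, Real.sin_pi_div_two, Real.cos_pi_div_two] at this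
    convert! this using 2
    ring_nf
  rw [abs_le]
  constructor
  · have hn' := h.abs_deriv_le (θ + π)
    have h2 : |2 * n' (θ + π)| ≤ 2 * N := by rw [abs_mul, abs_two]; linarith
    have h1 := (abs_le.1 (hE (2 * n' (θ + π)) (h2.trans (by linarith)))).1
    obtain ⟨h3, h4⟩ := abs_le.1 (abs_mul_le (abs_of_pos hε0).le h2)
    have h5 := hL.1 θ (θ + π + ε * (2 * n' (θ + π))) (by linarith) (by linarith)
    linarith
  · obtain ⟨t, ht1, ht2, ht⟩ := hL.2 θ
    have h1 := hloc n n' m r ε h hεa θ (t - (θ + π)) (abs_le.2 ⟨by linarith, by linarith⟩) (by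
      rw [add_sub_cancel, ht]
      exact hL.1 θ (θ + π) (by linarith) (by linarith))
    have h2 : t = θ + π + ε * ((t - (θ + π)) / ε) := by field_simp; ring
    have h3 : |(t - (θ + π)) / ε| ≤ B + 2 * N := by
      rw [abs_div, abs_of_pos hε0, div_le_iff₀ hε0]
      refine h1.trans ?_
      have : 0 ≤ 2 * N * ε := by positivity
      linarith
    have h4 := (abs_le.1 (hE _ h3)).2
    rw [← h2, ht] at h4
    have h5 := mul_nonneg (sq_nonneg ε)
      (sq_nonneg (n' (θ + π) - (t - (θ + π)) / ε / 2))
    linarith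

/-- The coefficient of `ε ^ 2` in the perimeter of the triangle with vertices at polar angles
`θ`, `θ + 2π/3 + ε ξ` and `θ + 4π/3 + ε ζ`. -/
noncomputable def triangleSecondOrder (n n' m : ℝ → ℝ) (θ ξ ζ : ℝ) : ℝ :=
  chordSecondOrder n n' m (π / 3) θ (θ + 2 * π / 3) 0 ξ +
    chordSecondOrder n n' m (π / 3) (θ + 2 * π / 3) (θ + 4 * π / 3) ξ ζ +
    chordSecondOrder n n' m (2 * π / 3) θ (θ + 4 * π / 3) 0 ζ

theorem exists_triangle_expansion {N B : ℝ} (hN : 0 ≤ N) (hB : 0 ≤ B) :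
    ∃ C : ℝ, 0 ≤ C ∧ ∃ ε₁ : ℝ, 0 < ε₁ ∧ ∀ (n n' m r : ℝ → ℝ) (ε : ℝ),
      IsDeformation n n' m r N ε → ε ≤ ε₁ → ∀ θ ξ ζ : ℝ, |ξ| ≤ B → |ζ| ≤ B →
        |chordLength r θ (θ + 2 * π / 3 + ε * ξ) +
          chordLength r (θ + 2 * π / 3 + ε * ξ) (θ + 4 * π / 3 + ε * ζ) +
          chordLength r θ (θ + 4 * π / 3 + ε * ζ) -
          (3 * √3 + ε * (√3 * (n θ + n (θ + 2 * π / 3) + n (θ + 4 * π / 3))) +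
            ε ^ 2 * triangleSecondOrder n n' m θ ξ ζ)| ≤ C * ε ^ 3 := by
  obtain ⟨C₁, hC₁, ε₁, hε₁, hexp₁⟩ := exists_chordLength_expansion (α := π / 3)
    (by rw [Real.sin_pi_div_three]; positivity) hN hB
  obtain ⟨C₂, hC₂, ε₂, hε₂, hexp₂⟩ := exists_chordLength_expansion (α := 2 * π / 3)
    (by rw [sin_two_pi_div_three]; positivity) hN hB
  refine ⟨C₁ + C₁ + C₂, by positivity, min ε₁ ε₂, by positivity,
    fun n n' m r ε h hε θ ξ ζ hξ hζ => ?_⟩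
  have hεa := hε.trans (min_le_left _ _)
  have hεb := hε.trans (min_le_right _ _)
  have h0 : |(0 : ℝ)| ≤ B := by rwa [abs_zero]
  have h1 := hexp₁ n n' m r ε h hεa θ (θ + 2 * π / 3) 0 ξ (by ring) h0 hξ
  have h2 := hexp₁ n n' m r ε h hεa (θ + 2 * π / 3) (θ + 4 * π / 3) ξ ζ (by ring) hξ hζ
  have h3 := hexp₂ n n' m r ε h hεb θ (θ + 4 * π / 3) 0 ζ (by ring) h0 hζ
  rw [mul_zero, add_zero, Real.sin_pi_div_three, Real.cos_pi_div_three] at h1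
  rw [Real.sin_pi_div_three, Real.cos_pi_div_three] at h2
  rw [mul_zero, add_zero, sin_two_pi_div_three, cos_two_pi_div_three] at h3
  refine (abs_le_of_four (d := 0) (D := 0) ?_ h1 h2 h3 abs_zero.le).trans (by linarith)
  rw [triangleSecondOrder]
  ring

theorem exists_abs_chordSecondOrder_le (α : ℝ) {N B : ℝ} (hN : 0 ≤ N) (hB : 0 ≤ B) :
    ∃ C : ℝ, 0 ≤ C ∧ ∀ (n n' m r : ℝ → ℝ) (ε : ℝ), IsDeformation n n' m r N ε →
      ∀ φ ψ ξ ζ : ℝ, |ξ| ≤ B → |ζ| ≤ B → |chordSecondOrder n n' m α φ ψ ξ ζ| ≤ C := by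
  refine ⟨1 * (N + N) + 1 * (N * B + N * B) + |cos α / 2| * (N + N) * (B + B) +
    (|sin α / 4| * ((B + B) * (B + B)) +
      |cos α ^ 2 / (4 * sin α)| * ((N + N) * (N + N))), by positivity,
    fun n n' m r ε h φ ψ ξ ζ hξ hζ => ?_⟩
  have hs : |sin α| ≤ 1 := abs_sin_le_one α
  have h1 : |n φ + n ψ| ≤ N + N :=
    (abs_add_le _ _).trans (add_le_add (h.abs_first_le _) (h.abs_first_le _))
  have h2 : |n φ - n ψ| ≤ N + N :=
    (abs_sub _ _).trans (add_le_add (h.abs_first_le _) (h.abs_first_le _))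
  have h3 : |ζ - ξ| ≤ B + B := (abs_sub _ _).trans (add_le_add hζ hξ)
  refine abs_le_of_four (d := -(sin α / 4 * ((ζ - ξ) * (ζ - ξ))) +
      cos α ^ 2 / (4 * sin α) * ((n φ - n ψ) * (n φ - n ψ))) ?_
    (abs_mul_le hs ((abs_add_le _ _).trans (add_le_add (h.abs_le_second φ) (h.abs_le_second ψ))))
    (abs_mul_le hs ((abs_add_le _ _).trans (add_le_add (abs_mul_le (h.abs_deriv_le φ) hξ)
      (abs_mul_le (h.abs_deriv_le ψ) hζ))))
    (abs_mul_le (abs_mul_le (le_refl |cos α / 2|) h1) h3)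
    ((abs_add_le _ _).trans (add_le_add ?_ (abs_mul_le le_rfl (abs_mul_le h2 h2))))
  · rw [chordSecondOrder]; ring
  · rw [abs_neg]; exact abs_mul_le le_rfl (abs_mul_le h3 h3)

/-- The maximal value of `triangleSecondOrder`. -/
noncomputable def triangleSecondOrderMax (n n' m : ℝ → ℝ) (θ : ℝ) : ℝ :=
  √3 * (m θ + m (θ + 2 * π / 3) + m (θ + 4 * π / 3)) +
    2 * √3 / 9 * ((√3 * n' θ + (n (θ + 4 * π / 3) - n (θ + 2 * π / 3)) / 4) ^ 2 +
      (√3 * n' (θ + 2 * π / 3) + (n θ - n (θ + 4 * π / 3)) / 4) ^ 2 +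
      (√3 * n' (θ + 4 * π / 3) + (n (θ + 2 * π / 3) - n θ) / 4) ^ 2) +
    √3 / 8 * (n θ ^ 2 + n (θ + 2 * π / 3) ^ 2 + n (θ + 4 * π / 3) ^ 2)

/-- The displacements at which `triangleSecondOrder` is maximal. -/
noncomputable def triangleShift₁ (n n' : ℝ → ℝ) (θ : ℝ) : ℝ :=
  4 * √3 / 9 * (√3 * (n' (θ + 2 * π / 3) - n' θ) - 3 * n (θ + 4 * π / 3) / 4)

/-- The displacements at which `triangleSecondOrder` is maximal. -/
noncomputable def triangleShift₂ (n n' : ℝ → ℝ) (θ : ℝ) : ℝ :=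
  4 * √3 / 9 * (√3 * (n' (θ + 4 * π / 3) - n' θ) + 3 * n (θ + 2 * π / 3) / 4)

/-- Completion of the square in two variables. The definite form on the right shows at once that the
maximum is an upper bound and where it is attained. -/
theorem triangleSecondOrderMax_sub {n n' m : ℝ → ℝ} {θ : ℝ}
    (hn : n θ + n (θ + 2 * π / 3) + n (θ + 4 * π / 3) = 0)
    (hn' : n' θ + n' (θ + 2 * π / 3) + n' (θ + 4 * π / 3) = 0) (ξ ζ : ℝ) :
    triangleSecondOrderMax n n' m θ - triangleSecondOrder n n' m θ ξ ζ =
      √3 / 8 * ((ξ - triangleShift₁ n n' θ) ^ 2 +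
        ((ζ - triangleShift₂ n n' θ) - (ξ - triangleShift₁ n n' θ)) ^ 2 +
        (ζ - triangleShift₂ n n' θ) ^ 2) := by
  simp only [triangleSecondOrderMax, triangleShift₁, triangleShift₂, triangleSecondOrder, chordSecondOrder, Real.sin_pi_div_three,
    Real.cos_pi_div_three, sin_two_pi_div_three, cos_two_pi_div_three]
  obtain ⟨a, ha⟩ : ∃ a, a = n (θ + 2 * π / 3) := ⟨_, rfl⟩
  obtain ⟨b, hb⟩ : ∃ b, b = n (θ + 4 * π / 3) := ⟨_, rfl⟩
  obtain ⟨a', ha'⟩ : ∃ a, a = n' (θ + 2 * π / 3) := ⟨_, rfl⟩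
  obtain ⟨b', hb'⟩ : ∃ b, b = n' (θ + 4 * π / 3) := ⟨_, rfl⟩
  rw [← ha, ← hb] at hn
  rw [← ha', ← hb'] at hn'
  rw [← ha, ← hb, ← ha', ← hb']
  have e : n θ = -a - b := by linarith
  have e' : n' θ = -a' - b' := by linarith
  rw [e, e']
  obtain ⟨w, hw⟩ : ∃ w : ℝ, w = √3 := ⟨_, rfl⟩
  have hw2 : w ^ 2 = 3 := by rw [hw]; exact Real.sq_sqrt (by norm_num)
  have hw0 : w ≠ 0 := by rw [hw]; positivity
  have hinv : (1 / 2 : ℝ) ^ 2 / (4 * (w / 2)) = w / 24 := by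
    field_simp; linarith
  have hinv' : (-(1 / 2) : ℝ) ^ 2 / (4 * (w / 2)) = w / 24 := by
    field_simp; linarith
  rw [← hw, hinv, hinv']
  have hw3 : w ^ 3 = 3 * w := by rw [pow_succ, hw2]
  have hw4 : w ^ 4 = 9 := by rw [show w ^ 4 = (w ^ 2) ^ 2 by ring, hw2]; norm_num
  have hw5 : w ^ 5 = 9 * w := by rw [pow_succ, hw4]
  ring_nf
  simp only [hw2, hw3, hw4, hw5]
  ring

theorem IsDeformation.abs_triangleShift_le {n n' m r : ℝ → ℝ} {N ε : ℝ}
    (h : IsDeformation n n' m r N ε) (θ : ℝ) :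
    |triangleShift₁ n n' θ| ≤ 5 * N ∧ |triangleShift₂ n n' θ| ≤ 5 * N := by
  have hw1 : |4 * √3 / 9| ≤ 1 := by
    have := sqrt_three_div_two_le_one
    rw [abs_of_nonneg (by positivity)]; linarith
  have hw2 : |√3| ≤ 2 := by
    have := sqrt_three_div_two_le_one
    rw [abs_of_nonneg (by positivity)]; linarith
  have hd : ∀ x y, |√3 * (n' x - n' y)| ≤ 2 * (N + N) := fun x y =>
    abs_mul_le hw2 ((abs_sub _ _).trans (add_le_add (h.abs_deriv_le x) (h.abs_deriv_le y)))
  have hf : ∀ x, |3 * n x / 4| ≤ N := fun x => by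
    have := h.abs_first_le x
    rw [abs_div, abs_mul]; norm_num; linarith [abs_nonneg (n x)]
  constructor
  · refine (abs_mul_le hw1 ((abs_sub _ _).trans (add_le_add (hd _ _) (hf _)))).trans ?_
    linarith
  · refine (abs_mul_le hw1 ((abs_add_le _ _).trans (add_le_add (hd _ _) (hf _)))).trans ?_
    linarith

theorem exists_maximal_triangle_displacement {N : ℝ} (hN : 0 ≤ N) :
    ∃ B : ℝ, 0 ≤ B ∧ ∃ ε₁ : ℝ, 0 < ε₁ ∧ ∀ (n n' m r : ℝ → ℝ) (ε L : ℝ),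
      IsDeformation n n' m r N ε → ε ≤ ε₁ → IsMaximalTrianglePerimeter r L → ∀ θ : ℝ,
        ∃ ξ ζ : ℝ, |ξ| ≤ B ∧ |ζ| ≤ B ∧
          chordLength r θ (θ + 2 * π / 3 + ε * ξ) +
          chordLength r (θ + 2 * π / 3 + ε * ξ) (θ + 4 * π / 3 + ε * ζ) +
          chordLength r θ (θ + 4 * π / 3 + ε * ζ) = L := by
  obtain ⟨B, hB, ε₁, hε₁, hloc⟩ := exists_localization_triangle hN
  refine ⟨B, hB, ε₁, hε₁, fun n n' m r ε L h hε hL θ => ?_⟩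
  have hε0 := h.pos
  have hπ := Real.pi_pos
  obtain ⟨t, u, h1, h2, h3, h4⟩ := hL.2 θ
  rw [chordLength_comm r u θ] at h4
  have h5 := hL.1 θ (θ + 2 * π / 3) (θ + 4 * π / 3) (by linarith) (by linarith) (by linarith)
  rw [chordLength_comm r _ θ] at h5
  obtain ⟨h6, h7⟩ := hloc n n' m r ε h hε θ t u h1 h2 h3 (h5.trans_eq h4.symm)
  refine ⟨(t - (θ + 2 * π / 3)) / ε, (u - (θ + 4 * π / 3)) / ε, ?_, ?_, ?_⟩
  · rwa [abs_div, abs_of_pos hε0, div_le_iff₀ hε0]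
  · rwa [abs_div, abs_of_pos hε0, div_le_iff₀ hε0]
  · rw [mul_div_cancel₀ _ hε0.ne', mul_div_cancel₀ _ hε0.ne', add_sub_cancel, add_sub_cancel, h4]

/-- The linear effects of the displacements cancel around the triangle, so at this order the
maximizer need not be known. This version precedes the knowledge that triangle sums of `n` vanish.
-/
theorem exists_maximal_triangle_first_order {N : ℝ} (hN : 0 ≤ N) :
    ∃ C : ℝ, 0 ≤ C ∧ ∃ ε₁ : ℝ, 0 < ε₁ ∧ ∀ (n n' m r : ℝ → ℝ) (ε L : ℝ),
      IsDeformation n n' m r N ε → ε ≤ ε₁ → IsMaximalTrianglePerimeter r L → ∀ θ : ℝ,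
        |L - (3 * √3 + ε * (√3 * (n θ + n (θ + 2 * π / 3) + n (θ + 4 * π / 3))))| ≤ C * ε ^ 2 := by
  obtain ⟨B, hB, ε₁, hε₁, hdis⟩ := exists_maximal_triangle_displacement hN
  obtain ⟨C, hC, ε₂, hε₂, hexp⟩ := exists_triangle_expansion hN hB
  obtain ⟨D, hD, hb⟩ := exists_abs_chordSecondOrder_le (π / 3) hN hB
  obtain ⟨D', hD', hb'⟩ := exists_abs_chordSecondOrder_le (2 * π / 3) hN hB
  refine ⟨C + (D + D + D'), by positivity, min ε₁ ε₂, by positivity,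
    fun n n' m r ε L h hε hL θ => ?_⟩
  obtain ⟨ξ, ζ, hξ, hζ, e⟩ := hdis n n' m r ε L h (hε.trans (min_le_left _ _)) hL θ
  have h1 := hexp n n' m r ε h (hε.trans (min_le_right _ _)) θ ξ ζ hξ hζ
  rw [e] at h1
  have h0 : |(0 : ℝ)| ≤ B := by rwa [abs_zero]
  have h2 : |triangleSecondOrder n n' m θ ξ ζ| ≤ D + D + D' :=
    (abs_add_le _ _).trans (add_le_add ((abs_add_le _ _).trans
      (add_le_add (hb n n' m r ε h _ _ _ _ h0 hξ) (hb n n' m r ε h _ _ _ _ hξ hζ)))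
      (hb' n n' m r ε h _ _ _ _ h0 hζ))
  have h3 := abs_mul_le (abs_of_pos (show 0 < ε ^ 2 by have := h.pos; positivity)).le h2
  refine (abs_le_of_four (c := 0) (d := 0) (C := 0) (D := 0) ?_ h1 h3 abs_zero.le
    abs_zero.le).trans ?_
  · ring
  · have := mul_le_mul_of_nonneg_left (h.pow_le (show 2 ≤ 3 by norm_num)) hC
    linarith

theorem exists_maximal_triangle_second_order {N : ℝ} (hN : 0 ≤ N) :
    ∃ C : ℝ, 0 ≤ C ∧ ∃ ε₁ : ℝ, 0 < ε₁ ∧ ∀ (n n' m r : ℝ → ℝ) (ε L : ℝ),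
      IsDeformation n n' m r N ε → ε ≤ ε₁ → IsMaximalTrianglePerimeter r L → ∀ θ : ℝ,
        n θ + n (θ + 2 * π / 3) + n (θ + 4 * π / 3) = 0 →
        n' θ + n' (θ + 2 * π / 3) + n' (θ + 4 * π / 3) = 0 →
        |L - (3 * √3 + ε ^ 2 * triangleSecondOrderMax n n' m θ)| ≤ C * ε ^ 3 := by
  obtain ⟨B, hB, ε₁, hε₁, hdis⟩ := exists_maximal_triangle_displacement hN
  obtain ⟨C, hC, ε₂, hε₂, hexp⟩ := exists_triangle_expansion hN (B := B + 5 * N) (by positivity)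
  -- The optimal shifts are at most 5N, so this bound keeps the vertices of the test triangle in
  -- cyclic order.
  refine ⟨C, hC, min (min ε₁ ε₂) (1 / (10 * N + 1)), by positivity,
    fun n n' m r ε L h hε hL θ hn hn' => ?_⟩
  have hεa := hε.trans ((min_le_left _ _).trans (min_le_left _ _))
  have hεb := hε.trans ((min_le_left _ _).trans (min_le_right _ _))
  have hεc := hε.trans (min_le_right _ _)
  rw [le_div_iff₀ (by positivity)] at hεc
  have hε0 := h.pos
  have hπ := Real.pi_gt_three
  have hE := fun ξ ζ hξ hζ => hexp n n' m r ε h hεb θ ξ ζ hξ hζ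
  simp only [hn, mul_zero, add_zero] at hE
  rw [abs_le]
  constructor
  · obtain ⟨hx, hy⟩ := h.abs_triangleShift_le θ
    have h1 := triangleSecondOrderMax_sub (m := m) hn hn' (triangleShift₁ n n' θ)
      (triangleShift₂ n n' θ)
    have h2 : triangleSecondOrderMax n n' m θ = triangleSecondOrder n n' m θ
        (triangleShift₁ n n' θ) (triangleShift₂ n n' θ) := by
      rw [← sub_eq_zero, h1]; ring
    have h3 := (abs_le.1 (hE _ _ (hx.trans (by linarith)) (hy.trans (by linarith)))).1
    obtain ⟨hx1, hx2⟩ := abs_le.1 (abs_mul_le (abs_of_pos hε0).le hx)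
    obtain ⟨hy1, hy2⟩ := abs_le.1 (abs_mul_le (abs_of_pos hε0).le hy)
    have h5 := hL.1 θ (θ + 2 * π / 3 + ε * triangleShift₁ n n' θ)
      (θ + 4 * π / 3 + ε * triangleShift₂ n n' θ) (by linarith) (by linarith) (by linarith)
    rw [chordLength_comm r _ θ] at h5
    rw [h2]
    linarith
  · obtain ⟨ξ, ζ, hξ, hζ, e⟩ := hdis n n' m r ε L h hεa hL θ
    have h1 := triangleSecondOrderMax_sub (m := m) hn hn' ξ ζ
    have h2 : triangleSecondOrder n n' m θ ξ ζ ≤ triangleSecondOrderMax n n' m θ := by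
      rw [← sub_nonneg, h1]; positivity
    have h3 := (abs_le.1 (hE ξ ζ (hξ.trans (by linarith)) (hζ.trans (by linarith)))).2
    rw [e] at h3
    have h4 := mul_le_mul_of_nonneg_left h2 (sq_nonneg ε)
    linarith

/-! ### Identities for the first order term of the deformation -/

/-- There are arbitrarily small deformations with first order term `n`, and uniform bounds, in which
the maximal inscribed polygons with two and with three sides have constant perimeter. -/
def HasSmallDeformations (n n' : ℝ → ℝ) (N : ℝ) : Prop :=
  ∀ ε₀ > 0, ∃ (ε : ℝ) (m r : ℝ → ℝ) (L₂ L₃ : ℝ), ε ≤ ε₀ ∧ IsDeformation n n' m r N ε ∧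
    IsMaximalChordLength r L₂ ∧ IsMaximalTrianglePerimeter r L₃

theorem eq_of_forall_exists_abs_sub_le_mul {a b C : ℝ}
    (h : ∀ ε₀ > 0, ∃ ε, 0 < ε ∧ ε ≤ ε₀ ∧ |a - b| ≤ C * ε) : a = b := by
  by_contra hab
  have h0 : 0 < |a - b| := abs_pos.2 (sub_ne_zero.2 hab)
  obtain ⟨ε, h1, h2, h3⟩ := h (|a - b| / (2 * (|C| + 1))) (by positivity)
  rw [le_div_iff₀ (by positivity)] at h2
  have h4 : C * ε ≤ |C| * ε := by gcongr; exact le_abs_self C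
  linarith

/-- The same number `L` is expanded at two base points, with `a` and `b` the first coefficients that
may differ. -/
theorem eq_of_pow_mul_approx {a b x C L ε : ℝ} (hε : 0 < ε) (k : ℕ)
    (h1 : |L - (x + ε ^ k * a)| ≤ C * ε ^ (k + 1)) (h2 : |L - (x + ε ^ k * b)| ≤ C * ε ^ (k + 1)) :
    |a - b| ≤ 2 * C * ε := by
  have h3 : |ε ^ k * (a - b)| ≤ C * ε ^ (k + 1) + C * ε ^ (k + 1) := by
    rw [show ε ^ k * (a - b) = (L - (x + ε ^ k * b)) - (L - (x + ε ^ k * a)) by ring]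
    exact (abs_sub _ _).trans (add_le_add h2 h1)
  rw [abs_mul, abs_of_pos (pow_pos hε k)] at h3
  refine le_of_mul_le_mul_left (h3.trans_eq ?_) (pow_pos hε k)
  ring

namespace HasSmallDeformations

variable {n n' : ℝ → ℝ} {N : ℝ}

theorem nonneg (h : HasSmallDeformations n n' N) : 0 ≤ N := by
  obtain ⟨ε, m, r, L₂, L₃, -, hd, -⟩ := h 1 one_pos
  exact hd.nonneg

theorem add_antipode_eq (h : HasSmallDeformations n n' N) (θ φ : ℝ) :
    n θ + n (θ + π) = n φ + n (φ + π) := by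
  have hN := h.nonneg
  obtain ⟨C, hC, ε₁, hε₁, hexp⟩ := exists_maximal_chordLength_expansion hN
  refine eq_of_forall_exists_abs_sub_le_mul (C := 2 * (C + (N + N + N * N))) fun ε₀ hε₀ => ?_
  obtain ⟨ε, m, r, L₂, L₃, hε, hd, h2, -⟩ := h (min ε₀ ε₁) (lt_min hε₀ hε₁)
  refine ⟨ε, hd.pos, hε.trans (min_le_left _ _), ?_⟩
  have key : ∀ θ, |L₂ - (2 + ε ^ 1 * (n θ + n (θ + π)))| ≤
      (C + (N + N + N * N)) * ε ^ (1 + 1) := by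
    intro θ
    have h3 := hexp n n' m r ε L₂ hd (hε.trans (min_le_right _ _)) h2 θ
    have h4 : |m θ + m (θ + π) + n' (θ + π) ^ 2| ≤ N + N + N * N := by
      refine (abs_add_le _ _).trans (add_le_add ((abs_add_le _ _).trans
        (add_le_add (hd.abs_le_second _) (hd.abs_le_second _))) ?_)
      rw [sq]; exact abs_mul_le (hd.abs_deriv_le _) (hd.abs_deriv_le _)
    have h5 := abs_mul_le (abs_of_pos (show 0 < ε ^ 2 by have := hd.pos; positivity)).le h4
    refine (abs_le_of_four (c := 0) (d := 0) (C := 0) (D := 0) ?_ h3 h5 abs_zero.le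
      abs_zero.le).trans ?_
    · ring
    · have := mul_le_mul_of_nonneg_left (hd.pow_le (show 2 ≤ 3 by norm_num)) hC
      norm_num
      linarith
  exact eq_of_pow_mul_approx (x := 2) hd.pos 1 (key θ) (key φ)

theorem add_triangle_eq (h : HasSmallDeformations n n' N) (θ φ : ℝ) :
    n θ + n (θ + 2 * π / 3) + n (θ + 4 * π / 3) =
      n φ + n (φ + 2 * π / 3) + n (φ + 4 * π / 3) := by
  obtain ⟨C, hC, ε₁, hε₁, hexp⟩ := exists_maximal_triangle_first_order h.nonneg
  refine mul_left_cancel₀ (show √3 ≠ 0 by positivity)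
    (eq_of_forall_exists_abs_sub_le_mul (C := 2 * C) fun ε₀ hε₀ => ?_)
  obtain ⟨ε, m, r, L₂, L₃, hε, hd, -, h3⟩ := h (min ε₀ ε₁) (lt_min hε₀ hε₁)
  refine ⟨ε, hd.pos, hε.trans (min_le_left _ _), ?_⟩
  have key := hexp n n' m r ε L₃ hd (hε.trans (min_le_right _ _)) h3
  refine eq_of_pow_mul_approx (x := 3 * √3) (L := L₃) hd.pos 1 ?_ ?_
  · simpa using key θ
  · simpa using key φ

end HasSmallDeformations

/-- The quadratic expression in the first order term of a deformation which governs the coexistence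
of caustics of rotation numbers `1/2` and `1/3`. -/
noncomputable def coexistenceForm (n n' : ℝ → ℝ) (θ : ℝ) : ℝ :=
  n' θ ^ 2 + n' (θ + 2 * π / 3) ^ 2 + n' (θ + 4 * π / 3) ^ 2 +
    2 * √3 / 3 * (n' θ * (n (θ + 4 * π / 3) - n (θ + 2 * π / 3)) +
      n' (θ + 2 * π / 3) * (n θ - n (θ + 4 * π / 3)) +
      n' (θ + 4 * π / 3) * (n (θ + 2 * π / 3) - n θ)) +
    (n θ ^ 2 + n (θ + 2 * π / 3) ^ 2 + n (θ + 4 * π / 3) ^ 2)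

/-- The triangles at θ and θ + π have as vertices the six ends of three diameters, so all values of
`m` cancel. The rest is simplified by the antisymmetry of `n` and the vanishing of its triangle
sums. -/
theorem coexistenceForm_eq {n n' m : ℝ → ℝ} (h2 : ∀ θ, n (θ + π) = -n θ)
    (h2' : ∀ θ, n' (θ + π) = -n' θ)
    (h3 : ∀ θ, n θ + n (θ + 2 * π / 3) + n (θ + 4 * π / 3) = 0) (θ : ℝ) :
    √3 / 3 * coexistenceForm n n' θ =
      triangleSecondOrderMax n n' m θ + triangleSecondOrderMax n n' m (θ + π) -
      √3 * ((m θ + m (θ + π) + n' (θ + π) ^ 2) +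
        (m (θ + 2 * π / 3) + m (θ + 2 * π / 3 + π) + n' (θ + 2 * π / 3 + π) ^ 2) +
        (m (θ + 4 * π / 3) + m (θ + 4 * π / 3 + π) + n' (θ + 4 * π / 3 + π) ^ 2)) := by
  have e1 : ∀ x, θ + π + x = θ + x + π := fun x => add_right_comm _ _ _
  simp only [coexistenceForm, triangleSecondOrderMax, e1, h2, h2']
  have h4 : n θ = -n (θ + 2 * π / 3) - n (θ + 4 * π / 3) := by linarith [h3 θ]
  obtain ⟨w, hw⟩ : ∃ w : ℝ, w = √3 := ⟨_, rfl⟩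
  have hw2 : w ^ 2 = 3 := by rw [hw]; exact Real.sq_sqrt (by norm_num)
  have hw3 : w ^ 3 = 3 * w := by rw [pow_succ, hw2]
  rw [h4, ← hw]
  ring_nf
  simp only [hw2, hw3]
  ring

/-- The number 2L₃ - 3√3 L₂ does not depend on the base point, and its orders 0 and 1 in ε vanish;
its ε² coefficient is √3/3 times the form. -/
theorem HasSmallDeformations.coexistenceForm_const {n n' : ℝ → ℝ} {N : ℝ}
    (h : HasSmallDeformations n n' N) (h2 : ∀ θ, n (θ + π) = -n θ)
    (h2' : ∀ θ, n' (θ + π) = -n' θ)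
    (h3 : ∀ θ, n θ + n (θ + 2 * π / 3) + n (θ + 4 * π / 3) = 0)
    (h3' : ∀ θ, n' θ + n' (θ + 2 * π / 3) + n' (θ + 4 * π / 3) = 0) (θ φ : ℝ) :
    coexistenceForm n n' θ = coexistenceForm n n' φ := by
  have hN := h.nonneg
  obtain ⟨C, hC, ε₁, hε₁, hexp⟩ := exists_maximal_chordLength_expansion hN
  obtain ⟨D, hD, ε₂, hε₂, hexp'⟩ := exists_maximal_triangle_second_order hN
  refine mul_left_cancel₀ (show √3 / 3 ≠ 0 by positivity)
    (eq_of_forall_exists_abs_sub_le_mul (C := 2 * (D + D + √3 * (C + C + C))) fun ε₀ hε₀ => ?_)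
  obtain ⟨ε, m, r, L₂, L₃, hε, hd, hL₂, hL₃⟩ := h (min ε₀ (min ε₁ ε₂)) (by positivity)
  refine ⟨ε, hd.pos, hε.trans (min_le_left _ _), ?_⟩
  have hε' := hε.trans (min_le_right _ _)
  have k2 := hexp n n' m r ε L₂ hd (hε'.trans (min_le_left _ _)) hL₂
  have k3 := fun θ => hexp' n n' m r ε L₃ hd (hε'.trans (min_le_right _ _)) hL₃ θ (h3 θ) (h3' θ)
  simp only [h2 _, add_neg_cancel, mul_zero, add_zero] at k2
  have key : ∀ θ, |(2 * L₃ - 3 * √3 * L₂) - (0 + ε ^ 2 * (√3 / 3 * coexistenceForm n n' θ))| ≤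
      (D + D + √3 * (C + C + C)) * ε ^ (2 + 1) := by
    intro θ
    rw [coexistenceForm_eq (m := m) h2 h2' h3]
    have e1 := (abs_add_le _ _).trans (add_le_add (k3 θ) (k3 (θ + π)))
    have e2 := abs_mul_le (abs_of_nonneg (Real.sqrt_nonneg 3)).le ((abs_add_le _ _).trans (add_le_add
      ((abs_add_le _ _).trans (add_le_add (k2 θ) (k2 (θ + 2 * π / 3)))) (k2 (θ + 4 * π / 3))))
    have e3 := (abs_sub _ _).trans (add_le_add e1 e2)
    refine le_trans (le_of_eq ?_) (e3.trans_eq ?_)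
    · congr 1; ring
    · ring
  exact eq_of_pow_mul_approx (x := 0) hd.pos 2 (key θ) (key φ)

/-! ### Rapidly decaying sequences orthogonal to their translates -/

/-- `a` maximizes `f a * 2 ^ (i * a)`. -/
def IsSlopeMax (f : ℤ → ℝ) (i : ℕ) (a : ℤ) : Prop :=
  ∀ b, f b * (2 : ℝ) ^ (i * b) ≤ f a * (2 : ℝ) ^ (i * a)

theorem two_zpow_le_exp {x : ℤ} (hx : 0 ≤ x) : (2 : ℝ) ^ x ≤ Real.exp x := by
  obtain ⟨k, rfl⟩ := Int.eq_ofNat_of_zero_le hx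
  rw [zpow_natCast, Int.cast_natCast, ← Real.exp_one_pow]
  gcongr
  linarith [Real.add_one_le_exp 1]

/-- Gaussian decay beats the exponential weight, so only finitely many indices compete with `a₀`. -/
theorem exists_isSlopeMax {f : ℤ → ℝ} {C : ℝ} (hf : ∀ k, f k ≤ C * Real.exp (-17 * (k : ℝ) ^ 2))
    (hC : 0 ≤ C) {a₀ : ℤ} (h0 : 0 < f a₀) (i : ℕ) : ∃ a, IsSlopeMax f i a := by
  set v := f a₀ * (2 : ℝ) ^ (i * a₀) with hv
  have hv0 : 0 < v := by positivity
  set s : Set ℤ := {a | v ≤ f a * (2 : ℝ) ^ (i * a)} with hs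
  have hfin : s.Finite := by
    have hb : ∀ a : ℤ, f a * (2 : ℝ) ^ (i * a) ≤ C * Real.exp (((i : ℝ) + 1) ^ 2 - |(a : ℝ)|) := by
      intro a
      have h1 : (2 : ℝ) ^ (i * a) ≤ Real.exp (i * |(a : ℝ)|) := by
        have h2 : (2 : ℝ) ^ ((i : ℤ) * a) ≤ (2 : ℝ) ^ ((i : ℤ) * |a|) :=
          zpow_le_zpow_right₀ (by norm_num) (by gcongr; exact le_abs_self a)
        refine h2.trans ((two_zpow_le_exp (by positivity)).trans (le_of_eq ?_))
        push_cast; rfl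
      calc f a * (2 : ℝ) ^ (i * a) ≤ C * Real.exp (-17 * (a : ℝ) ^ 2) * (2 : ℝ) ^ (i * a) := by
            gcongr; exact hf a
        _ ≤ C * Real.exp (-17 * (a : ℝ) ^ 2) * Real.exp (i * |(a : ℝ)|) := by gcongr
        _ = C * Real.exp (-17 * (a : ℝ) ^ 2 + i * |(a : ℝ)|) := by rw [mul_assoc, Real.exp_add]
        _ ≤ _ := by
            gcongr
            rw [← sq_abs]
            nlinarith [sq_nonneg (|(a : ℝ)| - (i + 1)), sq_nonneg (|(a : ℝ)|)]
    obtain ⟨M, hM⟩ : ∃ M : ℕ, C * Real.exp (((i : ℝ) + 1) ^ 2 - M) < v := by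
      have ht : Tendsto (fun M : ℕ => C * Real.exp (((i : ℝ) + 1) ^ 2 - M)) atTop (𝓝 (C * 0)) := by
        refine Tendsto.const_mul C (Real.tendsto_exp_atBot.comp ?_)
        simp only [sub_eq_add_neg]
        exact tendsto_atBot_add_const_left _ _ (tendsto_neg_atTop_atBot.comp
          tendsto_natCast_atTop_atTop)
      rw [mul_zero] at ht
      exact (ht.eventually (gt_mem_nhds hv0)).exists
    refine (Set.finite_Icc (-(M : ℤ)) M).subset fun a ha => ?_
    by_contra hna
    have h3 : (M : ℤ) < |a| := by
      by_contra! hc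
      exact hna (abs_le.1 hc)
    have h4 : (M : ℝ) ≤ |(a : ℝ)| := by exact_mod_cast h3.le
    have ha' : v ≤ f a * (2 : ℝ) ^ (i * a) := ha
    have h5 := ha'.trans (hb a)
    have h6 : C * Real.exp (((i : ℝ) + 1) ^ 2 - |(a : ℝ)|) ≤
        C * Real.exp (((i : ℝ) + 1) ^ 2 - M) := by gcongr
    linarith
  obtain ⟨a, ha, hmax⟩ := Set.exists_max_image s (fun a => f a * (2 : ℝ) ^ (i * a)) hfin
    ⟨a₀, le_refl v⟩
  refine ⟨a, fun b => ?_⟩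
  by_cases hb : b ∈ s
  · exact hmax b hb
  · exact (not_le.1 hb).le.trans ha

namespace IsSlopeMax

variable {f : ℤ → ℝ} {i j : ℕ} {a b : ℤ}

theorem pos (h : IsSlopeMax f i a) {a₀ : ℤ} (h0 : 0 < f a₀) : 0 < f a :=
  pos_of_mul_pos_left ((by positivity : 0 < f a₀ * (2 : ℝ) ^ (i * a₀)).trans_le (h a₀))
    (by positivity)

/-- Exchange argument: multiplying the two maximality inequalities leaves (j - i)(b - a) ≥ 0, as for
slopes of a Newton polygon. -/
theorem mono (ha : IsSlopeMax f i a) (hb : IsSlopeMax f j b) (hij : i < j) {a₀ : ℤ}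
    (h0 : 0 < f a₀) : a ≤ b := by
  have hfa := ha.pos h0
  have hfb := hb.pos h0
  by_contra! hba
  have h1 := mul_le_mul (ha b) (hb a) (by positivity) (by positivity)
  have h2 : f b * (2 : ℝ) ^ (i * b) * (f a * (2 : ℝ) ^ (j * a)) =
      (f a * f b) * (2 : ℝ) ^ (i * b + j * a) := by
    rw [zpow_add₀ two_ne_zero]; ring
  have h3 : f a * (2 : ℝ) ^ (i * a) * (f b * (2 : ℝ) ^ (j * b)) =
      (f a * f b) * (2 : ℝ) ^ (i * a + j * b) := by
    rw [zpow_add₀ two_ne_zero]; ring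
  rw [h2, h3] at h1
  have h4 := le_of_mul_le_mul_left h1 (mul_pos hfa hfb)
  rw [zpow_le_zpow_iff_right₀ (by norm_num)] at h4
  have hij' : (i : ℤ) < j := by exact_mod_cast hij
  nlinarith

/-- Relative to the intermediate slope, maximality for `i + 2` gains a factor 2 per step to the
right, and maximality for `i` does so to the left. -/
theorem le_of_adjacent (h1 : IsSlopeMax f i a) (h2 : IsSlopeMax f (i + 2) a) (k : ℤ) :
    f (a + k) * (2 : ℝ) ^ ((i + 1 : ℤ) * k) ≤ f a * (1 / 2) ^ k.natAbs := by
  have key : ∀ l : ℕ, IsSlopeMax f l a → f (a + k) * (2 : ℝ) ^ ((l : ℤ) * k) ≤ f a := by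
    intro l hl
    have := hl (a + k)
    rw [mul_add, zpow_add₀ two_ne_zero, mul_left_comm, mul_comm (f a)] at this
    exact le_of_mul_le_mul_left this (by positivity)
  rcases le_total 0 k with hk | hk
  · obtain ⟨l, rfl⟩ := Int.eq_ofNat_of_zero_le hk
    have h3 := key _ h2
    rw [show (((i + 2 : ℕ) : ℤ)) * (l : ℤ) = (i + 1 : ℤ) * l + l by push_cast; ring,
      zpow_add₀ two_ne_zero, ← mul_assoc] at h3
    rw [Int.natAbs_natCast, one_div, inv_pow, ← div_eq_mul_inv, le_div_iff₀ (by positivity)]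
    simpa using h3
  · obtain ⟨l, hl⟩ := Int.eq_ofNat_of_zero_le (neg_nonneg.2 hk)
    have hl : k = -(l : ℤ) := by simpa [neg_eq_iff_eq_neg] using hl
    have h3 := key _ h1
    rw [show (i : ℤ) * k = (i + 1 : ℤ) * k + l by rw [hl]; ring,
      zpow_add₀ two_ne_zero, ← mul_assoc] at h3
    rw [hl, Int.natAbs_neg, Int.natAbs_natCast, one_div, inv_pow, ← div_eq_mul_inv,
      le_div_iff₀ (by positivity), ← hl]
    simpa using h3

/-- Maximizers move at speed at most 1/8 in the slope: if `a` were further out, the weight, at most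
exp(16a²), could not offset the decay exp(-17a²). -/
theorem exists_le {f : ℤ → ℝ} {C : ℝ} (hf : ∀ k, f k ≤ C * Real.exp (-17 * (k : ℝ) ^ 2))
    (hC : 0 ≤ C) {a₀ : ℤ} (h0 : 0 < f a₀) :
    ∃ M : ℤ, ∀ i a, IsSlopeMax f i a → 8 * a ≤ i + M := by
  obtain ⟨M, hM⟩ : ∃ M : ℕ, C * Real.exp (-M) < f a₀ := by
    have ht : Tendsto (fun M : ℕ => C * Real.exp (-M)) atTop (𝓝 (C * 0)) :=
      Tendsto.const_mul C (Real.tendsto_exp_atBot.comp (tendsto_neg_atTop_atBot.comp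
          tendsto_natCast_atTop_atTop))
    rw [mul_zero] at ht
    exact (ht.eventually (gt_mem_nhds h0)).exists
  refine ⟨8 * (M + |a₀| + 1), fun i a h => ?_⟩
  by_contra! hc
  have hi : (0 : ℤ) ≤ i := by positivity
  have ha0 := abs_nonneg a₀
  have h1 : (i : ℤ) ≤ 8 * a := by linarith
  have h2 : |a₀| ≤ a := by linarith
  have h3 : (M : ℤ) ≤ a := by linarith
  have h4 : 1 ≤ a := by linarith
  have h5 := h a₀
  have h6 : f a₀ ≤ f a * (2 : ℝ) ^ (i * (a - a₀)) := by
    rw [mul_sub, zpow_sub₀ two_ne_zero, ← mul_div_assoc, le_div_iff₀ (by positivity)]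
    exact h5
  have h7 : 0 ≤ (i : ℤ) * (a - a₀) := mul_nonneg hi (by linarith [le_abs_self a₀])
  -- The 16 is 8 · 2, from `i ≤ 8 * a` and `a - a₀ ≤ 2 * a`.
  have h8 : (i : ℤ) * (a - a₀) ≤ 16 * a ^ 2 := by
    have : a - a₀ ≤ 2 * a := by linarith [neg_abs_le a₀]
    nlinarith
  have h9 : f a₀ ≤ C * Real.exp (-M) :=
    calc f a₀ ≤ f a * (2 : ℝ) ^ (i * (a - a₀)) := h6
      _ ≤ C * Real.exp (-17 * (a : ℝ) ^ 2) * Real.exp (16 * (a : ℝ) ^ 2) := by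
          refine mul_le_mul (hf a) ((two_zpow_le_exp h7).trans ?_) (by positivity) (by positivity)
          gcongr
          exact_mod_cast h8
      _ = C * Real.exp (-(a : ℝ) ^ 2) := by rw [mul_assoc, ← Real.exp_add]; ring_nf
      _ ≤ C * Real.exp (-M) := by
          gcongr
          have : (M : ℤ) ≤ a ^ 2 := by nlinarith
          exact_mod_cast this
  linarith

end IsSlopeMax

theorem hasSum_quarter_pow_natAbs_ne_zero :
    HasSum (fun j : ℤ => if j = 0 then (0 : ℝ) else (1 / 4) ^ j.natAbs) (2 / 3) := by
  have hg : HasSum (fun j : ℕ => (1 / 4 : ℝ) ^ (j + 1)) (1 / 3) := by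
    have := (hasSum_geometric_of_lt_one (r := (1 / 4 : ℝ)) (by norm_num) (by norm_num)).mul_right
      (1 / 4)
    simp only [← pow_succ] at this
    rwa [show (1 - 1 / 4 : ℝ)⁻¹ * (1 / 4) = 1 / 3 by norm_num] at this
  have h1 : HasSum (fun j : ℕ => if ((j : ℕ) : ℤ) = 0 then (0 : ℝ) else (1 / 4) ^ (j : ℤ).natAbs)
      (1 / 3) := by
    refine (hasSum_nat_add_iff' 1).1 ?_
    have e : ∀ j : ℕ, (if ((j + 1 : ℕ) : ℤ) = 0 then (0 : ℝ) else
        (1 / 4) ^ ((j + 1 : ℕ) : ℤ).natAbs) = (1 / 4) ^ (j + 1) := fun j => by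
      rw [if_neg (by omega), Int.natAbs_natCast]
    simpa only [Finset.range_one, Finset.sum_singleton, Nat.cast_zero, if_true, sub_zero, e] using hg
  have h2 : HasSum (fun j : ℕ => if (-((j : ℤ) + 1)) = 0 then (0 : ℝ) else
      (1 / 4) ^ (-((j : ℤ) + 1)).natAbs) (1 / 3) := by
    have e : ∀ j : ℕ, (if (-((j : ℤ) + 1)) = 0 then (0 : ℝ) else
        (1 / 4) ^ (-((j : ℤ) + 1)).natAbs) = (1 / 4) ^ (j + 1) := fun j => by
      rw [if_neg (by omega), show (-((j : ℤ) + 1)).natAbs = j + 1 by omega]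
    simpa only [e] using hg
  have h3 := HasSum.of_nat_of_neg_add_one (f := fun j : ℤ => if j = 0 then (0 : ℝ) else
    (1 / 4) ^ j.natAbs) h1 h2
  rwa [show (1 / 3 + 1 / 3 : ℝ) = 2 / 3 by norm_num] at h3

/-- The off-centre terms total at most 2/3 of the central one, so they cannot cancel it. -/
theorem not_hasSum_zero_of_dominated {g : ℤ → ℂ} (h0 : g 0 ≠ 0)
    (hg : ∀ j, ‖g j‖ ≤ ‖g 0‖ * (1 / 4) ^ j.natAbs) : ¬ HasSum g 0 := by
  intro hs
  have h1 : HasSum (fun j => if j = 0 then 0 else g j) (0 - g 0) := by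
    have := hs.sub (hasSum_ite_eq (0 : ℤ) (g 0))
    convert! this using 2 with j
    by_cases hj : j = 0 <;> simp [hj]
  have h2 := hasSum_quarter_pow_natAbs_ne_zero.mul_left ‖g 0‖
  have h3 := tsum_of_norm_bounded h2 (f := fun j => if j = 0 then 0 else g j) (fun j => by
    by_cases hj : j = 0
    · simp [hj]
    · simpa [hj] using hg j)
  rw [h1.tsum_eq, zero_sub, norm_neg] at h3
  have := norm_pos_iff.2 h0
  linarith

/-- A sequence which decays very rapidly, and is orthogonal to all its translates, has at most
one nonzero term. -/
theorem false_of_orthogonal_translates {h : ℤ → ℂ} {C : ℝ}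
    (hC : ∀ k, ‖h k‖ ≤ C * Real.exp (-17 * (k : ℝ) ^ 2))
    (horth : ∀ K : ℤ, K ≠ 0 → HasSum (fun a => h (a + K) * (starRingEnd ℂ) (h a)) 0)
    {a₀ a₁ : ℤ} (h01 : a₀ < a₁) (h0 : h a₀ ≠ 0) (h1 : h a₁ ≠ 0) : False := by
  set f : ℤ → ℝ := fun k => ‖h k‖ with hf
  set f' : ℤ → ℝ := fun k => ‖h (-k)‖ with hf'
  have hC0 : 0 ≤ C := by
    have := (norm_nonneg _).trans (hC 0)
    exact nonneg_of_mul_nonneg_left this (Real.exp_pos _)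
  have hfC : ∀ k, f k ≤ C := fun k => (hC k).trans (by
    apply mul_le_of_le_one_right hC0
    rw [Real.exp_le_one_iff]
    nlinarith [sq_nonneg (k : ℝ)])
  have hC' : ∀ k, f' k ≤ C * Real.exp (-17 * (k : ℝ) ^ 2) := fun k => by
    have := hC (-k)
    simpa using this
  have hp1 : 0 < f a₁ := norm_pos_iff.2 h1
  have hp0 : 0 < f' (-a₀) := by simpa [hf'] using h0
  -- `A i` is a vertex of the Newton polygon of slope parameter `i` on the right; `-B i` is its
  -- mirror counterpart on the left.
  choose A hA using exists_isSlopeMax hC hC0 hp1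
  choose B hB using exists_isSlopeMax hC' hC0 hp0
  obtain ⟨M, hM⟩ := IsSlopeMax.exists_le hC hC0 hp1
  obtain ⟨M', hM'⟩ := IsSlopeMax.exists_le hC' hC0 hp0
  -- If both vertices were the same index, its two maximality inequalities would bound 2^i, so the
  -- translation `A i + B i` is nonzero for large `i`.
  have hAB : ∀ i, A i + B i = 0 → f a₁ * f' (-a₀) * 2 ^ i ≤ C * C := by
    intro i hi
    have e1 := hA i a₁
    have e2 := hB i (-a₀)
    have hBi : B i = -A i := by linarith
    have e3 : f' (B i) = f (A i) := by simp [hf, hf', hBi]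
    rw [e3, hBi] at e2
    have e4 := mul_le_mul e1 e2 (by positivity) (by positivity)
    have e5 : f (A i) * (2 : ℝ) ^ (i * A i) * (f (A i) * (2 : ℝ) ^ (i * -A i)) =
        f (A i) * f (A i) := by
      rw [mul_neg, zpow_neg]; field_simp
    have e6 : f a₁ * (2 : ℝ) ^ (i * a₁) * (f' (-a₀) * (2 : ℝ) ^ (i * -a₀)) =
        f a₁ * f' (-a₀) * (2 : ℝ) ^ (i * (a₁ - a₀)) := by
      rw [show (i : ℤ) * (a₁ - a₀) = i * a₁ + i * -a₀ by ring, zpow_add₀ two_ne_zero]; ring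
    rw [e5, e6] at e4
    have e7 : (2 : ℝ) ^ i ≤ (2 : ℝ) ^ (i * (a₁ - a₀)) := by
      rw [← zpow_natCast]
      refine zpow_le_zpow_right₀ (by norm_num) ?_
      have : 1 ≤ a₁ - a₀ := by linarith
      exact le_mul_of_one_le_right (by positivity) this
    calc _ ≤ f a₁ * f' (-a₀) * (2 : ℝ) ^ (i * (a₁ - a₀)) := by gcongr
      _ ≤ _ := e4
      _ ≤ _ := mul_le_mul (hfC _) (hfC _) (norm_nonneg _) hC0
  obtain ⟨i₀, hi₀⟩ : ∃ i₀ : ℕ, ∀ i ≥ i₀, A i + B i ≠ 0 := by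
    have ht : Tendsto (fun i : ℕ => f a₁ * f' (-a₀) * (2 : ℝ) ^ i) atTop atTop :=
      Tendsto.const_mul_atTop (mul_pos hp1 hp0) (tendsto_pow_atTop_atTop_of_one_lt (by norm_num))
    obtain ⟨i₀, hi₀⟩ := eventually_atTop.1 (ht.eventually (eventually_gt_atTop (C * C)))
    exact ⟨i₀, fun i hi e => absurd (hAB i e) (not_le.2 (hi₀ i hi))⟩
  -- Both sequences are nondecreasing. Without a common pause over two steps, `A + B` would grow at
  -- rate at least 1/2, against the rate 1/8 + 1/8 allowed by `IsSlopeMax.exists_le`.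
  obtain ⟨i, hi, eA, eB⟩ : ∃ i ≥ i₀, A i = A (i + 2) ∧ B i = B (i + 2) := by
    by_contra! hno
    have hstep : ∀ k : ℕ, A i₀ + B i₀ + k ≤ A (i₀ + 2 * k) + B (i₀ + 2 * k) := by
      intro k
      induction k with
      | zero => simp
      | succ k ih =>
        have m1 := (hA (i₀ + 2 * k)).mono (hA (i₀ + 2 * k + 2)) (by omega) hp1
        have m2 := (hB (i₀ + 2 * k)).mono (hB (i₀ + 2 * k + 2)) (by omega) hp0
        have m3 := hno (i₀ + 2 * k) (by omega)
        rw [show i₀ + 2 * (k + 1) = i₀ + 2 * k + 2 by ring]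
        push_cast
        by_cases m4 : A (i₀ + 2 * k) = A (i₀ + 2 * k + 2)
        · have := m3 m4; omega
        · omega
    obtain ⟨k, hk⟩ : ∃ k : ℕ, 2 * (i₀ : ℤ) + M + M' - 8 * (A i₀ + B i₀) < k :=
      ⟨_, Int.lt_of_le_of_lt (Int.self_le_toNat _) (Nat.cast_lt.2 (Nat.lt_succ_self _))⟩
    have h2 := hM _ _ (hA (i₀ + 2 * k))
    have h3 := hM' _ _ (hB (i₀ + 2 * k))
    have h4 := hstep k
    push_cast at h2 h3
    linarith
  have hAi := hA i
  have hA2 := hA (i + 2)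
  rw [← eA] at hA2
  have hBi := hB i
  have hB2 := hB (i + 2)
  rw [← eB] at hB2
  -- Re-indexed at the two vertices, the opposite weights cancel in each product, and two factors
  -- 2^(-|j|) give 4^(-|j|).
  refine not_hasSum_zero_of_dominated (g := fun j => h (A i + j) * (starRingEnd ℂ) (h (-B i + j)))
    ?_ ?_ ?_
  · have n1 := norm_pos_iff.1 (hAi.pos hp1)
    have n2 := norm_pos_iff.1 (hBi.pos hp0)
    simpa using And.intro n1 n2
  · intro j
    have e1 := hAi.le_of_adjacent hA2 j
    have e2 := hBi.le_of_adjacent hB2 (-j)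
    have e3 := mul_le_mul e1 e2 (by positivity) (by positivity)
    have e4 : f (A i + j) * (2 : ℝ) ^ ((i + 1 : ℤ) * j) *
        (f' (B i + -j) * (2 : ℝ) ^ ((i + 1 : ℤ) * -j)) = f (A i + j) * f' (B i + -j) := by
      rw [mul_neg, zpow_neg]; field_simp
    rw [e4, Int.natAbs_neg] at e3
    have e5 : f' (B i + -j) = ‖h (-B i + j)‖ := by simp [hf', add_comm]
    rw [e5] at e3
    simp only [norm_mul, Complex.norm_conj, add_zero]
    refine e3.trans (le_of_eq ?_)
    have : (1 / 4 : ℝ) ^ j.natAbs = (1 / 2) ^ j.natAbs * (1 / 2) ^ j.natAbs := by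
      rw [← mul_pow]; norm_num
    rw [this]; simp only [hf']; ring
  · have := (Equiv.addLeft (-B i)).hasSum_iff.2 (horth (A i + B i) (hi₀ i hi))
    convert! this using 2 with j
    simp only [Function.comp_def, Equiv.coe_addLeft]
    rw [show -B i + j + (A i + B i) = A i + j by ring]

/-! ### Absolutely convergent Fourier series -/

/-- The exponential `e^{ikθ}`. -/
noncomputable def expMode (k : ℤ) (θ : ℝ) : ℂ := Complex.exp ((k : ℂ) * θ * Complex.I)

theorem norm_expMode (k : ℤ) (θ : ℝ) : ‖expMode k θ‖ = 1 := by
  rw [expMode, show (k : ℂ) * θ * Complex.I = ((k * θ : ℝ) : ℂ) * Complex.I by push_cast; ring,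
    Complex.norm_exp_ofReal_mul_I]

theorem continuous_expMode (k : ℤ) : Continuous (expMode k) := by
  unfold expMode; fun_prop

theorem expMode_mul (k l : ℤ) (θ : ℝ) : expMode k θ * expMode l θ = expMode (k + l) θ := by
  rw [expMode, expMode, expMode, ← Complex.exp_add]
  congr 1; push_cast; ring

theorem conj_expMode (k : ℤ) (θ : ℝ) : (starRingEnd ℂ) (expMode k θ) = expMode (-k) θ := by
  rw [expMode, expMode, ← Complex.exp_conj]
  congr 1; simp

theorem hasDerivAt_expMode (k : ℤ) (θ : ℝ) :
    HasDerivAt (expMode k) (Complex.I * k * expMode k θ) θ := by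
  have := ((((Complex.ofRealCLM.hasDerivAt (x := θ)).const_mul (k : ℂ)).mul_const Complex.I).cexp)
  convert! this using 1
  simp [expMode]
  ring

theorem integral_expMode (k : ℤ) :
    ∫ θ in (0 : ℝ)..2 * π, expMode k θ = if k = 0 then ((2 * π : ℝ) : ℂ) else 0 := by
  split_ifs with hk
  · subst hk
    simp [expMode]
  · have hk' : Complex.I * (k : ℂ) ≠ 0 :=
      mul_ne_zero Complex.I_ne_zero (by exact_mod_cast hk)
    have h1 := intervalIntegral.integral_eq_sub_of_hasDerivAt (a := 0) (b := 2 * π)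
      (f := fun θ => expMode k θ / (Complex.I * k)) (f' := expMode k) (fun θ _ => by
        have := (hasDerivAt_expMode k θ).div_const (Complex.I * k)
        rwa [mul_div_cancel_left₀ _ hk'] at this)
      ((continuous_expMode k).intervalIntegrable _ _)
    have h2 : expMode k (2 * π) = 1 := by
      rw [expMode, Complex.exp_eq_one_iff]
      exact ⟨k, by push_cast; ring⟩
    rw [h1, h2, show expMode k 0 = 1 by simp [expMode], sub_self]

theorem hasSum_integral_mul {c : ℤ → ℂ} {F : ℝ → ℂ} (hc : Summable fun k => ‖c k‖)
    (hF : ∀ θ, HasSum (fun k => c k * expMode k θ) (F θ)) {G : ℝ → ℂ} (hG : Continuous G) :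
    HasSum (fun k => c k * ∫ θ in (0 : ℝ)..2 * π, expMode k θ * G θ)
      (∫ θ in (0 : ℝ)..2 * π, F θ * G θ) := by
  have h1 := intervalIntegral.hasSum_integral_of_dominated_convergence
    (μ := MeasureTheory.volume) (a := 0) (b := 2 * π)
    (F := fun k θ => c k * (expMode k θ * G θ)) (f := fun θ => F θ * G θ)
    (fun k θ => ‖c k‖ * ‖G θ‖) ?_ ?_ ?_ ?_ ?_
  · simpa only [intervalIntegral.integral_const_mul] using h1
  · exact fun k => ((continuous_const.mul ((continuous_expMode k).mul
      hG)).aestronglyMeasurable)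
  · exact fun k => Eventually.of_forall fun θ _ => by
      rw [norm_mul, norm_mul, norm_expMode, one_mul]
  · exact Eventually.of_forall fun θ _ => hc.mul_right _
  · simp only [tsum_mul_right]
    exact (continuous_const.mul hG.norm).intervalIntegrable _ _
  · exact Eventually.of_forall fun θ _ => by
      simpa only [mul_assoc] using (hF θ).mul_right (G θ)

theorem coeff_eq_integral {c : ℤ → ℂ} {F : ℝ → ℂ} (hc : Summable fun k => ‖c k‖)
    (hF : ∀ θ, HasSum (fun k => c k * expMode k θ) (F θ)) (l : ℤ) :
    ∫ θ in (0 : ℝ)..2 * π, F θ * expMode (-l) θ = 2 * π * c l := by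
  have h1 := hasSum_integral_mul hc hF (continuous_expMode (-l))
  simp only [expMode_mul, integral_expMode] at h1
  have h2 : (fun k => c k * if k + -l = 0 then ((2 * π : ℝ) : ℂ) else 0) =
      fun k => if k = l then 2 * π * c l else 0 := by
    ext k
    by_cases hk : k = l
    · subst hk; simp; ring
    · rw [if_neg hk, if_neg (by omega), mul_zero]
  rw [h2] at h1
  exact h1.unique (hasSum_ite_eq l _)

theorem coeff_unique {c d : ℤ → ℂ} {F : ℝ → ℂ} (hc : Summable fun k => ‖c k‖)
    (hd : Summable fun k => ‖d k‖) (hF : ∀ θ, HasSum (fun k => c k * expMode k θ) (F θ))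
    (hF' : ∀ θ, HasSum (fun k => d k * expMode k θ) (F θ)) (l : ℤ) : c l = d l := by
  have h := (coeff_eq_integral hc hF l).symm.trans (coeff_eq_integral hd hF' l)
  have hπ : (2 * π : ℂ) ≠ 0 := by exact_mod_cast Real.two_pi_pos.ne'
  exact mul_left_cancel₀ hπ h

/-- The Fourier coefficients of a function of constant modulus are orthogonal to their
translates. -/
theorem hasSum_coeff_mul_conj_translate {c : ℤ → ℂ} {F : ℝ → ℂ} (hc : Summable fun k => ‖c k‖)
    (hF : ∀ θ, HasSum (fun k => c k * expMode k θ) (F θ)) (hFc : Continuous F) {κ : ℝ}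
    (hκ : ∀ θ, Complex.normSq (F θ) = κ) {K : ℤ} (hK : K ≠ 0) :
    HasSum (fun a => c (a + K) * (starRingEnd ℂ) (c a)) 0 := by
  have h1 := hasSum_integral_mul hc hF (G := fun θ => (starRingEnd ℂ) (F θ) * expMode (-K) θ)
    ((Complex.continuous_conj.comp hFc).mul (continuous_expMode _))
  have h2 : ∫ θ in (0 : ℝ)..2 * π, F θ * ((starRingEnd ℂ) (F θ) * expMode (-K) θ) = 0 := by
    simp only [← mul_assoc, Complex.mul_conj, hκ, intervalIntegral.integral_const_mul,
      integral_expMode]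
    rw [if_neg (by omega), mul_zero]
  have h3 : ∀ k, ∫ θ in (0 : ℝ)..2 * π, expMode k θ * ((starRingEnd ℂ) (F θ) * expMode (-K) θ) =
      2 * π * (starRingEnd ℂ) (c (k - K)) := by
    intro k
    have h4 := congrArg (starRingEnd ℂ) (coeff_eq_integral hc hF (k - K))
    rw [← intervalIntegral.intervalIntegral_conj] at h4
    simp only [map_mul, conj_expMode, neg_neg, Complex.conj_ofReal, map_ofNat] at h4
    rw [← h4]
    congr 1
    ext θ
    rw [sub_eq_add_neg, ← expMode_mul]
    ring
  rw [h2] at h1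
  simp only [h3] at h1
  have h5 := ((Equiv.addRight K).hasSum_iff.2 h1).mul_left ((2 * π : ℂ)⁻¹)
  have hπ : (2 * π : ℂ) ≠ 0 := by exact_mod_cast Real.two_pi_pos.ne'
  rw [mul_zero] at h5
  convert! h5 using 2 with a
  simp only [Function.comp_def, Equiv.coe_addRight, add_sub_cancel_right]
  field_simp

theorem hasSum_fourierCoefficient {n : ℝ → ℝ} (hper : Function.Periodic n (2 * π))
    (hc : Continuous n) (hs : Summable fun k => ‖fourierCoefficient n k‖) (θ : ℝ) :
    HasSum (fun k => fourierCoefficient n k * expMode k θ) (n θ : ℂ) := by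
  have : Fact (0 < 2 * π) := ⟨Real.two_pi_pos⟩
  have hper' : Function.Periodic (fun θ => (n θ : ℂ)) (2 * π) := fun x => by
    simp only [hper x]
  let f : C(AddCircle (2 * π), ℂ) := ⟨hper'.lift, by
    rw [show hper'.lift = _ from rfl]
    exact continuous_coinduced_dom.2 (by
      have : Continuous fun θ => (n θ : ℂ) := by fun_prop
      exact this)⟩
  have hcoef : ∀ k, fourierCoeff f k = fourierCoefficient n k := by
    intro k
    rw [fourierCoefficient, fourierCoeffOn_eq_integral, fourierCoeff_eq_intervalIntegral _ _ 0,
      zero_add, sub_zero]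
    congr 1
  have h1 := has_pointwise_sum_fourier_series_of_summable (f := f) (by
    rw [show fourierCoeff f = _ from funext hcoef]; exact hs.of_norm) (θ : AddCircle (2 * π))
  simp only [hcoef, smul_eq_mul, fourier_coe_apply] at h1
  have h2 : ∀ k : ℤ, Complex.exp (2 * π * Complex.I * k * θ / ((2 * π : ℝ) : ℂ)) = expMode k θ := by
    intro k
    have hπ : (π : ℂ) ≠ 0 := by exact_mod_cast Real.pi_ne_zero
    rw [expMode]
    congr 1
    push_cast
    field_simp
  simp only [h2] at h1
  exact h1

theorem hasSum_deriv {c : ℤ → ℂ} {n : ℝ → ℝ} {n' : ℝ → ℝ} (hn : ∀ θ, HasDerivAt n (n' θ) θ)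
    (hc : Summable fun k : ℤ => (|(k : ℝ)| + 1) * ‖c k‖)
    (h : ∀ θ, HasSum (fun k => c k * expMode k θ) (n θ : ℂ)) (θ : ℝ) :
    HasSum (fun k => Complex.I * k * c k * expMode k θ) (n' θ : ℂ) := by
  have hb : ∀ (k : ℤ) (y : ℝ), ‖Complex.I * k * c k * expMode k y‖ ≤ (|(k : ℝ)| + 1) * ‖c k‖ := by
    intro k y
    rw [norm_mul, norm_mul, norm_mul, norm_expMode, Complex.norm_I, one_mul, mul_one,
      Complex.norm_intCast]
    gcongr
    linarith
  have h1 := hasDerivAt_tsum (g := fun k y => c k * expMode k y)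
    (g' := fun k y => Complex.I * k * c k * expMode k y) hc
    (fun k y => by
      convert! (hasDerivAt_expMode k y).const_mul (c k) using 1; ring)
    hb (h 0).summable θ
  have h2 : (fun y => ∑' k, c k * expMode k y) = fun y => (n y : ℂ) := funext fun y => (h y).tsum_eq
  rw [h2] at h1
  have h3 := h1.unique (hn θ).ofReal_comp
  rw [← h3]
  exact (Summable.of_norm_bounded hc fun k => hb k θ).hasSum

/-! ### The function of constant modulus attached to a deformation -/

/-- The primitive cube root of unity `e^{2πi/3}`. -/
noncomputable def cubeRoot : ℂ := ⟨-(1 / 2), √3 / 2⟩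

/-- The function `ν' - iν`, where `ν` collects the Fourier modes of `n` congruent to `1`
modulo `3`. -/
noncomputable def modeDefect (n n' : ℝ → ℝ) (θ : ℝ) : ℂ :=
  1 / 3 * ((n' θ - Complex.I * n θ) +
    (starRingEnd ℂ) cubeRoot * (n' (θ + 2 * π / 3) - Complex.I * n (θ + 2 * π / 3)) +
    cubeRoot * (n' (θ + 4 * π / 3) - Complex.I * n (θ + 4 * π / 3)))

/-- Conceptually, n(θ + 2πj/3) = ωʲν + conj(ωʲν) with ω = e^{2πi/3}; summing over j turns the
squares into 6|ν'|² and 6|ν|², and the mixed terms into the cross term of 6|ν' - iν|². -/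
theorem normSq_modeDefect {n n' : ℝ → ℝ} {θ : ℝ}
    (h : n θ + n (θ + 2 * π / 3) + n (θ + 4 * π / 3) = 0)
    (h' : n' θ + n' (θ + 2 * π / 3) + n' (θ + 4 * π / 3) = 0) :
    Complex.normSq (modeDefect n n' θ) = coexistenceForm n n' θ / 6 := by
  have hw2 : √3 ^ 2 = (3 : ℝ) := Real.sq_sqrt (by norm_num)
  have e : n θ = -n (θ + 2 * π / 3) - n (θ + 4 * π / 3) := by linarith
  have e' : n' θ = -n' (θ + 2 * π / 3) - n' (θ + 4 * π / 3) := by linarith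
  rw [modeDefect, show (1 / 3 : ℂ) = ((1 / 3 : ℝ) : ℂ) by push_cast; rfl, map_mul,
    Complex.normSq_ofReal, Complex.normSq_apply, coexistenceForm]
  simp only [cubeRoot, Complex.add_re, Complex.add_im, Complex.sub_re, Complex.sub_im,
    Complex.mul_re, Complex.mul_im, Complex.conj_re, Complex.conj_im, Complex.I_re, Complex.I_im,
    Complex.ofReal_re, Complex.ofReal_im]
  rw [e, e']
  ring_nf
  simp only [hw2]
  ring

theorem expMode_add (k : ℤ) (θ φ : ℝ) : expMode k (θ + φ) = expMode k θ * expMode k φ := by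
  rw [expMode, expMode, expMode, ← Complex.exp_add]
  congr 1; push_cast; ring

theorem expMode_three_mul_add (l : ℤ) (r : ℤ) :
    expMode (3 * l + r) (2 * π / 3) = expMode r (2 * π / 3) := by
  rw [expMode, expMode, show ((3 * l + r : ℤ) : ℂ) * ((2 * π / 3 : ℝ) : ℂ) * Complex.I =
    (r : ℂ) * ((2 * π / 3 : ℝ) : ℂ) * Complex.I + l * (2 * π * Complex.I) by push_cast; ring,
    Complex.exp_add, Complex.exp_int_mul_two_pi_mul_I, mul_one]

theorem expMode_one_two_pi_div_three : expMode 1 (2 * π / 3) = cubeRoot := by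
  rw [expMode, Int.cast_one, one_mul]
  apply Complex.ext
  · rw [Complex.exp_ofReal_mul_I_re, cos_two_pi_div_three, cubeRoot]
  · rw [Complex.exp_ofReal_mul_I_im, sin_two_pi_div_three, cubeRoot]

theorem expMode_four_pi_div_three (k : ℤ) :
    expMode k (4 * π / 3) = expMode k (2 * π / 3) * expMode k (2 * π / 3) := by
  rw [← expMode_add]; congr 1; ring

theorem cubeRoot_mul_self : cubeRoot * cubeRoot = (starRingEnd ℂ) cubeRoot := by
  have hw2 : √3 * √3 = (3 : ℝ) := Real.mul_self_sqrt (by norm_num)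
  apply Complex.ext
  · simp [cubeRoot]; linarith
  · simp [cubeRoot]; ring

theorem cubeRoot_mul_conj : cubeRoot * (starRingEnd ℂ) cubeRoot = 1 := by
  have hw2 : √3 * √3 = (3 : ℝ) := Real.mul_self_sqrt (by norm_num)
  rw [Complex.mul_conj, Complex.normSq_apply]
  simp only [cubeRoot]
  norm_cast
  linarith

theorem norm_cubeRoot : ‖cubeRoot‖ = 1 := by
  rw [← expMode_one_two_pi_div_three, norm_expMode]

/-- The factor by which the projection to the modes congruent to `1` modulo `3` multiplies the
`k`-th mode. -/
noncomputable def modeProjection (k : ℤ) : ℂ :=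
  1 / 3 * (1 + (starRingEnd ℂ) cubeRoot * expMode k (2 * π / 3) + cubeRoot * expMode k (4 * π / 3))

theorem norm_modeProjection_le (k : ℤ) : ‖modeProjection k‖ ≤ 1 := by
  rw [modeProjection, norm_mul]
  have h : ‖1 + (starRingEnd ℂ) cubeRoot * expMode k (2 * π / 3) +
      cubeRoot * expMode k (4 * π / 3)‖ ≤ 1 + 1 + 1 := by
    refine (norm_add_le _ _).trans (add_le_add ((norm_add_le _ _).trans (add_le_add ?_ ?_)) ?_)
    · simp
    · rw [norm_mul, Complex.norm_conj, norm_cubeRoot, norm_expMode, one_mul]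
    · rw [norm_mul, norm_cubeRoot, norm_expMode, one_mul]
  norm_num at h ⊢
  linarith

/-- Only this residue class matters below; for the others `norm_modeProjection_le` suffices. -/
theorem modeProjection_eq_one (l : ℤ) : modeProjection (3 * l + 1) = 1 := by
  rw [modeProjection, expMode_four_pi_div_three, expMode_three_mul_add,
    expMode_one_two_pi_div_three, cubeRoot_mul_self, mul_comm _ cubeRoot, cubeRoot_mul_conj]
  norm_num

section FourierModes

variable {n n' : ℝ → ℝ} {c : ℤ → ℂ}

/-- The factor `k - 1` vanishes only for the mode `k = 1`, which to first order corresponds to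
translating the circle. -/
theorem hasSum_modeDefect (h : ∀ θ, HasSum (fun k => c k * expMode k θ) (n θ : ℂ))
    (h' : ∀ θ, HasSum (fun k => Complex.I * k * c k * expMode k θ) (n' θ : ℂ)) (θ : ℝ) :
    HasSum (fun k => modeProjection k * (Complex.I * (k - 1)) * c k * expMode k θ)
      (modeDefect n n' θ) := by
  have h1 : ∀ θ, HasSum (fun k => (Complex.I * (k - 1)) * c k * expMode k θ)
      (n' θ - Complex.I * n θ) := fun θ => by
    convert! (h' θ).sub ((h θ).mul_left Complex.I) using 2 with k
    ring
  convert! (((h1 θ).add ((h1 (θ + 2 * π / 3)).mul_left ((starRingEnd ℂ) cubeRoot))).add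
    ((h1 (θ + 4 * π / 3)).mul_left cubeRoot)).mul_left (1 / 3) using 2 with k
  rw [expMode_add, expMode_add, modeProjection]
  ring

theorem coeff_three_mul_eq_zero (hc : Summable fun k => ‖c k‖)
    (h : ∀ θ, HasSum (fun k => c k * expMode k θ) (n θ : ℂ))
    (h3 : ∀ θ, n θ + n (θ + 2 * π / 3) + n (θ + 4 * π / 3) = 0) (l : ℤ) : c (3 * l) = 0 := by
  set d : ℤ → ℂ := fun k => (1 + expMode k (2 * π / 3) + expMode k (4 * π / 3)) * c k with hd
  have hdn : ∀ k, ‖d k‖ ≤ 3 * ‖c k‖ := fun k => by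
    rw [hd, norm_mul]
    gcongr
    refine (norm_add_le _ _).trans ((add_le_add (norm_add_le _ _) le_rfl).trans ?_)
    rw [norm_expMode, norm_expMode]; norm_num
  have h1 : ∀ θ, HasSum (fun k => d k * expMode k θ) (0 : ℂ) := fun θ => by
    have h2 := ((h θ).add (h (θ + 2 * π / 3))).add (h (θ + 4 * π / 3))
    rw [← Complex.ofReal_add, ← Complex.ofReal_add, h3, Complex.ofReal_zero] at h2
    convert! h2 using 2 with k
    rw [expMode_add, expMode_add, hd]
    ring
  have h2 := coeff_unique (d := fun _ => 0) (F := fun _ => 0)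
    (Summable.of_nonneg_of_le (fun _ => norm_nonneg _) hdn (hc.mul_left 3)) (by simp)
    h1 (fun θ => by simp) (3 * l)
  have h4 : expMode (3 * l) (2 * π / 3) = 1 := by
    rw [← add_zero (3 * l), expMode_three_mul_add]; simp [expMode]
  simp only [hd, expMode_four_pi_div_three, h4] at h2
  norm_num at h2
  exact h2

theorem coeff_neg (hc : Summable fun k => ‖c k‖)
    (h : ∀ θ, HasSum (fun k => c k * expMode k θ) (n θ : ℂ)) (k : ℤ) :
    c (-k) = (starRingEnd ℂ) (c k) := by
  refine (coeff_unique (d := fun k => (starRingEnd ℂ) (c (-k))) (F := fun θ => (n θ : ℂ)) hc ?_ h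
    (fun θ => ?_) (-k)).trans (by rw [neg_neg])
  · simp only [Complex.norm_conj]
    exact (Equiv.neg ℤ).summable_iff.2 hc
  · have h1 := (Complex.hasSum_conj' ).2 (h θ)
    rw [Complex.conj_ofReal] at h1
    convert! (Equiv.neg ℤ).hasSum_iff.2 h1 using 2 with k
    simp [conj_expMode]

end FourierModes

/-! ### Decay of the coefficients -/

theorem abs_intCast_eq_natAbs (k : ℤ) : |(k : ℝ)| = k.natAbs := by
  rw [← Int.cast_abs, Int.abs_eq_natAbs]; simp

/-- Gaussian decay is all that is used of the growth of `w`. The weight `|k| + 1` pays for the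
differentiation in `modeDefect`. -/
theorem exists_coefficient_bound {n : ℝ → ℝ} {w : ℤ → ℝ} (hw : IsModularFunction n w)
    (hdecay : Tendsto (fun i : ℕ => w i / 2 ^ i) atTop atTop) :
    ∃ C : ℝ, ∀ k : ℤ, (|(k : ℝ)| + 1) * ‖fourierCoefficient n k‖ ≤
      C * Real.exp (-17 * (k : ℝ) ^ 2) := by
  -- Eventually w(i) ≥ 2^i ≥ 18i²: 17 for the Gaussian and 1 to absorb |k| + 1 ≤ e^{|k|}. The
  -- remaining indices are covered by the constant.
  have h1 := (tendsto_pow_const_div_const_pow_of_one_lt 2 (r := (2 : ℝ)) (by norm_num)).eventually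
    (gt_mem_nhds (show (0 : ℝ) < 1 / 18 by norm_num))
  obtain ⟨i₀, hi₀⟩ := eventually_atTop.1 (h1.and (hdecay.eventually_ge_atTop 1))
  have hwabs : ∀ k : ℤ, w k = w k.natAbs := fun k => by
    rcases Int.natAbs_eq k with h | h
    · exact congrArg w h
    · rw [← hw.even]; congr 1; omega
  refine ⟨Real.exp (i₀ + 17 * (i₀ : ℝ) ^ 2), fun k => ?_⟩
  have h2 : |(k : ℝ)| + 1 ≤ Real.exp |(k : ℝ)| := Real.add_one_le_exp _
  have h3 : (|(k : ℝ)| + 1) * ‖fourierCoefficient n k‖ ≤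
      Real.exp (|(k : ℝ)| - w k.natAbs) := by
    rw [sub_eq_add_neg, Real.exp_add, ← hwabs]
    exact mul_le_mul h2 (hw.bound k) (norm_nonneg _) (Real.exp_pos _).le
  refine h3.trans ?_
  rw [← Real.exp_add, ← sq_abs (k : ℝ), abs_intCast_eq_natAbs k]
  gcongr
  set i := k.natAbs
  rcases le_total i₀ i with hi | hi
  · obtain ⟨h4, h5⟩ := hi₀ i hi
    have h2i : (0 : ℝ) < 2 ^ i := by positivity
    rw [div_lt_iff₀ h2i] at h4
    rw [le_div_iff₀ h2i] at h5
    have h6 : (i : ℝ) ≤ (i : ℝ) ^ 2 := by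
      exact_mod_cast Nat.le_self_pow two_ne_zero i
    have h7 : (0 : ℝ) ≤ i₀ + 17 * (i₀ : ℝ) ^ 2 := by positivity
    linarith
  · have h4 := hw.pos i
    have h5 : (i : ℝ) ≤ i₀ := by exact_mod_cast hi
    have h6 : (i : ℝ) ^ 2 ≤ (i₀ : ℝ) ^ 2 := by gcongr
    linarith

theorem summable_exp_neg_sq : Summable fun k : ℤ => Real.exp (-17 * (k : ℝ) ^ 2) := by
  have hg : Summable fun k : ℤ => (Real.exp (-1)) ^ k.natAbs := by
    have h1 : Summable fun k : ℕ => (Real.exp (-1)) ^ k :=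
      summable_geometric_of_lt_one (Real.exp_pos _).le (by rw [Real.exp_lt_one_iff]; norm_num)
    exact Summable.of_nat_of_neg (by simp [h1]) (by simp [h1])
  refine Summable.of_nonneg_of_le (fun _ => (Real.exp_pos _).le) (fun k => ?_) hg
  rw [← Real.exp_nat_mul, Real.exp_le_exp, ← sq_abs, abs_intCast_eq_natAbs]
  have h1 : (k.natAbs : ℝ) ≤ (k.natAbs : ℝ) ^ 2 := by
    exact_mod_cast Nat.le_self_pow two_ne_zero k.natAbs
  linarith [sq_nonneg (k.natAbs : ℝ)]

/-! ### Bounds for periodic functions -/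

theorem exists_abs_le_of_periodic {f : ℝ → ℝ} (hf : Continuous f)
    (hper : Function.Periodic f (2 * π)) : ∃ M : ℝ, 0 ≤ M ∧ ∀ x, |f x| ≤ M := by
  obtain ⟨M, hM⟩ := isCompact_Icc.exists_bound_of_continuousOn (s := Icc 0 (2 * π))
    hf.continuousOn
  refine ⟨M, (norm_nonneg _).trans (hM 0 ⟨le_rfl, Real.two_pi_pos.le⟩), fun x => ?_⟩
  obtain ⟨y, hy, e⟩ := hper.exists_mem_Ico₀ Real.two_pi_pos x
  rw [e]
  exact hM y ⟨hy.1, hy.2.le⟩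

theorem periodic_deriv {f : ℝ → ℝ} {T : ℝ} (hper : Function.Periodic f T) :
    Function.Periodic (deriv f) T := fun x => by
  rw [← deriv_comp_add_const f T x]
  congr 1
  exact funext hper

theorem exists_second_order_bound {n : ℝ → ℝ} (hn : ContDiff ℝ 2 n)
    (hper : Function.Periodic n (2 * π)) :
    ∃ M : ℝ, 0 ≤ M ∧ (∀ x, |n x| ≤ M) ∧ (∀ x, |deriv n x| ≤ M) ∧
      ∀ x h, |n (x + h) - n x - deriv n x * h| ≤ M * h ^ 2 := by
  have hn1 : ContDiff ℝ 1 (deriv n) := hn.deriv'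
  have hd : ∀ x, HasDerivAt n (deriv n x) x := fun x =>
    ((hn.differentiable (by norm_num)) x).hasDerivAt
  have hd2 : ∀ x, HasDerivAt (deriv n) (deriv (deriv n) x) x := fun x =>
    ((hn1.differentiable (by norm_num)) x).hasDerivAt
  obtain ⟨M₀, h0, hM₀⟩ := exists_abs_le_of_periodic hn.continuous hper
  obtain ⟨M₁, h1, hM₁⟩ := exists_abs_le_of_periodic hn1.continuous (periodic_deriv hper)
  obtain ⟨M₂, h2, hM₂⟩ := exists_abs_le_of_periodic (hn1.continuous_deriv (by norm_num))
    (periodic_deriv (periodic_deriv hper))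
  refine ⟨M₀ + M₁ + M₂, by positivity, fun x => (hM₀ x).trans (by linarith),
    fun x => (hM₁ x).trans (by linarith), fun x h => ?_⟩
  have hlip : ∀ t, |deriv n t - deriv n x| ≤ M₂ * |t - x| := fun t => by
    simpa using Convex.norm_image_sub_le_of_norm_hasDerivWithin_le (s := univ) (C := M₂)
      (fun y _ => (hd2 y).hasDerivWithinAt) (fun y _ => hM₂ y) convex_univ (mem_univ x) (mem_univ t)
  have h3 := Convex.norm_image_sub_le_of_norm_hasDerivWithin_le (s := uIcc x (x + h))
    (C := M₂ * |h|) (f := fun t => n t - deriv n x * t)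
    (f' := fun t => deriv n t - deriv n x) (x := x) (y := x + h)
    (fun y _ => by
      have := (hd y).sub ((hasDerivAt_id y).const_mul (deriv n x))
      rw [mul_one] at this
      exact this.hasDerivWithinAt)
    (fun y hy => (hlip y).trans (mul_le_mul_of_nonneg_left
      (by simpa using abs_sub_left_of_mem_uIcc hy) h2)) (convex_uIcc _ _) left_mem_uIcc right_mem_uIcc
  rw [add_sub_cancel_left, Real.norm_eq_abs, Real.norm_eq_abs, mul_assoc, abs_mul_abs_self, ← sq] at h3
  calc _ = |n (x + h) - deriv n x * (x + h) - (n x - deriv n x * x)| := by ring_nf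
    _ ≤ M₂ * h ^ 2 := h3
    _ ≤ _ := by gcongr; linarith

theorem integral_comp_add_eq_zero {n : ℝ → ℝ} (hper : Function.Periodic n (2 * π))
    (h0 : ∫ θ in (0 : ℝ)..2 * π, n θ = 0) (a : ℝ) :
    ∫ θ in (0 : ℝ)..2 * π, n (θ + a) = 0 := by
  rw [intervalIntegral.integral_comp_add_right, zero_add, add_comm (2 * π) a,
    hper.intervalIntegral_add_eq a 0, zero_add, h0]

theorem eq_zero_of_const_of_integral_eq_zero {f : ℝ → ℝ} (hf : ∀ x y, f x = f y)
    (h0 : ∫ θ in (0 : ℝ)..2 * π, f θ = 0) (x : ℝ) : f x = 0 := by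
  rw [show f = fun _ => f x from funext fun y => hf y x, intervalIntegral.integral_const,
    smul_eq_mul, sub_zero] at h0
  exact (mul_eq_zero.1 h0).resolve_left Real.two_pi_pos.ne'

/-! ### The main theorem -/

/-- Sharpness of `w` makes coefficients nonzero at arbitrarily large indices. Residue 0 modulo 3 is
excluded, and residue 2 becomes residue 1 under `k ↦ -k`; hence the absolute value. -/
theorem exists_coeff_ne_zero {n : ℝ → ℝ} {w : ℤ → ℝ} (hw : IsModularFunction n w)
    (h0 : ∀ l : ℤ, fourierCoefficient n (3 * l) = 0)
    (hneg : ∀ k, fourierCoefficient n (-k) = (starRingEnd ℂ) (fourierCoefficient n k)) (M : ℤ) :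
    ∃ l : ℤ, M < |3 * l + 1| ∧ fourierCoefficient n (3 * l + 1) ≠ 0 := by
  obtain ⟨k, hk, L, hL, ht⟩ := hw.sharp
  obtain ⟨i, hi, hiM⟩ := ((ht.eventually (lt_mem_nhds hL)).and
    (eventually_gt_atTop M.toNat)).exists
  have hne : fourierCoefficient n (k i) ≠ 0 := by
    intro e
    rw [e, norm_zero, zero_div] at hi
    exact lt_irrefl _ hi
  have hki : M < k i := by
    have h1 := hk.id_le i
    have h2 := Int.self_le_toNat M
    simp only [id] at h1
    omega
  rcases (by omega : (k i : ℤ) % 3 = 0 ∨ (k i : ℤ) % 3 = 1 ∨ (k i : ℤ) % 3 = 2) with h | h | h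
  · exact (hne (by rw [show (k i : ℤ) = 3 * ((k i : ℤ) / 3) by omega]; exact h0 _)).elim
  · refine ⟨(k i : ℤ) / 3, ?_, ?_⟩ <;> rw [show 3 * ((k i : ℤ) / 3) + 1 = k i by omega]
    · exact hki.trans_le (le_abs_self _)
    · exact hne
  · refine ⟨-((k i : ℤ) / 3) - 1, ?_, ?_⟩ <;>
      rw [show 3 * (-((k i : ℤ) / 3) - 1) + 1 = -(k i : ℤ) by omega]
    · rw [abs_neg]; exact hki.trans_le (le_abs_self _)
    · rw [hneg]; exact (map_ne_zero _).2 hne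

theorem HasSmallDeformations.false_of_isModularFunction {n : ℝ → ℝ} {N : ℝ}
    (h : HasSmallDeformations n (deriv n) N) (hper : Function.Periodic n (2 * π))
    (hn : ContDiff ℝ 2 n) (hint : ∫ θ in (0 : ℝ)..2 * π, n θ = 0) {w : ℤ → ℝ}
    (hw : IsModularFunction n w)
    (hdecay : Tendsto (fun i : ℕ => w i / 2 ^ i) atTop atTop) : False := by
  have hd : ∀ x, HasDerivAt n (deriv n x) x := fun x =>
    ((hn.differentiable (by norm_num)) x).hasDerivAt
  have hshift : ∀ a x, HasDerivAt (fun y => n (y + a)) (deriv n (x + a)) x := fun a x =>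
    (hd (x + a)).comp_add_const x a
  have hint' : ∀ a, IntervalIntegrable (fun θ => n (θ + a)) MeasureTheory.volume 0 (2 * π) :=
    fun a => (hn.continuous.comp (continuous_id.add continuous_const)).intervalIntegrable _ _
  have hz := integral_comp_add_eq_zero hper hint
  have h2 : ∀ θ, n (θ + π) = -n θ := by
    intro θ
    have := eq_zero_of_const_of_integral_eq_zero h.add_antipode_eq (by
      rw [intervalIntegral.integral_add (by simpa using hint' 0) (hint' π), hint, hz, add_zero]) θ
    linarith
  have h3 : ∀ θ, n θ + n (θ + 2 * π / 3) + n (θ + 4 * π / 3) = 0 :=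
    eq_zero_of_const_of_integral_eq_zero h.add_triangle_eq (by
      rw [intervalIntegral.integral_add ((by simpa using hint' 0 : IntervalIntegrable n _ _ _).add
        (hint' _)) (hint' _), intervalIntegral.integral_add (by simpa using hint' 0) (hint' _),
        hint, hz, hz, add_zero, add_zero])
  have h2' : ∀ θ, deriv n (θ + π) = -deriv n θ := fun θ => by
    have h4 := hshift π θ
    rw [show (fun y => n (y + π)) = fun y => -n y from funext h2] at h4
    exact h4.unique (hd θ).fun_neg
  have h3' : ∀ θ, deriv n θ + deriv n (θ + 2 * π / 3) + deriv n (θ + 4 * π / 3) = 0 := fun θ => by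
    have h4 := ((hd θ).fun_add (hshift (2 * π / 3) θ)).fun_add (hshift (4 * π / 3) θ)
    rw [show (fun y => n y + n (y + 2 * π / 3) + n (y + 4 * π / 3)) = fun _ => 0 from
      funext h3] at h4
    exact h4.unique (hasDerivAt_const θ 0)
  obtain ⟨C, hC⟩ := exists_coefficient_bound hw hdecay
  set c : ℤ → ℂ := fourierCoefficient n with hc
  have hs1 : Summable fun k : ℤ => (|(k : ℝ)| + 1) * ‖c k‖ :=
    Summable.of_nonneg_of_le (fun k => by positivity) hC (summable_exp_neg_sq.mul_left C)
  have hs : Summable fun k : ℤ => ‖c k‖ :=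
    Summable.of_nonneg_of_le (fun k => norm_nonneg _) (fun k =>
      le_mul_of_one_le_left (norm_nonneg _) (by linarith [abs_nonneg (k : ℝ)])) hs1
  have hF := hasSum_fourierCoefficient hper hn.continuous hs
  have hH := hasSum_modeDefect hF (hasSum_deriv hd hs1 hF)
  set e : ℤ → ℂ := fun k => modeProjection k * (Complex.I * (k - 1)) * c k with he
  have hen : ∀ k, ‖e k‖ ≤ (|(k : ℝ)| + 1) * ‖c k‖ := fun k => by
    rw [he, norm_mul, norm_mul, norm_mul, Complex.norm_I, one_mul]
    gcongr
    refine (mul_le_of_le_one_left (norm_nonneg _) (norm_modeProjection_le k)).trans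
      ((norm_sub_le _ _).trans (le_of_eq ?_))
    rw [Complex.norm_intCast, norm_one]
  have hne : ∀ l : ℤ, 1 < |3 * l + 1| → c (3 * l + 1) ≠ 0 → e (3 * l + 1) ≠ 0 := by
    intro l hl hcl
    rw [he]
    refine mul_ne_zero (mul_ne_zero ?_ (mul_ne_zero Complex.I_ne_zero ?_)) hcl
    · rw [modeProjection_eq_one]; exact one_ne_zero
    · intro h0
      have h1 : ((3 * l + 1 : ℤ) : ℂ) = 1 := sub_eq_zero.1 h0
      have h2 : 3 * l + 1 = 1 := by exact_mod_cast h1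
      rw [h2] at hl
      norm_num at hl
  have hmod : Continuous (modeDefect n (deriv n)) := by
    have h1 := hn.continuous
    have h2 := hn.continuous_deriv (by norm_num)
    unfold modeDefect
    fun_prop
  have horth : ∀ K : ℤ, K ≠ 0 → HasSum (fun a => e (a + K) * (starRingEnd ℂ) (e a)) 0 :=
    fun K hK => hasSum_coeff_mul_conj_translate
      (Summable.of_nonneg_of_le (fun _ => norm_nonneg _) hen hs1) hH hmod
      (κ := coexistenceForm n (deriv n) 0 / 6) (fun θ => by
        rw [normSq_modeDefect (h3 θ) (h3' θ), h.coexistenceForm_const h2 h2' h3 h3' θ 0]) hK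
  have hex := exists_coeff_ne_zero hw (coeff_three_mul_eq_zero hs hF h3) (coeff_neg hs hF)
  -- The bound 1 avoids the killed mode `k = 1`; the second index exceeds the first in absolute
  -- value, so they differ.
  obtain ⟨l, hl, hcl⟩ := hex 1
  obtain ⟨l', hl', hcl'⟩ := hex |3 * l + 1|
  have hel := hne l hl hcl
  have hel' := hne l' (hl.trans hl') hcl'
  have hbd := fun k => (hen k).trans (hC k)
  rcases lt_trichotomy (3 * l + 1) (3 * l' + 1) with h4 | h4 | h4
  · exact false_of_orthogonal_translates hbd horth h4 hel hel'
  · rw [h4] at hl'; exact lt_irrefl _ hl'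
  · exact false_of_orthogonal_translates hbd horth h4 hel' hel

theorem mainTheorem1 (n : ℝ → ℝ) (hper : Function.Periodic n (2 * π))
    (hanalytic : AnalyticOnNhd ℝ n univ) (heven : ∀ θ, n (-θ) = n θ) (hnorm : IsNormalized n)
    (w : ℤ → ℝ) (hw : IsModularFunction n w)
    (hdecay : Tendsto (fun i : ℕ => w i / 2 ^ i) atTop atTop) (K : ℝ≥0) :
    ∃ ε₀ : ℝ, 0 < ε₀ ∧
      ∀ (m : ℝ → ℝ) (r : ℝ → ℝ → ℝ),
        Function.Periodic m (2 * π) → (∀ θ, |m θ| ≤ K) → LipschitzWith K m →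
        ∀ ε : ℝ, 0 < ε → ε ≤ ε₀ →
          IsBilliardTable (r ε) →
          (∀ θ, |r ε θ - (1 + ε * n θ + ε ^ 2 * m θ)| ≤ K * ε ^ 3) →
          ¬ (HasRationalCaustic (r ε) 1 2 ∧ HasRationalCaustic (r ε) 1 3) := by
  have hn : ContDiff ℝ 2 n := hanalytic.contDiff
  obtain ⟨M, hM0, hM, hM', hM''⟩ := exists_second_order_bound hn hper
  -- The negation supplies a table with both caustics below every threshold, each with its own `m`
  -- and `r` but with the same bounds `M + K`.
  by_contra! hno
  refine HasSmallDeformations.false_of_isModularFunction (N := M + K) (fun ε₀ hε₀ => ?_) hper hn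
    hnorm.integral_zero hw hdecay
  obtain ⟨m, r, -, hmK, hmL, ε, hε0, hε, htable, happrox, hc2, hc3⟩ := hno (min ε₀ 1) (by positivity)
  obtain ⟨L₂, hL₂⟩ := exists_maximal_chordLength htable hc2
  obtain ⟨L₃, hL₃⟩ := exists_maximal_triangle htable hc3
  have hK : (0 : ℝ) ≤ K := K.2
  refine ⟨ε, m, r ε, L₂, L₃, hε.trans (min_le_left _ _),
    ⟨hε0, hε.trans (min_le_right _ _), fun x => (hM x).trans (by linarith),
      fun x => (hM' x).trans (by linarith), fun x h => (hM'' x h).trans ?_,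
      fun x => (hmK x).trans (by linarith), fun x h => ?_, fun x => (happrox x).trans ?_⟩,
    hL₂, hL₃⟩
  · gcongr; linarith
  · have := hmL.dist_le_mul (x + h) x
    rw [Real.dist_eq, Real.dist_eq, add_sub_cancel_left] at this
    refine this.trans ?_
    gcongr; linarith
  · gcongr; linarith
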